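/- **Setting.** Let $\mathcal Q$ be a bipartite quiver with finite vertex set $V=V_{\rm source}\sqcup V_{\rm target}$ and arrows $h_1,\dots,h_r$, $h_k:{\rm s}(h_k)\to{\rm t}(h_k)$, with ${\rm s}(h_k)\in V_{\rm source}$, ${\rm t}(h_k)\in V_{\rm target}$, and let $\mathbf m=(m_\gamma)_{\gamma\in V}$, $\mathbf u=(u_\gamma)_{\gamma\in V}$ be tuples of nonnegative integers. Let $X^{(k)}$ be an $m_{{\rm t}(h_k)}\times m_{{\rm s}(h_k)}$ array ("page $k$"), and let $L$ be the set of all $(i,j,k)$ with $1\le k\le r$, $1\le i\le m_{{\rm t}(h_k)}$, $1\le j\le m_{{\rm s}(h_k)}$. For a target $\alpha$ let $A_\alpha$ be the block array obtained by putting the $X^{(k)}$ with ${\rm t}(h_k)=\alpha$ side by side (in increasing order of $k$, from left to right); for a source $\beta$ let $A_\beta$ be obtained by putting the $X^{(k)}$ with ${\rm s}(h_k)=\beta$ on top of each other (in increasing order of $k$, from top to bottom). Let $A_\gamma$ have size $a_\gamma\times b_\gamma$, and let $\phi_\gamma$ send a position of $A_\gamma$ to the corresponding point of $L$. Put $v_\alpha=\sum_{{\rm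 t}(h_k)=\alpha}u_{{\rm s}(h_k)}$ and $v_\beta=\sum_{{\rm s}(h_k)=\beta}u_{{\rm t}(h_k)}$, and assume $0<u_\gamma\le\min(a_\gamma,b_\gamma)$ and $u_\gamma\le v_\gamma$ for all $\gamma\in V$. Positions are in matrix coordinates (row, column), rows growing to the south and columns to the east. **Concurrent vertex maps.** A SW-NE path is a lattice path with steps $(0,1)$ or $(-1,0)$; reversed, it is a NE-SW path. A corner of a path is a vertex adjacent to both a horizontal and a vertical edge of it. A *road map* consists of, for every target $\alpha$, pairwise vertex-disjoint SW-NE paths $H^\alpha_p$ in $A_\alpha$ from $(a_\alpha-u_\alpha+p,1)$ to $(p,b_\alpha)$, $1\le p\le u_\alpha$, and, for every source $\beta$, pairwise vertex-disjoint NE-SW paths $V^\beta_q$ in $A_\beta$ from $(1,b_\beta-u_\beta+q)$ to $(a_\beta,q)$, $1\le q\le u_\beta$. It is *straight* if, as a point of $L$, each corner of a path $H^\alpha_p$ lies on some $V^\beta_q$ and each corner of a path $V^\beta_q$ lies on some $H^\alpha_p$. A subset $C\subseteq L$ is a *concurrent vertex map* if it is the set of points of $L$ lying on both a horizontal and a vertical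 path of some straight road map. **$C_{\max}(\emptyset)$ and $C_{\min}(\emptyset)$.** A diagonal chain of size $s$ is a set $\{(i_1,j_1),\dots,(i_s,j_s)\}$ with $i_1<\dots<i_s$ and $j_1<\dots<j_s$. A set $C\subseteq L$ is *$\mathbf u$-compatible* if $\phi_\gamma^{-1}(C)$ contains no diagonal chain of size $u_\gamma+1$, for every $\gamma\in V$. Order $L$ by $(i,j,k)<_T(i',j',k')$ iff $(k,i,j)$ is lexicographically smaller than $(k',i',j')$. Then $C_{\max}(\emptyset)$ (resp. $C_{\min}(\emptyset)$) is obtained by starting with $\emptyset$ and running through the points of $L$ from the largest to the smallest (resp. from the smallest to the largest), adding each point that keeps the set $\mathbf u$-compatible. **Chute moves.** Let $C\subseteq L$. If $\alpha$ is a target and a rectangular block of $A_\alpha$ consisting of two consecutive rows and at least two consecutive columns meets $\phi_\alpha^{-1}(C)$ exactly in its NE, SE and SW corners, then adding to $C$ the point of the NW corner and removing the point of the SE corner is a *horizontal chute move* $C\to C'$. A *vertical chute move* is defined likewise with a source $\beta$ and a block of $A_\beta$ consisting of two consecutive columns and at least two consecutive rows. The reverse of a chute move is an *inverse chute move*. **Proposition.**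 (1) $C_{\max}(\emptyset)$ is a concurrent vertex map, and every concurrent vertex map $C$ can be obtained from $C_{\max}(\emptyset)$ by a finite (possibly empty) sequence of horizontal or vertical chute moves. Moreover $C_{\max}(\emptyset)$ is described explicitly as follows. For $h_k:\beta\to\alpha$ put $$S_k^\alpha=\sum_{k'>k,\ {\rm t}(h_{k'})=\alpha}u_{{\rm s}(h_{k'})},\qquad S_k^\beta=\sum_{k'>k,\ {\rm s}(h_{k'})=\beta}u_{{\rm t}(h_{k'})},\qquad [x]_+=\max(x,0).$$ Then on page $k$ the set $C_{\max}(\emptyset)$ consists of exactly the points that lie in the bottom $u_\alpha$ rows or the rightmost $[u_\alpha-S_k^\alpha]_+$ columns, and that also lie in the bottom $[u_\beta-S_k^\beta]_+$ rows or the rightmost $u_\beta$ columns. (2) $C_{\min}(\emptyset)$ is a concurrent vertex map, and every concurrent vertex map $C$ can be obtained from $C_{\min}(\emptyset)$ by a finite (possibly empty) sequence of inverse horizontal or inverse vertical chute moves. -/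

import Mathlib

/-- A lattice point `(i, j, k)`: the point in row `i` and column `j` of the `k`-th page, where the
`r` pages are indexed by `Fin r`. Rows and columns are numbered from `1`. -/
@[ext]
structure PagePoint (r : ℕ) where
  row : ℤ
  col : ℤ
  page : Fin r

namespace PagePoint

/-- The triple `(k, i, j)`, in the lexicographic product. -/
def lexKey {r : ℕ} (P : PagePoint r) : Fin r ×ₗ (ℤ ×ₗ ℤ) :=
  toLex (P.page, toLex (P.row, P.col))

theorem lexKey_injective {r : ℕ} : Function.Injective (lexKey (r := r)) := by
  rintro ⟨i, j, k⟩ ⟨i', j', k'⟩ h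
  simp only [lexKey, EmbeddingLike.apply_eq_iff_eq, Prod.mk.injEq] at h
  obtain ⟨rfl, rfl, rfl⟩ := h
  rfl

/-- The total order `<_T`: compare the pages first, then the rows, then the columns. -/
instance {r : ℕ} : LinearOrder (PagePoint r) := LinearOrder.lift' lexKey lexKey_injective

theorem lt_iff {r : ℕ} (P Q : PagePoint r) :
    P < Q ↔ P.page < Q.page ∨ (P.page = Q.page ∧ P.row < Q.row) ∨
      (P.page = Q.page ∧ P.row = Q.row ∧ P.col < Q.col) := by
  change lexKey P < lexKey Q ↔ _
  simp only [lexKey, Prod.Lex.toLex_lt_toLex]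
  tauto

end PagePoint

/-- `H` is the list of vertices of a lattice path from its SW endpoint `P` to its NE endpoint `Q`
with steps to the east along `(0, 1)` or to the north along `(-1, 0)`
(matrix coordinates: rows grow to the south, columns grow to the east). -/
def IsSWNEPath (H : List (ℤ × ℤ)) (P Q : ℤ × ℤ) : Prop :=
  H.head? = some P ∧ H.getLast? = some Q ∧
    H.IsChain (fun X Y => Y = X + (0, 1) ∨ Y = X + (-1, 0))

/-- A path from its NE endpoint `Q` to its SW endpoint `P`: a reversed SW-NE path. -/
def IsNESWPath (H : List (ℤ × ℤ)) (Q P : ℤ × ℤ) : Prop :=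
  IsSWNEPath H.reverse P Q

/-- `R` is a corner of the lattice path `H`: a vertex that is adjacent to both a horizontal and a
vertical edge of `H`. (If two neighbouring lattice points both lie on a SW-NE or NE-SW path, then
the segment between them is an edge of this path.) -/
def IsPathCorner (H : List (ℤ × ℤ)) (R : ℤ × ℤ) : Prop :=
  R ∈ H ∧ (R + (0, 1) ∈ H ∨ R - (0, 1) ∈ H) ∧ (R + (1, 0) ∈ H ∨ R - (1, 0) ∈ H)

/-- `A` contains a diagonal chain of size `s`, that is, points `(i_1, j_1), …, (i_s, j_s)` with
`i_1 < ⋯ < i_s` and `j_1 < ⋯ < j_s`. -/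
def HasDiagonalChain (A : Finset (ℤ × ℤ)) (s : ℕ) : Prop :=
  ∃ f : Fin s → ℤ × ℤ, StrictMono (fun t => (f t).1) ∧ StrictMono (fun t => (f t).2) ∧
    ∀ t, f t ∈ A

/-- A bipartite quiver with source vertices `S`, target vertices `T` and `r` ordered arrows
`src k ⟶ tgt k`, together with two tuples `m`, `u` of natural numbers indexed by the vertices. -/
structure BipartiteDatum (S T : Type*) where
  r : ℕ
  src : Fin r → S
  tgt : Fin r → T
  m : S ⊕ T → ℕ
  u : S ⊕ T → ℕ

namespace BipartiteDatum

variable {S T : Type*} (D : BipartiteDatum S T)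

/-- The set `L` of all lattice points on all pages. -/
noncomputable def points : Finset (PagePoint D.r) :=
  Finset.univ.biUnion fun k : Fin D.r =>
    (Finset.Icc (1 : ℤ) (D.m (.inr (D.tgt k))) ×ˢ Finset.Icc (1 : ℤ) (D.m (.inl (D.src k)))).image
      fun p => ⟨p.1, p.2, k⟩

theorem mem_points (P : PagePoint D.r) :
    P ∈ D.points ↔ 1 ≤ P.row ∧ P.row ≤ D.m (.inr (D.tgt P.page)) ∧
      1 ≤ P.col ∧ P.col ≤ D.m (.inl (D.src P.page)) := by
  obtain ⟨i, j, k⟩ := P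
  simp only [points, Finset.mem_biUnion, Finset.mem_univ, true_and, Finset.mem_image,
    Finset.mem_product, Finset.mem_Icc, Prod.exists, PagePoint.mk.injEq]
  constructor
  · rintro ⟨k, i, j, h, rfl, rfl, rfl⟩
    tauto
  · intro h
    exact ⟨k, i, j, by tauto, rfl, rfl, rfl⟩

variable [DecidableEq S] [DecidableEq T]

/-- `a_γ`, the number of rows of the block matrix `A_γ`. For a target `α`, the blocks
`X^(k)` with `tgt k = α` are put side by side; for a source `β`, the blocks `X^(k)` with
`src k = β` are put on top of each other; `X^(k)` has size `m (tgt k) × m (src k)`. -/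
def numRows : S ⊕ T → ℕ
  | .inl β => ∑ k with D.src k = β, D.m (.inr (D.tgt k))
  | .inr α => D.m (.inr α)

/-- `b_γ`, the number of columns of the block matrix `A_γ`. -/
def numCols : S ⊕ T → ℕ
  | .inl β => D.m (.inl β)
  | .inr α => ∑ k with D.tgt k = α, D.m (.inl (D.src k))

/-- `v_γ`, the sum of `u` over the other endpoints of all arrows incident to `γ`. -/
def v : S ⊕ T → ℕ
  | .inl β => ∑ k with D.src k = β, D.u (.inr (D.tgt k))
  | .inr α => ∑ k with D.tgt k = α, D.u (.inl (D.src k))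

/-- The standing assumption `0 < u_γ ≤ min (a_γ, b_γ)` and `u_γ ≤ v_γ` for all vertices `γ`. -/
def Admissible : Prop :=
  ∀ γ : S ⊕ T, 0 < D.u γ ∧ D.u γ ≤ min (D.numRows γ) (D.numCols γ) ∧ D.u γ ≤ D.v γ

/-- The arrow `k` is incident to the vertex `γ`, that is, `X^(k)` is a block of `A_γ`. -/
def Incident (γ : S ⊕ T) (k : Fin D.r) : Prop :=
  γ = .inl (D.src k) ∨ γ = .inr (D.tgt k)

instance (γ : S ⊕ T) (k : Fin D.r) : Decidable (D.Incident γ k) :=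
  inferInstanceAs (Decidable (_ ∨ _))

/-- The position `φ_γ⁻¹ (P)` in the block matrix `A_γ` of the point `P`
(meaningful when the page of `P` is a block of `A_γ`). -/
def pos : S ⊕ T → PagePoint D.r → ℤ × ℤ
  | .inl β, P => (P.row + ∑ l with l < P.page ∧ D.src l = β, (D.m (.inr (D.tgt l)) : ℤ), P.col)
  | .inr α, P => (P.row, P.col + ∑ l with l < P.page ∧ D.tgt l = α, (D.m (.inl (D.src l)) : ℤ))

/-- `φ_γ (x) = P`: the entry of `A_γ` at position `x` is the variable of the point `P ∈ L`. -/
def IsEntry (γ : S ⊕ T) (x : ℤ × ℤ) (P : PagePoint D.r) : Prop :=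
  P ∈ D.points ∧ D.Incident γ P.page ∧ D.pos γ P = x

/-- `C^γ = φ_γ⁻¹ (C)`. -/
def preim (γ : S ⊕ T) (C : Finset (PagePoint D.r)) : Finset (ℤ × ℤ) :=
  ({P ∈ C | D.Incident γ P.page}).image (D.pos γ)

/-- A road map of rank `u`. The indices `p = 1, …, u_γ` are `(p : ℕ) + 1` for `p : Fin (u γ)`. -/
structure RoadMap where
  /-- horizontal paths -/
  H : (α : T) → Fin (D.u (.inr α)) → List (ℤ × ℤ)
  /-- vertical paths -/
  V : (β : S) → Fin (D.u (.inl β)) → List (ℤ × ℤ)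
  H_path : ∀ α p, IsSWNEPath (H α p)
    ((D.numRows (.inr α) : ℤ) - D.u (.inr α) + ((p : ℕ) + 1), 1)
    (((p : ℕ) : ℤ) + 1, D.numCols (.inr α))
  V_path : ∀ β q, IsNESWPath (V β q)
    (1, (D.numCols (.inl β) : ℤ) - D.u (.inl β) + ((q : ℕ) + 1))
    (D.numRows (.inl β), ((q : ℕ) : ℤ) + 1)
  H_nonintersecting : ∀ α p p', p ≠ p' → List.Disjoint (H α p) (H α p')
  V_nonintersecting : ∀ β q q', q ≠ q' → List.Disjoint (V β q) (V β q')

variable {D} in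
/-- The point `P` lies on a horizontal path. -/
def RoadMap.OnHorizontal (R : D.RoadMap) (P : PagePoint D.r) : Prop :=
  ∃ p, D.pos (.inr (D.tgt P.page)) P ∈ R.H (D.tgt P.page) p

variable {D} in
/-- The point `P` lies on a vertical path. -/
def RoadMap.OnVertical (R : D.RoadMap) (P : PagePoint D.r) : Prop :=
  ∃ q, D.pos (.inl (D.src P.page)) P ∈ R.V (D.src P.page) q

variable {D} in
/-- A road map is straight if each corner of a horizontal path lies in a vertical path and each
corner of a vertical path lies in a horizontal path. -/
def RoadMap.Straight (R : D.RoadMap) : Prop :=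
  (∀ α p x P, IsPathCorner (R.H α p) x → D.IsEntry (.inr α) x P → R.OnVertical P) ∧
  (∀ β q x P, IsPathCorner (R.V β q) x → D.IsEntry (.inl β) x P → R.OnHorizontal P)

/-- `C` is a concurrent vertex map: it is the set of points of `L` that lie on both a horizontal
and a vertical path of some straight road map. -/
def IsConcurrent (C : Finset (PagePoint D.r)) : Prop :=
  ∃ R : D.RoadMap, R.Straight ∧
    ∀ P, P ∈ C ↔ P ∈ D.points ∧ R.OnHorizontal P ∧ R.OnVertical P

/-- `C ⊆ L` is `u`-compatible: no `C^γ` contains a diagonal chain of size `u_γ + 1`. -/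
def UCompatible (C : Finset (PagePoint D.r)) : Prop :=
  C ⊆ D.points ∧ ∀ γ : S ⊕ T, ¬ HasDiagonalChain (D.preim γ C) (D.u γ + 1)

open Classical in
/-- Run through the list `l`, adding each point that keeps the set `u`-compatible. -/
noncomputable def greedy (l : List (PagePoint D.r)) (C : Finset (PagePoint D.r)) :
    Finset (PagePoint D.r) :=
  l.foldl (fun C' P => if D.UCompatible (insert P C') then insert P C' else C') C

/-- `C_max (C)`: points are tried from the largest to the smallest with respect to `<_T`. -/
noncomputable def cMax (C : Finset (PagePoint D.r)) : Finset (PagePoint D.r) :=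
  D.greedy (D.points.sort (· ≥ ·)) C

/-- `C_min (C)`: points are tried from the smallest to the largest with respect to `<_T`. -/
noncomputable def cMin (C : Finset (PagePoint D.r)) : Finset (PagePoint D.r) :=
  D.greedy (D.points.sort (· ≤ ·)) C

/-- `C'` is obtained from `C` by a horizontal or vertical chute move performed in a block of `A_γ`
with rows `i, …, i'` and columns `j, …, j'`: the only points of `C` in the block are its NE, SW and
SE corners, and `C' = (C ∪ {NW corner}) \ {SE corner}`. -/
def ChuteIn (γ : S ⊕ T) (i i' j j' : ℤ) (C C' : Finset (PagePoint D.r)) : Prop :=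
  1 ≤ i ∧ i < i' ∧ i' ≤ D.numRows γ ∧ 1 ≤ j ∧ j < j' ∧ j' ≤ D.numCols γ ∧
  D.preim γ C ∩ (Finset.Icc i i' ×ˢ Finset.Icc j j') = {(i, j'), (i', j), (i', j')} ∧
  ∃ P Q, D.IsEntry γ (i, j) P ∧ D.IsEntry γ (i', j') Q ∧ C' = (C ∪ {P}) \ {Q}

/-- Horizontal chute move `C → C'`: the block has two rows and lies in `A_α`, `α` a target. -/
def HorizontalChuteMove (C C' : Finset (PagePoint D.r)) : Prop :=
  ∃ (α : T) (i j j' : ℤ), D.ChuteIn (.inr α) i (i + 1) j j' C C'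

/-- Vertical chute move `C → C'`: the block has two columns and lies in `A_β`, `β` a source. -/
def VerticalChuteMove (C C' : Finset (PagePoint D.r)) : Prop :=
  ∃ (β : S) (i i' j : ℤ), D.ChuteIn (.inl β) i i' j (j + 1) C C'

/-- A horizontal or vertical chute move `C → C'`. -/
def ChuteMove (C C' : Finset (PagePoint D.r)) : Prop :=
  D.HorizontalChuteMove C C' ∨ D.VerticalChuteMove C C'

/-- A horizontal or vertical inverse chute move from `C'` to `C`. -/
def InverseChuteMove (C' C : Finset (PagePoint D.r)) : Prop :=
  D.ChuteMove C C'

/-- `S_k^γ`: the sum of `u` over the other endpoints of the arrows `l > k` incident to `γ`. -/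
def laterSum : S ⊕ T → Fin D.r → ℕ
  | .inl β, k => ∑ l with k < l ∧ D.src l = β, D.u (.inr (D.tgt l))
  | .inr α, k => ∑ l with k < l ∧ D.tgt l = α, D.u (.inl (D.src l))

/-- The explicit set whose part on page `k`, for `k : β ⟶ α`, consists of the points that lie
in the bottom `u_α` rows or the rightmost `[u_α - S_k^α]_+` columns, and
in the bottom `[u_β - S_k^β]_+` rows or the rightmost `u_β` columns. -/
noncomputable def initialRegion : Finset (PagePoint D.r) :=
  {P ∈ D.points |
    let α : S ⊕ T := .inr (D.tgt P.page)
    let β : S ⊕ T := .inl (D.src P.page)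
    ((D.m α : ℤ) - D.u α < P.row ∨
      (D.m β : ℤ) - max ((D.u α : ℤ) - D.laterSum α P.page) 0 < P.col) ∧
    ((D.m α : ℤ) - max ((D.u β : ℤ) - D.laterSum β P.page) 0 < P.row ∨
      (D.m β : ℤ) - D.u β < P.col)}

end BipartiteDatum

/-! Straight road maps are studied as nets: families of paths with integer indices whose vertices
are given by predicates. Transposition exchanges sources with targets and rows with columns, so each
statement about horizontal paths also yields its vertical counterpart.

The basic fact is that straightness forces paths to share edges
(`PageShape.Net.exists_vp_of_vertical_edge`): a vertical edge of a horizontal path is an edge of a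
vertical path, and dually. Hence both ends of such an edge are concurrent vertices, and along a row
a horizontal path cannot leave between two consecutive concurrent vertices.

Suppose a horizontal path has a north-west corner at (i, c), the next concurrent vertex of row i is
(i, c'), and no horizontal path meets row i + 1 in the columns c + 1, …, c'. Pushing the segment to
the south-east gives a straight net again, in which the concurrent vertex (i, c) has moved to (i +
1, c') (`exists_moved`). This is an inverse chute move, and it replaces a point by a larger one for
<_T. Maximizing a weight therefore shows that every concurrent vertex map arises by chute moves from
a net without such free corners, horizontal or vertical (`exists_reduced`).

A net without free corners is unique. What obstructs a corner of path p is path p + 1, which has its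
own north-west corner one row below; by descending induction the corners of path p lie in row p, so
path p is a hook (east, north, east), at least when u_α < m_α; otherwise it is a full row. The
vertical part of a hook runs along one vertical path. A vertical path coming later must cross the
final row of the hook and thereby forces the hook p + 1. So, counting from the end, the n-th hook is
attached to the n-th vertical path (`Attached.number_eq`). Comparison with the transposed statement
shows that the vertical part lies in the first column of that vertical path
(`Attached.col_eq_of_reduced`). These data determine `extremalNet`.

The crossing set of the extremal net is the explicit region and also the greedy set. The u_γ paths
of a vertex cover the crossing points, and no path contains two points one strictly south-east of
the other, so crossing sets are compatible. For a point outside the region, the lower ends of the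
hooks of one of its two vertices (or the transposed points) form a diagonal chain of u_γ crossing
points to its south-east. These points come earlier in the greedy run and block it.

For C_min, rotate every page by a half turn and reverse the order of the arrows: this reverses <_T
and turns chute moves into inverse chute moves. -/

set_option linter.unusedSectionVars false

/-! ### Partial sums over a filtered `Fin r` -/

section PartialSums

variable {r : ℕ} (P : Fin r → Prop) [DecidablePred P] (g : Fin r → ℤ)

theorem sum_below_add_le (hg : ∀ l, 0 ≤ g l) {k k' : Fin r} (hk : P k) (h : k < k') :
    (∑ l with l < k ∧ P l, g l) + g k ≤ ∑ l with l < k' ∧ P l, g l := by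
  have hn : k ∉ Finset.univ.filter (fun l => l < k ∧ P l) := by simp
  rw [add_comm, ← Finset.sum_insert hn]
  refine Finset.sum_le_sum_of_subset_of_nonneg ?_ (fun l _ _ => hg l)
  intro l hl
  simp only [Finset.mem_insert, Finset.mem_filter, Finset.mem_univ, true_and] at hl ⊢
  rcases hl with rfl | ⟨h1, h2⟩
  · exact ⟨h, hk⟩
  · exact ⟨h1.trans h, h2⟩

theorem sum_below_add_above {k : Fin r} (hk : P k) :
    (∑ l with l < k ∧ P l, g l) + g k + (∑ l with k < l ∧ P l, g l) = ∑ l with P l, g l := by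
  have h : Finset.univ.filter P =
      (insert k (Finset.univ.filter fun l => l < k ∧ P l)) ∪
        (Finset.univ.filter fun l => k < l ∧ P l) := by
    ext l
    simp only [Finset.mem_filter, Finset.mem_univ, true_and, Finset.mem_union, Finset.mem_insert]
    constructor
    · intro hl
      rcases lt_trichotomy l k with h | h | h
      · exact .inl (.inr ⟨h, hl⟩)
      · exact .inl (.inl h)
      · exact .inr ⟨h, hl⟩
    · rintro ((rfl | h) | h)
      exacts [hk, h.2, h.2]
  rw [h, Finset.sum_union, Finset.sum_insert (by simp), add_comm (g k)]
  rw [Finset.disjoint_left]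
  intro l hl hl'
  simp only [Finset.mem_filter, Finset.mem_univ, true_and, Finset.mem_insert] at hl hl'
  rcases hl with rfl | hl
  · exact lt_irrefl _ hl'.1
  · exact lt_asymm hl.1 hl'.1

/-- The partial sums start at 0 and reach the total, so there is a first index at which they attain
y. It is used to find the page of a column and the vertical path with a given number. -/
theorem exists_sum_below_lt_le {y : ℤ} (h0 : 0 < y) (h1 : y ≤ ∑ l with P l, g l) :
    ∃ k, P k ∧ (∑ l with l < k ∧ P l, g l) < y ∧ y ≤ (∑ l with l < k ∧ P l, g l) + g k := by
  classical
  -- Partial sums over natural numbers allow the bound r itself, which is not an element of `Fin r`.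
  let F : ℕ → ℤ := fun n => ∑ l ∈ Finset.univ.filter (fun l : Fin r => (l : ℕ) < n ∧ P l), g l
  have hF : ∃ n, y ≤ F n := ⟨r, by
    refine h1.trans_eq (Finset.sum_congr ?_ fun _ _ => rfl)
    ext l; simp⟩
  obtain ⟨n, hn⟩ : ∃ n, Nat.find hF = n + 1 := by
    refine Nat.exists_eq_succ_of_ne_zero fun h => ?_
    have := Nat.find_spec hF
    rw [h] at this
    simp only [F, not_lt_zero, false_and, Finset.filter_false, Finset.sum_empty] at this
    omega
  have hlt : F n < y := not_le.1 (Nat.find_min hF (by omega))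
  have hle : y ≤ F (n + 1) := hn ▸ Nat.find_spec hF
  have key : ∃ k : Fin r, (k : ℕ) = n ∧ P k := by
    by_contra hne
    have : F (n + 1) = F n := by
      refine Finset.sum_congr ?_ fun _ _ => rfl
      ext l
      simp only [Finset.mem_filter, Finset.mem_univ, true_and, and_congr_left_iff]
      intro hl
      have : (l : ℕ) ≠ n := fun h => hne ⟨l, h, hl⟩
      omega
    omega
  obtain ⟨k, rfl, hk⟩ := key
  have e : F (k + 1) = (∑ l with l < k ∧ P l, g l) + g k := by
    have : Finset.univ.filter (fun l : Fin r => (l : ℕ) < k + 1 ∧ P l) =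
        insert k (Finset.univ.filter fun l => l < k ∧ P l) := by
      ext l
      simp only [Finset.mem_filter, Finset.mem_univ, true_and, Finset.mem_insert, Fin.lt_def,
        Fin.ext_iff]
      constructor
      · rintro ⟨h, hl⟩
        by_cases hlk : (l : ℕ) = k
        · exact .inl hlk
        · exact .inr ⟨by omega, hl⟩
      · rintro (h | h)
        · have : l = k := Fin.ext h
          subst this
          exact ⟨by omega, hk⟩
        · exact ⟨by omega, h.2⟩
    simp only [F]
    rw [this, Finset.sum_insert (by simp), add_comm]
  exact ⟨k, hk, hlt, by rw [← e]; exact hle⟩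

end PartialSums

/-! ### Lattice paths as predicates -/

/-- The set of vertices of a lattice path from the SW endpoint `(i₀, j₀)` to the NE endpoint
`(i₁, j₁)` with steps to the east or to the north. -/
structure LatticePath (M : ℤ → ℤ → Prop) (i₀ j₀ i₁ j₁ : ℤ) : Prop where
  start : M i₀ j₀
  fin : M i₁ j₁
  next : ∀ {i j}, M i j → (i = i₁ ∧ j = j₁) ∨ M i (j + 1) ∨ M (i - 1) j
  prev : ∀ {i j}, M i j → (i = i₀ ∧ j = j₀) ∨ M i (j - 1) ∨ M (i + 1) j
  diag : ∀ {i j i' j'}, M i j → M i' j' → j - i = j' - i' → i = i'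
  lower : ∀ {i j}, M i j → j₀ - i₀ ≤ j - i
  upper : ∀ {i j}, M i j → j - i ≤ j₁ - i₁

namespace LatticePath

variable {M M' : ℤ → ℤ → Prop} {i₀ j₀ i₁ j₁ i₀' j₀' i₁' j₁' : ℤ}

theorem transpose (h : LatticePath M i₀ j₀ i₁ j₁) :
    LatticePath (fun i j => M j i) j₁ i₁ j₀ i₀ where
  start := h.fin
  fin := h.start
  next H := by
    rcases h.prev H with h | h | h
    exacts [.inl h.symm, .inr (.inr h), .inr (.inl h)]
  prev H := by
    rcases h.next H with h | h | h
    exacts [.inl h.symm, .inr (.inr h), .inr (.inl h)]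
  diag H H' e := by have := h.diag H H' (by omega); omega
  lower H := by have := h.upper H; omega
  upper H := by have := h.lower H; omega

theorem translate (h : LatticePath M i₀ j₀ i₁ j₁) (a b : ℤ) :
    LatticePath (fun i j => M (i + a) (j + b)) (i₀ - a) (j₀ - b) (i₁ - a) (j₁ - b) where
  start := by simpa using h.start
  fin := by simpa using h.fin
  next {i j} H := by
    rcases h.next H with h | h | h
    · exact .inl (by omega)
    · exact .inr (.inl (by rwa [show j + 1 + b = j + b + 1 by ring]))
    · exact .inr (.inr (by rwa [show i - 1 + a = i + a - 1 by ring]))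
  prev {i j} H := by
    rcases h.prev H with h | h | h
    · exact .inl (by omega)
    · exact .inr (.inl (by rwa [show j - 1 + b = j + b - 1 by ring]))
    · exact .inr (.inr (by rwa [show i + 1 + a = i + a + 1 by ring]))
  diag H H' e := by have := h.diag H H' (by omega); omega
  lower H := by have := h.lower H; omega
  upper H := by have := h.upper H; omega

/-- The difference j - i increases by one at each step and thus serves as a time parameter; in the
course of time rows only decrease and columns only increase. -/
theorem mono (h : LatticePath M i₀ j₀ i₁ j₁) {i j i' j' : ℤ} (H : M i j) (H' : M i' j')
    (hd : j - i ≤ j' - i') : i' ≤ i ∧ j ≤ j' := by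
  obtain ⟨n, hn⟩ := Int.le.dest hd
  induction n generalizing i j with
  | zero =>
    have := h.diag H H' (by simpa using hn)
    push_cast at hn
    omega
  | succ n ih =>
    push_cast at hn
    rcases h.next H with ⟨rfl, rfl⟩ | H1 | H1
    · have := h.upper H'
      omega
    · have := ih H1 (by omega) (by omega)
      omega
    · have := ih H1 (by omega) (by omega)
      omega

theorem bounds (h : LatticePath M i₀ j₀ i₁ j₁) {i j : ℤ} (H : M i j) :
    i₁ ≤ i ∧ i ≤ i₀ ∧ j₀ ≤ j ∧ j ≤ j₁ := by
  have h1 := h.mono h.start H (h.lower H)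
  have h2 := h.mono H h.fin (h.upper H)
  omega

theorem not_lt_lt (h : LatticePath M i₀ j₀ i₁ j₁) {i j i' j' : ℤ} (H : M i j) (H' : M i' j')
    (hi : i < i') (hj : j < j') : False := by
  rcases le_total (j - i) (j' - i') with hd | hd
  · have := h.mono H H' hd
    omega
  · have := h.mono H' H hd
    omega

theorem exists_on_diag (h : LatticePath M i₀ j₀ i₁ j₁) {t : ℤ} (h0 : j₀ - i₀ ≤ t)
    (h1 : t ≤ j₁ - i₁) : ∃ i, M i (i + t) := by
  obtain ⟨n, hn⟩ := Int.le.dest h0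
  induction n generalizing t with
  | zero =>
    refine ⟨i₀, ?_⟩
    have : i₀ + t = j₀ := by push_cast at hn; omega
    rw [this]
    exact h.start
  | succ n ih =>
    push_cast at hn
    obtain ⟨i, hi⟩ := ih (t := t - 1) (by omega) (by omega) (by omega)
    rcases h.next hi with ⟨h1, h2⟩ | H | H
    · omega
    · exact ⟨i, by rwa [show i + (t - 1) + 1 = i + t by ring] at H⟩
    · exact ⟨i - 1, by rwa [show i + (t - 1) = i - 1 + t by ring] at H⟩

theorem exists_on_col (h : LatticePath M i₀ j₀ i₁ j₁) {j : ℤ} (h0 : j₀ ≤ j) (h1 : j ≤ j₁) :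
    ∃ i, M i j := by
  have key : ∀ (n : ℕ) (i c : ℤ), M i c → c ≤ j → j₁ - i₁ - (c - i) ≤ n → ∃ i, M i j := by
    intro n
    induction n with
    | zero =>
      intro i c H hc hn
      have := h.upper H
      have := h.mono H h.fin (by omega)
      have := h.mono h.fin H (by push_cast at hn; omega)
      exact ⟨i, by rwa [show j = c by omega]⟩
    | succ n ih =>
      intro i c H hc hn
      rcases hc.eq_or_lt with rfl | hc
      · exact ⟨i, H⟩
      push_cast at hn
      rcases h.next H with ⟨rfl, rfl⟩ | H1 | H1
      · omega
      · exact ih i (c + 1) H1 (by omega) (by omega)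
      · exact ih (i - 1) c H1 (by omega) (by omega)
  exact key (j₁ - i₁ - (j₀ - i₀)).toNat i₀ j₀ h.start h0 (Int.self_le_toNat _)

theorem exists_on_row (h : LatticePath M i₀ j₀ i₁ j₁) {i : ℤ} (h0 : i₁ ≤ i) (h1 : i ≤ i₀) :
    ∃ j, M i j :=
  h.transpose.exists_on_col h0 h1

theorem exists_vertical_edge (h : LatticePath M i₀ j₀ i₁ j₁) {i : ℤ} (h0 : i₁ ≤ i) (h1 : i < i₀) :
    ∃ j, M (i + 1) j ∧ M i j := by
  have key : ∀ (n : ℕ) (x c : ℤ), M x c → i < x → j₁ - i₁ - (c - x) ≤ n →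
      ∃ j, M (i + 1) j ∧ M i j := by
    intro n
    induction n with
    | zero =>
      intro x c H hc hn
      have := h.upper H
      have := h.mono h.fin H (by push_cast at hn; omega)
      omega
    | succ n ih =>
      intro x c H hc hn
      push_cast at hn
      rcases h.next H with ⟨rfl, rfl⟩ | H1 | H1
      · omega
      · exact ih x (c + 1) H1 hc (by omega)
      · by_cases e : x = i + 1
        · subst e
          exact ⟨c, H, by rwa [add_sub_cancel_right] at H1⟩
        · exact ih (x - 1) c H1 (by omega) (by omega)
  exact key (j₁ - i₁ - (j₀ - i₀)).toNat i₀ j₀ h.start h1 (Int.self_le_toNat _)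

/-- Passing to the next diagonal changes each row by 0 or -1, so the difference of the two rows
changes by at most one. It cannot change sign without vanishing, and disjointness excludes that. -/
theorem lt_of_disjoint (h : LatticePath M i₀ j₀ i₁ j₁) (h' : LatticePath M' i₀' j₀' i₁' j₁')
    (hd : ∀ i j, M i j → ¬ M' i j) {t₀ : ℤ} (hl : j₀ - i₀ ≤ t₀) (hl' : j₀' - i₀' ≤ t₀)
    (h0 : ∀ i i', M i (i + t₀) → M' i' (i' + t₀) → i < i') {t : ℤ} (ht : t₀ ≤ t) {i i' : ℤ}
    (H : M i (i + t)) (H' : M' i' (i' + t)) : i < i' := by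
  obtain ⟨n, hn⟩ := Int.le.dest ht
  induction n generalizing t i i' with
  | zero =>
    have : t₀ = t := by simpa using hn
    subst this
    exact h0 _ _ H H'
  | succ n ih =>
    push_cast at hn
    have hne : i ≠ i' := by
      rintro rfl
      exact hd _ _ H H'
    obtain ⟨x, hx, hx'⟩ : ∃ x, M x (x + (t - 1)) ∧ (x = i ∨ x = i + 1) := by
      rcases h.prev H with ⟨h1, h2⟩ | H1 | H1
      · omega
      · exact ⟨i, by rwa [← add_sub_assoc], .inl rfl⟩
      · exact ⟨i + 1, by rwa [show i + 1 + (t - 1) = i + t by ring], .inr rfl⟩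
    obtain ⟨y, hy, hy'⟩ : ∃ x, M' x (x + (t - 1)) ∧ (x = i' ∨ x = i' + 1) := by
      rcases h'.prev H' with ⟨h1, h2⟩ | H1 | H1
      · omega
      · exact ⟨i', by rwa [← add_sub_assoc], .inl rfl⟩
      · exact ⟨i' + 1, by rwa [show i' + 1 + (t - 1) = i' + t by ring], .inr rfl⟩
    have := ih (t := t - 1) (by omega) hx hy (by omega)
    omega

/-- A discrete intermediate value theorem: disjoint paths would keep on the diagonal t₁ the strict
order that they have on the diagonal t₀. -/
theorem exists_meet (h : LatticePath M i₀ j₀ i₁ j₁) (h' : LatticePath M' i₀' j₀' i₁' j₁')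
    {t₀ t₁ : ℤ} (ht : t₀ ≤ t₁) (hl : j₀ - i₀ ≤ t₀) (hl' : j₀' - i₀' ≤ t₀)
    (hu : t₁ ≤ j₁ - i₁) (hu' : t₁ ≤ j₁' - i₁')
    (h0 : ∀ i i', M i (i + t₀) → M' i' (i' + t₀) → i ≤ i')
    (h1 : ∀ i i', M i (i + t₁) → M' i' (i' + t₁) → i' ≤ i) : ∃ i j, M i j ∧ M' i j := by
  by_contra hne
  push Not at hne
  obtain ⟨i, hi⟩ := h.exists_on_diag (hl.trans ht) hu
  obtain ⟨i', hi'⟩ := h'.exists_on_diag (hl'.trans ht) hu'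
  have := lt_of_disjoint h h' hne hl hl' (fun i i' H H' => lt_of_le_of_ne (h0 i i' H H') (by
    rintro rfl
    exact hne _ _ H H')) ht hi hi'
  have := h1 _ _ hi hi'
  omega

/-- Shifting the points on the diagonals `c - i, …, c' - 1 - i` to the south-east replaces the
segment `(i + 1, c), (i, c), …, (i, c')` by `(i + 1, c), …, (i + 1, c'), (i, c')`. -/
theorem shift (h : LatticePath M i₀ j₀ i₁ j₁) {i c c' : ℤ} (hc : c < c') (H1 : M (i + 1) c)
    (H2 : ∀ y, c ≤ y → y ≤ c' → M i y) :
    LatticePath (fun x y => if c - i ≤ y - x ∧ y - x < c' - i then M (x - 1) (y - 1) else M x y)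
      i₀ j₀ i₁ j₁ := by
  have l1 := h.lower H1
  have u1 := h.upper (H2 c' hc.le le_rfl)
  have inv : ∀ {x y}, c - i ≤ y - x → y - x < c' - i → M (x - 1) (y - 1) → x = i + 1 := by
    intro x y ha hb H
    have := h.diag H (H2 (y - x + i) (by omega) (by omega)) (by omega)
    omega
  refine ⟨?_, ?_, ?_, ?_, ?_, ?_, ?_⟩
  · rw [if_neg (by omega)]; exact h.start
  · rw [if_neg (by omega)]; exact h.fin
  · intro x y H
    split_ifs at H with hxy
    · have hx := inv hxy.1 hxy.2 H
      subst hx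
      by_cases hy : y = c'
      · subst hy
        right; right
        rw [if_neg (by omega)]
        simpa using H2 y hc.le le_rfl
      · right; left
        rw [if_pos (by omega)]
        simpa using H2 y (by omega) (by omega)
    · by_cases hy : y - x = c - i - 1
      · have := h.diag H H1 (by omega)
        subst this
        right; left
        rw [if_pos (by omega)]
        simpa using H2 y (by omega) (by omega)
      · rcases h.next H with H | H | H
        · exact .inl H
        · right; left; rw [if_neg (by omega)]; exact H
        · right; right; rw [if_neg (by omega)]; exact H
  · intro x y H
    split_ifs at H with hxy
    · have hx := inv hxy.1 hxy.2 H
      subst hx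
      by_cases hy : y = c + 1
      · subst hy
        right; left
        rw [if_neg (by omega)]
        simpa using H1
      · right; left
        rw [if_pos (by omega)]
        simpa using H2 (y - 1 - 1) (by omega) (by omega)
    · by_cases hy : y - x = c' - i
      · have := h.diag H (H2 c' hc.le le_rfl) (by omega)
        subst this
        right; right
        rw [if_pos (by omega)]
        simpa using H2 (y - 1) (by omega) (by omega)
      · rcases h.prev H with H | H | H
        · exact .inl H
        · right; left; rw [if_neg (by omega)]; exact H
        · right; right; rw [if_neg (by omega)]; exact H
  · intro x y x' y' H H' e
    split_ifs at H H' <;> (have := h.diag H H' (by omega); omega)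
  · intro x y H
    split_ifs at H <;> have := h.lower H <;> omega
  · intro x y H
    split_ifs at H <;> have := h.upper H <;> omega

theorem congr (h : LatticePath M i₀ j₀ i₁ j₁) (e : ∀ i j, M i j ↔ M' i j) :
    LatticePath M' i₀ j₀ i₁ j₁ := by
  have : M = M' := by
    ext i j
    exact e i j
  exact this ▸ h

/-- The same path as in `shift`, described by the removed and the inserted points instead of by
diagonals. -/
theorem replace_corner (h : LatticePath M i₀ j₀ i₁ j₁) {i c c' : ℤ} (hc : c < c')
    (H1 : M (i + 1) c) (H2 : ∀ y, c ≤ y → y ≤ c' → M i y) :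
    LatticePath (fun x y => (M x y ∧ ¬ (x = i ∧ c ≤ y ∧ y < c')) ∨
      (x = i + 1 ∧ c < y ∧ y ≤ c')) i₀ j₀ i₁ j₁ := by
  refine (h.shift hc H1 H2).congr fun x y => ?_
  split_ifs with hxy
  · constructor
    · intro H
      have := h.diag H (H2 (y - x + i) (by omega) (by omega)) (by omega)
      omega
    · rintro (⟨H, hn⟩ | ⟨rfl, h1, h2⟩)
      · have := h.diag H (H2 (y - x + i) (by omega) (by omega)) (by omega)
        omega
      · simpa using H2 (y - 1) (by omega) (by omega)
  · constructor
    · intro H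
      exact .inl ⟨H, by omega⟩
    · rintro (⟨H, hn⟩ | ⟨rfl, h1, h2⟩)
      · exact H
      · omega

end LatticePath

/-! ### Page shapes and nets of paths -/

/-- The sizes of the pages of a bipartite quiver, with a number of paths for each vertex. -/
structure PageShape (S T : Type*) where
  r : ℕ
  src : Fin r → S
  tgt : Fin r → T
  mS : S → ℤ
  mT : T → ℤ
  uS : S → ℤ
  uT : T → ℤ

namespace PageShape

variable {S T : Type*}

/-- Exchange the roles of rows and columns. -/
@[reducible] def transpose (Q : PageShape S T) : PageShape T S :=
  ⟨Q.r, Q.tgt, Q.src, Q.mT, Q.mS, Q.uT, Q.uS⟩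

variable [DecidableEq S] [DecidableEq T] (Q : PageShape S T)

/-- The number of columns of the block matrix of a target. -/
def width (α : T) : ℤ := ∑ k with Q.tgt k = α, Q.mS (Q.src k)

/-- The number of columns of the block matrix of `tgt k` to the left of page `k`. -/
def colOff (k : Fin Q.r) : ℤ := ∑ l with l < k ∧ Q.tgt l = Q.tgt k, Q.mS (Q.src l)

/-- The number of vertical paths through the block matrix of a target. -/
def flow (α : T) : ℤ := ∑ k with Q.tgt k = α, Q.uS (Q.src k)

/-- The number of vertical paths through the block matrix of `tgt k` to the right of page `k`. -/
def tail (k : Fin Q.r) : ℤ := ∑ l with k < l ∧ Q.tgt l = Q.tgt k, Q.uS (Q.src l)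

/-- The number of rows of the block matrix of a source. -/
abbrev height (β : S) : ℤ := Q.transpose.width β

/-- The number of rows of the block matrix of `src k` above page `k`. -/
abbrev rowOff (k : Fin Q.r) : ℤ := Q.transpose.colOff k

/-- The standing assumptions on the sizes. -/
structure Regular : Prop where
  uS_pos : ∀ β, 1 ≤ Q.uS β
  uT_pos : ∀ α, 1 ≤ Q.uT α
  uS_le : ∀ β, Q.uS β ≤ Q.mS β
  uT_le : ∀ α, Q.uT α ≤ Q.mT α
  uS_le_flow : ∀ β, Q.uS β ≤ Q.transpose.flow β
  uT_le_flow : ∀ α, Q.uT α ≤ Q.flow α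

variable {Q}

theorem Regular.transpose (hQ : Q.Regular) : Q.transpose.Regular :=
  ⟨hQ.uT_pos, hQ.uS_pos, hQ.uT_le, hQ.uS_le, hQ.uT_le_flow, hQ.uS_le_flow⟩

theorem Regular.mS_nonneg (hQ : Q.Regular) (β : S) : 0 ≤ Q.mS β := by
  have := hQ.uS_pos β
  have := hQ.uS_le β
  omega

theorem Regular.colOff_nonneg (hQ : Q.Regular) (k : Fin Q.r) : 0 ≤ Q.colOff k :=
  Finset.sum_nonneg fun _ _ => hQ.mS_nonneg _

theorem Regular.tail_nonneg (hQ : Q.Regular) (k : Fin Q.r) : 0 ≤ Q.tail k :=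
  Finset.sum_nonneg fun _ _ => by have := hQ.uS_pos (Q.src ‹_›); omega

theorem Regular.colOff_add_le_colOff (hQ : Q.Regular) {k k' : Fin Q.r} (h : k < k')
    (ht : Q.tgt k = Q.tgt k') : Q.colOff k + Q.mS (Q.src k) ≤ Q.colOff k' := by
  unfold colOff
  rw [ht]
  exact sum_below_add_le (fun l => Q.tgt l = Q.tgt k') (fun l => Q.mS (Q.src l))
    (fun l => hQ.mS_nonneg _) ht h

theorem Regular.colOff_add_le_width (hQ : Q.Regular) (k : Fin Q.r) :
    Q.colOff k + Q.mS (Q.src k) ≤ Q.width (Q.tgt k) := by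
  have := sum_below_add_above (fun l => Q.tgt l = Q.tgt k) (fun l => Q.mS (Q.src l)) (k := k) rfl
  have h2 : 0 ≤ ∑ l with k < l ∧ Q.tgt l = Q.tgt k, Q.mS (Q.src l) :=
    Finset.sum_nonneg fun _ _ => hQ.mS_nonneg _
  unfold colOff width
  omega

theorem exists_page {α : T} {y : ℤ} (h0 : 1 ≤ y) (h1 : y ≤ Q.width α) :
    ∃ k j, Q.tgt k = α ∧ y = j + Q.colOff k ∧ 1 ≤ j ∧ j ≤ Q.mS (Q.src k) := by
  obtain ⟨k, rfl, h2, h3⟩ := exists_sum_below_lt_le (fun l => Q.tgt l = α)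
    (fun l => Q.mS (Q.src l)) (y := y) (by omega) h1
  refine ⟨k, y - Q.colOff k, rfl, by omega, ?_, ?_⟩ <;> unfold colOff <;> omega

theorem Regular.page_le_of_col_le (hQ : Q.Regular) {k k' : Fin Q.r} (ht : Q.tgt k = Q.tgt k')
    {j j' : ℤ} (hj' : j' ≤ Q.mS (Q.src k')) (hj : 1 ≤ j)
    (h : j + Q.colOff k ≤ j' + Q.colOff k') : k ≤ k' := by
  by_contra hk
  have := hQ.colOff_add_le_colOff (not_le.1 hk) ht.symm
  omega

theorem Regular.page_unique (hQ : Q.Regular) {k k' : Fin Q.r} (ht : Q.tgt k = Q.tgt k')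
    {j j' : ℤ} (hj0 : 1 ≤ j) (hj : j ≤ Q.mS (Q.src k)) (hj0' : 1 ≤ j')
    (hj' : j' ≤ Q.mS (Q.src k')) (h : j + Q.colOff k = j' + Q.colOff k') : k = k' ∧ j = j' := by
  obtain rfl : k = k' :=
    le_antisymm (hQ.page_le_of_col_le ht hj' hj0 h.le) (hQ.page_le_of_col_le ht.symm hj hj0' h.ge)
  exact ⟨rfl, by omega⟩

theorem Regular.page_unique_row (hQ : Q.Regular) {k k' : Fin Q.r} (hs : Q.src k = Q.src k')
    {i i' : ℤ} (hi0 : 1 ≤ i) (hi : i ≤ Q.mT (Q.tgt k)) (hi0' : 1 ≤ i')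
    (hi' : i' ≤ Q.mT (Q.tgt k')) (h : i + Q.rowOff k = i' + Q.rowOff k') : k = k' ∧ i = i' :=
  hQ.transpose.page_unique (k := k) (k' := k') hs hi0 hi hi0' hi' h

theorem flow_eq (k : Fin Q.r) :
    (∑ l with l < k ∧ Q.tgt l = Q.tgt k, Q.uS (Q.src l)) + Q.uS (Q.src k) + Q.tail k =
      Q.flow (Q.tgt k) :=
  sum_below_add_above (fun l => Q.tgt l = Q.tgt k) (fun l => Q.uS (Q.src l)) rfl

theorem Regular.tail_add_le_tail (hQ : Q.Regular) {k k' : Fin Q.r} (h : k < k')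
    (ht : Q.tgt k = Q.tgt k') : Q.tail k' + Q.uS (Q.src k') ≤ Q.tail k := by
  have h1 := Q.flow_eq k
  have h2 := Q.flow_eq k'
  rw [← ht] at h2
  have := sum_below_add_le (fun l => Q.tgt l = Q.tgt k) (fun l => Q.uS (Q.src l))
    (fun l => by have := hQ.uS_pos (Q.src l); omega) rfl h
  omega

/-- Every number `n` below the flow is the number of vertical paths to the right of a unique path:
the `q`-th one on page `k`. -/
theorem exists_thread {α : T} {n : ℤ} (h0 : 0 ≤ n) (h1 : n < Q.flow α) :
    ∃ k q, Q.tgt k = α ∧ 1 ≤ q ∧ q ≤ Q.uS (Q.src k) ∧ n = Q.tail k + Q.uS (Q.src k) - q := by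
  obtain ⟨k, rfl, h2, h3⟩ := exists_sum_below_lt_le (fun l => Q.tgt l = α)
    (fun l => Q.uS (Q.src l)) (y := Q.flow α - n) (by omega) (by unfold flow; omega)
  have := Q.flow_eq k
  exact ⟨k, Q.tail k + Q.uS (Q.src k) - n, rfl, by omega, by omega, by omega⟩

variable (Q) in
/-- A straight system of horizontal and vertical lattice paths. The `p`-th horizontal path of the
target `α` is `h α p`, the `q`-th vertical path of the source `β` is `v β q`; the points are
positions in the block matrices. -/
structure Net where
  h : T → ℤ → ℤ → ℤ → Prop
  v : S → ℤ → ℤ → ℤ → Prop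
  h_path : ∀ α p, 1 ≤ p → p ≤ Q.uT α →
    LatticePath (h α p) (Q.mT α - Q.uT α + p) 1 p (Q.width α)
  v_path : ∀ β q, 1 ≤ q → q ≤ Q.uS β →
    LatticePath (v β q) (Q.height β) q 1 (Q.mS β - Q.uS β + q)
  h_index : ∀ {α p i j}, h α p i j → 1 ≤ p ∧ p ≤ Q.uT α
  v_index : ∀ {β q i j}, v β q i j → 1 ≤ q ∧ q ≤ Q.uS β
  h_inj : ∀ {α p p' i j}, h α p i j → h α p' i j → p = p'
  v_inj : ∀ {β q q' i j}, v β q i j → v β q' i j → q = q'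
  h_corner : ∀ {k p i j}, 1 ≤ j → j ≤ Q.mS (Q.src k) → h (Q.tgt k) p i (j + Q.colOff k) →
    (h (Q.tgt k) p i (j + 1 + Q.colOff k) ∨ h (Q.tgt k) p i (j - 1 + Q.colOff k)) →
    (h (Q.tgt k) p (i + 1) (j + Q.colOff k) ∨ h (Q.tgt k) p (i - 1) (j + Q.colOff k)) →
    ∃ q, v (Q.src k) q (i + Q.rowOff k) j
  v_corner : ∀ {k q i j}, 1 ≤ i → i ≤ Q.mT (Q.tgt k) → v (Q.src k) q (i + Q.rowOff k) j →
    (v (Q.src k) q (i + 1 + Q.rowOff k) j ∨ v (Q.src k) q (i - 1 + Q.rowOff k) j) →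
    (v (Q.src k) q (i + Q.rowOff k) (j + 1) ∨ v (Q.src k) q (i + Q.rowOff k) (j - 1)) →
    ∃ p, h (Q.tgt k) p i (j + Q.colOff k)

/-! ### Shared edges, meeting points and order of the paths of a net -/

namespace Net

variable (N : Q.Net)

/-- Exchange horizontal and vertical paths. -/
@[reducible] def transpose : Q.transpose.Net where
  h β q i j := N.v β q j i
  v α p i j := N.h α p j i
  h_path β q h1 h2 := (N.v_path β q h1 h2).transpose
  v_path α p h1 h2 := (N.h_path α p h1 h2).transpose
  h_index := N.v_index
  v_index := N.h_index
  h_inj := N.v_inj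
  v_inj := N.h_inj
  h_corner := N.v_corner
  v_corner := N.h_corner

/-- The horizontal path `p` of the target of `k` in the coordinates of page `k`. -/
abbrev hp (k : Fin Q.r) (p i j : ℤ) : Prop := N.h (Q.tgt k) p i (j + Q.colOff k)

/-- The vertical path `q` of the source of `k` in the coordinates of page `k`. -/
abbrev vp (k : Fin Q.r) (q i j : ℤ) : Prop := N.v (Q.src k) q (i + Q.rowOff k) j

variable {N}

theorem path_of_h {α : T} {p i j : ℤ} (H : N.h α p i j) :
    LatticePath (N.h α p) (Q.mT α - Q.uT α + p) 1 p (Q.width α) :=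
  N.h_path α p (N.h_index H).1 (N.h_index H).2

theorem path_of_hp {k : Fin Q.r} {p i j : ℤ} (H : N.hp k p i j) :
    LatticePath (N.hp k p) (Q.mT (Q.tgt k) - Q.uT (Q.tgt k) + p) (1 - Q.colOff k) p
      (Q.width (Q.tgt k) - Q.colOff k) := by
  have := (path_of_h H).translate 0 (Q.colOff k)
  simpa using this

theorem path_of_vp {k : Fin Q.r} {q i j : ℤ} (H : N.vp k q i j) :
    LatticePath (N.vp k q) (Q.height (Q.src k) - Q.rowOff k) q (1 - Q.rowOff k)
      (Q.mS (Q.src k) - Q.uS (Q.src k) + q) :=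
  (path_of_hp (N := N.transpose) (k := k) H).transpose

theorem h_bounds {α : T} {p i j : ℤ} (H : N.h α p i j) :
    1 ≤ p ∧ p ≤ Q.uT α ∧ p ≤ i ∧ i ≤ Q.mT α - Q.uT α + p ∧ 1 ≤ j ∧ j ≤ Q.width α := by
  have := N.h_index H
  have := (path_of_h H).bounds H
  omega

theorem hp_bounds {k : Fin Q.r} {p i j : ℤ} (H : N.hp k p i j) :
    1 ≤ p ∧ p ≤ Q.uT (Q.tgt k) ∧ p ≤ i ∧ i ≤ Q.mT (Q.tgt k) - Q.uT (Q.tgt k) + p := by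
  have := h_bounds H
  omega

theorem vp_bounds {k : Fin Q.r} {q i j : ℤ} (H : N.vp k q i j) :
    1 ≤ q ∧ q ≤ Q.uS (Q.src k) ∧ q ≤ j ∧ j ≤ Q.mS (Q.src k) - Q.uS (Q.src k) + q :=
  hp_bounds (N := N.transpose) (k := k) H

theorem row_bounds_of_page (hQ : Q.Regular) {k : Fin Q.r} {i : ℤ} (h1 : 1 ≤ i)
    (h2 : i ≤ Q.mT (Q.tgt k)) : 1 ≤ i + Q.rowOff k ∧ i + Q.rowOff k ≤ Q.height (Q.src k) := by
  have h3 : Q.rowOff k + Q.mT (Q.tgt k) ≤ Q.height (Q.src k) :=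
    hQ.transpose.colOff_add_le_width k
  have h4 : 0 ≤ Q.rowOff k := hQ.transpose.colOff_nonneg k
  omega

/-- Follow the horizontal path backwards down the last column. If it entered from the west, the
point is a corner. Otherwise the point below lies on a vertical path by induction, and that path
cannot leave the page to the east, so it goes north. -/
theorem exists_vp_lastCol (hQ : Q.Regular) {k : Fin Q.r} {p : ℤ} (n : ℕ) :
    ∀ i : ℤ, Q.mT (Q.tgt k) - i < n → 2 ≤ i → N.hp k p i (Q.mS (Q.src k)) →
      N.hp k p (i - 1) (Q.mS (Q.src k)) → ∃ q, N.vp k q i (Q.mS (Q.src k)) := by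
  induction n with
  | zero =>
    intro i hn hi H H'
    have := hp_bounds H
    push_cast at hn
    omega
  | succ n ih =>
    intro i hn hi H H'
    have hb := hp_bounds H
    have hN := hQ.uS_le (Q.src k)
    have hu := hQ.uS_pos (Q.src k)
    rcases (path_of_hp H).prev H with ⟨h1, h2⟩ | h1 | h1
    -- The horizontal path starts here, so the page has a single column, and a vertical path visits
    -- every row in that column.
    · have := hQ.colOff_nonneg k
      have hr := row_bounds_of_page hQ (k := k) (i := i) (by omega) (by omega)
      obtain ⟨j, hj⟩ := (N.v_path (Q.src k) 1 le_rfl hu).exists_on_row hr.1 hr.2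
      have hj' : N.vp k 1 i j := hj
      have := vp_bounds hj'
      obtain rfl : j = Q.mS (Q.src k) := by omega
      exact ⟨1, hj'⟩
    · exact N.h_corner (by omega) le_rfl H (.inr h1) (.inr H')
    · push_cast at hn
      obtain ⟨q, hq⟩ := ih (i + 1) (by omega) (by omega) h1 (by rwa [add_sub_cancel_right])
      have hq' := vp_bounds hq
      have hb1 := hp_bounds h1
      rcases (path_of_vp hq).next hq with ⟨h1, h2⟩ | h1 | h1
      · have h4 : 0 ≤ Q.rowOff k := hQ.transpose.colOff_nonneg k
        omega
      · have := vp_bounds h1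
        omega
      · exact ⟨q, by rwa [add_sub_cancel_right] at h1⟩

theorem vertical_edge_lastCol (hQ : Q.Regular) {k : Fin Q.r} {p i : ℤ} (hi : 2 ≤ i)
    (H : N.hp k p i (Q.mS (Q.src k))) (H' : N.hp k p (i - 1) (Q.mS (Q.src k))) :
    ∃ q, N.vp k q i (Q.mS (Q.src k)) ∧ N.vp k q (i - 1) (Q.mS (Q.src k)) := by
  obtain ⟨q, hq⟩ := exists_vp_lastCol hQ (Q.mT (Q.tgt k) - i + 1).toNat i (by omega) hi H H'
  refine ⟨q, hq, ?_⟩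
  rcases (path_of_vp hq).next hq with ⟨h1, h2⟩ | h1 | h1
  · have h4 : 0 ≤ Q.rowOff k := hQ.transpose.colOff_nonneg k
    omega
  · have := vp_bounds h1
    omega
  · exact h1

/-- Each vertical edge `(i, j), (i - 1, j)` of a horizontal path with `i + j < n` is an edge of
a vertical path. -/
def VerticalEdges (N : Q.Net) (n : ℕ) : Prop :=
  ∀ (k : Fin Q.r) (p i j : ℤ), i + j < n → 2 ≤ i → 1 ≤ j → j ≤ Q.mS (Q.src k) → N.hp k p i j → N.hp k p (i - 1) j →
    ∃ q, N.vp k q i j ∧ N.vp k q (i - 1) j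

/-- Both reductions go to an edge with smaller i + j: to a horizontal edge of a vertical path, where
the transposed hypothesis applies, or to the next vertical edge to the north. The last column is
treated apart because there the horizontal path may end. -/
theorem VerticalEdges.succ (hQ : Q.Regular) {n : ℕ} (ih : N.VerticalEdges n)
    (ihT : N.transpose.VerticalEdges n) : N.VerticalEdges (n + 1) := by
  intro k p i j hn hi hj hj' H H'
  push_cast at hn
  have hb := hp_bounds H
  rcases hj'.eq_or_lt with rfl | hj'
  · exact vertical_edge_lastCol hQ hi H H'
  by_cases hv : ∃ q, N.vp k q (i - 1) j
  · obtain ⟨q, hq⟩ := hv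
    rcases (path_of_vp hq).prev hq with ⟨h1, h2⟩ | h1 | h1
    · have hr := row_bounds_of_page hQ (k := k) (i := i) (by omega) (by omega)
      omega
    -- If the vertical path came from the west, that edge would be shared with the same horizontal
    -- path, which would then contain two points of one diagonal.
    · have h2 := vp_bounds h1
      obtain ⟨p', hp, hp'⟩ : ∃ p, N.hp k p (i - 1) j ∧ N.hp k p (i - 1) (j - 1) :=
        ihT k q j (i - 1) (by omega) (by omega) (by omega)
          (show i - 1 ≤ Q.mT (Q.tgt k) by omega) hq h1
      obtain rfl := N.h_inj hp H'
      have := (path_of_hp H).diag H hp' (by omega)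
      omega
    · exact ⟨q, by rwa [sub_add_cancel] at h1, hq⟩
  -- A point on no vertical path is no corner, so the horizontal path continues north; the induction
  -- hypothesis for that edge puts the point on a vertical path after all.
  · have hc : ¬ N.hp k p (i - 1) (j + 1) := fun h =>
      hv (N.h_corner hj hj'.le H' (.inl h) (.inl (by rwa [sub_add_cancel])))
    rcases (path_of_hp H').next H' with ⟨h1, h2⟩ | h1 | h1
    · have := hQ.colOff_add_le_width k
      omega
    · exact absurd h1 hc
    · have hb1 := hp_bounds h1
      obtain ⟨q, hq, -⟩ := ih k p (i - 1) j (by omega) (by omega) hj hj'.le H' h1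
      exact absurd ⟨q, hq⟩ hv

theorem verticalEdges (hQ : Q.Regular) (n : ℕ) :
    N.VerticalEdges n ∧ N.transpose.VerticalEdges n := by
  induction n with
  | zero =>
    constructor <;>
    · intro k p i j hn hi hj
      push_cast at hn
      omega
  | succ n ih => exact ⟨.succ hQ ih.1 ih.2, .succ hQ.transpose ih.2 ih.1⟩

/-- Each vertical edge of a horizontal path is an edge of a vertical path. -/
theorem exists_vp_of_vertical_edge (hQ : Q.Regular) {k : Fin Q.r} {p i j : ℤ} (hj : 1 ≤ j)
    (hj' : j ≤ Q.mS (Q.src k)) (H : N.hp k p i j) (H' : N.hp k p (i - 1) j) :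
    ∃ q, N.vp k q i j ∧ N.vp k q (i - 1) j := by
  have := hp_bounds H'
  exact (verticalEdges hQ (i + j + 1).toNat).1 k p i j (by omega) (by omega) hj hj' H H'

/-- Each horizontal edge of a vertical path is an edge of a horizontal path. -/
theorem exists_hp_of_horizontal_edge (hQ : Q.Regular) {k : Fin Q.r} {q i j : ℤ} (hi : 1 ≤ i)
    (hi' : i ≤ Q.mT (Q.tgt k)) (H : N.vp k q i j) (H' : N.vp k q i (j - 1)) :
    ∃ p, N.hp k p i j ∧ N.hp k p i (j - 1) :=
  exists_vp_of_vertical_edge (N := N.transpose) hQ.transpose (k := k) hi hi' H H'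

/-- Every horizontal path meets every vertical path on every page. -/
theorem exists_meet (hQ : Q.Regular) (k : Fin Q.r) {p q : ℤ} (hp : 1 ≤ p)
    (hp' : p ≤ Q.uT (Q.tgt k)) (hq : 1 ≤ q) (hq' : q ≤ Q.uS (Q.src k)) :
    ∃ i j, N.hp k p i j ∧ N.vp k q i j := by
  have P1 : LatticePath (N.hp k p) _ _ _ _ := path_of_hp (N := N) (k := k) (p := p)
    (i := Q.mT (Q.tgt k) - Q.uT (Q.tgt k) + p) (j := 1 - Q.colOff k)
    (by have := (N.h_path (Q.tgt k) p hp hp').start; simpa [Net.hp] using this)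
  have P2 : LatticePath (N.vp k q) _ _ _ _ := path_of_vp (N := N) (k := k) (q := q)
    (i := Q.height (Q.src k) - Q.rowOff k) (j := q)
    (by have := (N.v_path (Q.src k) q hq hq').start; simpa [Net.vp] using this)
  have a1 := hQ.colOff_nonneg k
  have a2 : 0 ≤ Q.rowOff k := hQ.transpose.colOff_nonneg k
  have a3 := hQ.colOff_add_le_width k
  have a4 : Q.rowOff k + Q.mT (Q.tgt k) ≤ Q.height (Q.src k) :=
    hQ.transpose.colOff_add_le_width k
  have a5 := hQ.uT_le (Q.tgt k)
  have a6 := hQ.uS_le (Q.src k)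
  generalize hA : 1 - Q.colOff k - (Q.mT (Q.tgt k) - Q.uT (Q.tgt k) + p) = A at *
  generalize hB : q - (Q.height (Q.src k) - Q.rowOff k) = B at *
  generalize hA' : Q.width (Q.tgt k) - Q.colOff k - p = A' at *
  generalize hB' : Q.mS (Q.src k) - Q.uS (Q.src k) + q - (1 - Q.rowOff k) = B' at *
  -- These are the first and the last diagonal common to both paths. At the first, the horizontal
  -- path starts west of or in the first column of the page, or the vertical path starts in or below
  -- its last row; the last diagonal is analogous.
  refine P1.exists_meet P2 (t₀ := max A B) (t₁ := min A' B') ?_ (by omega) (by omega) (by omega)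
    (by omega) ?_ ?_
  · omega
  · intro i i' H H'
    have b1 := hp_bounds H
    have b2 := vp_bounds H'
    have b3 := P1.bounds H
    have b4 := P2.bounds H'
    rcases le_total A B with h | h
    · rw [max_eq_right h] at *
      have := P2.diag H' P2.start (by omega)
      omega
    · rw [max_eq_left h] at *
      have := P1.diag H P1.start (by omega)
      omega
  · intro i i' H H'
    have b1 := hp_bounds H
    have b2 := vp_bounds H'
    have b3 := P1.bounds H
    have b4 := P2.bounds H'
    rcases le_total A' B' with h | h
    · rw [min_eq_left h] at *
      have := P1.diag H P1.fin (by omega)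
      omega
    · rw [min_eq_right h] at *
      have := P2.diag H' P2.fin (by omega)
      omega

/-- A horizontal path with larger index does not pass to the north-west of a point of one with
smaller index. -/
theorem h_order (hQ : Q.Regular) {α : T} {p p' i j i' j' : ℤ} (H : N.h α p i j)
    (H' : N.h α p' i' j') (hp : p < p') (hi : i' ≤ i) (hj : j' ≤ j) : False := by
  have P1 := path_of_h H
  have P2 := path_of_h H'
  have b1 := h_bounds H
  have b2 := h_bounds H'
  have hw := hQ.uT_le α
  -- The comparison begins on the diagonal where p starts. There p is in column 1, so the other
  -- path, which has already started, is strictly to the south-east on that diagonal.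
  have key : ∀ t, 1 - (Q.mT α - Q.uT α + p) ≤ t → ∀ x x', N.h α p x (x + t) →
      N.h α p' x' (x' + t) → x < x' := by
    intro t ht x x' Hx Hx'
    refine LatticePath.lt_of_disjoint P1 P2 (fun i j h h' => hp.ne (N.h_inj h h')) le_rfl
      (by omega) ?_ ht Hx Hx'
    intro y y' Hy Hy'
    have h1 := P1.diag Hy P1.start (by omega)
    have h2 := h_bounds Hy'
    have h3 : y ≠ y' := by
      rintro rfl
      exact hp.ne (N.h_inj Hy Hy')
    omega
  by_cases hl : 1 - (Q.mT α - Q.uT α + p) ≤ j' - i'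
  · by_cases hu : j' - i' ≤ Q.width α - p
    · obtain ⟨x, hx⟩ := P1.exists_on_diag hl hu
      have h1 := key _ hl x i' hx (by rwa [add_sub_cancel])
      rcases le_total (j - i) (j' - i') with hd | hd
      · have := P1.mono H hx (by omega)
        omega
      · have := P1.mono hx H (by omega)
        omega
    · omega
  · omega

/-- Paths through vertically adjacent points have adjacent indices. -/
theorem h_adjacent (hQ : Q.Regular) {α : T} {p p' i j : ℤ} (H : N.h α p i j)
    (H' : N.h α p' (i + 1) j) (hne : p ≠ p') : p' = p + 1 := by
  have hlt : p < p' := by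
    by_contra h
    exact h_order hQ H' H (by omega) (by omega) le_rfl
  by_contra h
  have b1 := h_bounds H
  have b2 := h_bounds H'
  -- If p' were larger than p + 1, the path p + 1 would have to cross column j strictly between rows
  -- i and i + 1.
  obtain ⟨x, hx⟩ := (N.h_path α (p + 1) (by omega) (by omega)).exists_on_col b1.2.2.2.2.1
    b1.2.2.2.2.2
  by_cases hxi : x ≤ i
  · exact h_order hQ H hx (by omega) hxi le_rfl
  · exact h_order hQ hx H' (by omega) (by omega) le_rfl

end Net
end PageShape

/-! ### Replacing a north-west corner -/

namespace PageShape
namespace Net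

variable {S T : Type*} [DecidableEq S] [DecidableEq T] {Q : PageShape S T} {N : Q.Net}

/-- The point `(i, j)` of page `k` lies on a horizontal and a vertical path. -/
def Cross (N : Q.Net) (k : Fin Q.r) (i j : ℤ) : Prop :=
  (∃ p, N.hp k p i j) ∧ ∃ q, N.vp k q i j

theorem cross_transpose {k : Fin Q.r} {i j : ℤ} : N.transpose.Cross k j i ↔ N.Cross k i j :=
  and_comm

/-- The position `(i, y)` of the block matrix of `α` lies on a horizontal and a vertical path. -/
def CrossAt (N : Q.Net) (α : T) (i y : ℤ) : Prop :=
  ∃ k j, Q.tgt k = α ∧ y = j + Q.colOff k ∧ N.Cross k i j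

theorem Cross.bounds {k : Fin Q.r} {i j : ℤ} (H : N.Cross k i j) :
    1 ≤ i ∧ i ≤ Q.mT (Q.tgt k) ∧ 1 ≤ j ∧ j ≤ Q.mS (Q.src k) := by
  obtain ⟨⟨p, hp⟩, q, hq⟩ := H
  have := hp_bounds hp
  have := vp_bounds hq
  omega

theorem crossAt_tgt (hQ : Q.Regular) {k : Fin Q.r} {i j : ℤ} (h1 : 1 ≤ j)
    (h2 : j ≤ Q.mS (Q.src k)) : N.CrossAt (Q.tgt k) i (j + Q.colOff k) ↔ N.Cross k i j := by
  constructor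
  · rintro ⟨k', j', ht, e, H⟩
    have := Cross.bounds H
    obtain ⟨rfl, rfl⟩ := hQ.page_unique ht.symm h1 h2 this.2.2.1 this.2.2.2 e
    exact H
  · intro H
    exact ⟨k, j, rfl, rfl, H⟩

theorem crossAt_of_corner {α : T} {p i y : ℤ} (H : N.h α p i y)
    (H1 : N.h α p i (y + 1) ∨ N.h α p i (y - 1)) (H2 : N.h α p (i + 1) y ∨ N.h α p (i - 1) y) :
    N.CrossAt α i y := by
  have hb := h_bounds H
  obtain ⟨k, j, rfl, rfl, h1, h2⟩ := exists_page hb.2.2.2.2.1 hb.2.2.2.2.2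
  refine ⟨k, j, rfl, rfl, ⟨p, H⟩, N.h_corner h1 h2 H ?_ H2⟩
  rwa [add_right_comm, show j - 1 + Q.colOff k = j + Q.colOff k - 1 by ring]

theorem exists_vertical_edge_page (hQ : Q.Regular) {α : T} {p i y : ℤ} (H : N.h α p (i + 1) y)
    (H' : N.h α p i y) : ∃ k q j, Q.tgt k = α ∧ y = j + Q.colOff k ∧ 1 ≤ j ∧
      j ≤ Q.mS (Q.src k) ∧ N.vp k q (i + 1) j ∧ N.vp k q i j := by
  have hb := h_bounds H
  obtain ⟨k, j, rfl, rfl, h1, h2⟩ := exists_page hb.2.2.2.2.1 hb.2.2.2.2.2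
  obtain ⟨q, hq⟩ := exists_vp_of_vertical_edge hQ (k := k) (p := p) (i := i + 1) (j := j) h1 h2 H
    (by rwa [add_sub_cancel_right])
  rw [add_sub_cancel_right] at hq
  exact ⟨k, q, j, rfl, rfl, h1, h2, hq⟩

theorem crossAt_of_vertical_edge (hQ : Q.Regular) {α : T} {p i y : ℤ} (H : N.h α p (i + 1) y)
    (H' : N.h α p i y) : N.CrossAt α (i + 1) y ∧ N.CrossAt α i y := by
  obtain ⟨k, q, j, rfl, rfl, -, -, hq⟩ := exists_vertical_edge_page hQ H H'
  exact ⟨⟨k, j, rfl, rfl, ⟨p, H⟩, q, hq.1⟩, ⟨k, j, rfl, rfl, ⟨p, H'⟩, q, hq.2⟩⟩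

/-- Between two consecutive crossing points in its row, a path is straight. -/
theorem h_row (hQ : Q.Regular) {α : T} {p i c c' : ℤ} (H : N.h α p i c) (H1 : N.h α p i (c + 1))
    (hc' : c' ≤ Q.width α) (gap : ∀ y, c < y → y < c' → ¬ N.CrossAt α i y) :
    ∀ y, c ≤ y → y ≤ c' → N.h α p i y := by
  intro y hy
  induction y, hy using Int.leInduction with
  | base => exact fun _ => H
  | succ y hy ih =>
    intro hy'
    rcases hy.eq_or_lt with rfl | hlt
    · exact H1
    have Hy := ih (by omega)
    rcases (path_of_h Hy).next Hy with h | h | h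
    · omega
    · exact h
    · rcases (path_of_h Hy).prev Hy with h2 | h2 | h2
      · have := h_bounds H
        omega
      · exact absurd (crossAt_of_corner Hy (.inr h2) (.inr h)) (gap y hlt (by omega))
      · exact absurd (crossAt_of_vertical_edge hQ h2 Hy).2 (gap y hlt (by omega))

/-- The horizontal path `p` of `α` has a north-west corner at `(i, c)`, the next crossing point in
its row is `(i, c')`, and no horizontal path meets row `i + 1` in the columns `c + 1, …, c'`. -/
structure FreeCorner (N : Q.Net) (α : T) (p i c c' : ℤ) : Prop where
  lt : c < c'
  south : N.h α p (i + 1) c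
  row : ∀ y, c ≤ y → y ≤ c' → N.h α p i y
  last : N.CrossAt α i c'
  gap : ∀ y, c < y → y < c' → ¬ N.CrossAt α i y
  free : ∀ p' y, c < y → y ≤ c' → ¬ N.h α p' (i + 1) y

/-- Replace the part `(i, c), …, (i, c' - 1)` of a path by `(i + 1, c + 1), …, (i + 1, c')`. -/
def replaceIn {A : Type*} (F : A → ℤ → ℤ → ℤ → Prop) (a : A) (p i c c' : ℤ) :
    A → ℤ → ℤ → ℤ → Prop := fun a' p' x y =>
  (F a' p' x y ∧ ¬ (a' = a ∧ p' = p ∧ x = i ∧ c ≤ y ∧ y < c')) ∨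
    (a' = a ∧ p' = p ∧ x = i + 1 ∧ c < y ∧ y ≤ c')

namespace FreeCorner

variable {α : T} {p i c c' : ℤ}

theorem corner (F : N.FreeCorner α p i c c') : N.h α p i c := F.row c le_rfl F.lt.le

theorem not_south_east (F : N.FreeCorner α p i c c') {x y : ℤ} (H : N.h α p x y) (hx : i < x)
    (hy : c < y) : False :=
  (path_of_h H).not_lt_lt F.corner H hx hy

theorem path (F : N.FreeCorner α p i c c') (α' : T) (p' : ℤ) (h1 : 1 ≤ p') (h2 : p' ≤ Q.uT α') :
    LatticePath (replaceIn N.h α p i c c' α' p') (Q.mT α' - Q.uT α' + p') 1 p' (Q.width α') := by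
  by_cases h : α' = α ∧ p' = p
  · obtain ⟨rfl, rfl⟩ := h
    refine ((N.h_path α' p' h1 h2).replace_corner F.lt F.south F.row).congr fun x y => ?_
    simp [replaceIn]
  · refine (N.h_path α' p' h1 h2).congr fun x y => ?_
    unfold replaceIn
    tauto

theorem index (F : N.FreeCorner α p i c c') {α' : T} {p' x y : ℤ}
    (H : replaceIn N.h α p i c c' α' p' x y) : 1 ≤ p' ∧ p' ≤ Q.uT α' := by
  rcases H with ⟨H, -⟩ | ⟨rfl, rfl, -⟩
  · exact N.h_index H
  · exact N.h_index F.south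

theorem inj (F : N.FreeCorner α p i c c') {α' : T} {p' p'' x y : ℤ}
    (H : replaceIn N.h α p i c c' α' p' x y) (H' : replaceIn N.h α p i c c' α' p'' x y) :
    p' = p'' := by
  rcases H with ⟨H, -⟩ | ⟨rfl, rfl, rfl, h1, h2⟩ <;>
    rcases H' with ⟨H', -⟩ | ⟨h0, rfl, h3, h4, h5⟩
  · exact N.h_inj H H'
  · subst h0 h3
    exact absurd H (F.free p' y h4 h5)
  · exact absurd H' (F.free p'' y h1 h2)
  · rfl

/-- The points (i + 1, c) and (i, c') are already crossing points. Away from them, a remaining old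
point that is a corner of the new path was a corner before, and an inserted point other than (i + 1,
c') has no vertical edge. -/
theorem corner_cases (hQ : Q.Regular) (F : N.FreeCorner α p i c c') {k : Fin Q.r} {p' x y : ℤ} (hy : 1 ≤ y)
    (hy' : y ≤ Q.mS (Q.src k))
    (H : replaceIn N.h α p i c c' (Q.tgt k) p' x (y + Q.colOff k))
    (H1 : replaceIn N.h α p i c c' (Q.tgt k) p' x (y + 1 + Q.colOff k) ∨
      replaceIn N.h α p i c c' (Q.tgt k) p' x (y - 1 + Q.colOff k))
    (H2 : replaceIn N.h α p i c c' (Q.tgt k) p' (x + 1) (y + Q.colOff k) ∨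
      replaceIn N.h α p i c c' (Q.tgt k) p' (x - 1) (y + Q.colOff k)) :
    (∃ q, N.vp k q x y) ∨ (Q.tgt k = α ∧ p' = p ∧ x = i + 1 ∧ y + Q.colOff k = c') := by
  by_cases hα : Q.tgt k = α ∧ p' = p
  swap
  · left
    have e : ∀ a b, replaceIn N.h α p i c c' (Q.tgt k) p' a b → N.h (Q.tgt k) p' a b := by
      intro a b h
      unfold replaceIn at h
      tauto
    exact N.h_corner hy hy' (e _ _ H) (H1.imp (e _ _) (e _ _)) (H2.imp (e _ _) (e _ _))
  obtain ⟨rfl, rfl⟩ := hα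
  have e : ∀ a b, replaceIn N.h (Q.tgt k) p' i c c' (Q.tgt k) p' a b →
      (N.h (Q.tgt k) p' a b ∧ ¬ (a = i ∧ c ≤ b ∧ b < c')) ∨ (a = i + 1 ∧ c < b ∧ b ≤ c') := by
    intro a b h
    simpa [replaceIn] using h
  rcases e _ _ H with ⟨h0, h0'⟩ | h0
  · by_cases s1 : x = i + 1 ∧ y + Q.colOff k = c
    · left
      have := (crossAt_of_vertical_edge hQ F.south F.corner).1
      rw [← s1.1, ← s1.2] at this
      exact ((crossAt_tgt hQ hy hy').1 this).2
    by_cases s2 : x = i ∧ y + Q.colOff k = c'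
    · left
      have := F.last
      rw [← s2.1, ← s2.2] at this
      exact ((crossAt_tgt hQ hy hy').1 this).2
    -- An old point next to an inserted one is removed, is one of the two points just treated, or
    -- lies south-east of the corner; the last is impossible on a lattice path.
    have ns : ¬ (i < x ∧ c < y + Q.colOff k) := fun h => F.not_south_east h0 h.1 h.2
    left
    refine N.h_corner hy hy' h0 (H1.imp (fun h => ?_) (fun h => ?_))
      (H2.imp (fun h => ?_) (fun h => ?_))
    all_goals
      rcases e _ _ h with h | h
      · exact h.1
      · omega
  · by_cases s1 : y + Q.colOff k = c'
    · exact .inr ⟨rfl, rfl, h0.1, s1⟩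
    · exfalso
      rcases H2 with h | h
      · rcases e _ _ h with h | h
        · exact F.not_south_east h.1 (by omega) (by omega)
        · omega
      · rcases e _ _ h with h | h <;> omega

theorem not_replaceIn_corner (F : N.FreeCorner α p i c c') {p' : ℤ} :
    ¬ replaceIn N.h α p i c c' α p' i c := by
  rintro (⟨H, hn⟩ | h)
  · exact hn ⟨rfl, N.h_inj H F.corner, rfl, le_rfl, F.lt⟩
  · omega

/-- Such a vertical path would continue east, and the shared horizontal edge would contradict
`free`, or north, which would create a crossing point in the gap. Hence the inserted segment creates
no crossing before its east end. -/
theorem not_vp_south (hQ : Q.Regular) {k : Fin Q.r} {j q : ℤ}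
    (F : N.FreeCorner (Q.tgt k) p i c c') (h1 : c < j + Q.colOff k) (h2 : j + Q.colOff k < c') :
    ¬ N.vp k q (i + 1) j := by
  intro H
  have hb := vp_bounds H
  have hs := h_bounds F.south
  have hi := h_bounds F.corner
  have hu := hQ.uS_le (Q.src k)
  rcases (path_of_vp H).next H with h | h | h
  · have := row_bounds_of_page hQ (k := k) (i := i) (by omega) (by omega)
    omega
  · obtain ⟨p', -, hp'⟩ := exists_hp_of_horizontal_edge hQ (k := k) (q := q) (i := i + 1)
      (j := j + 1) (by omega) (by omega) h (by rwa [add_sub_cancel_right])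
    rw [add_sub_cancel_right] at hp'
    exact F.free p' _ h1 h2.le hp'
  · rw [add_sub_cancel_right] at h
    exact F.gap _ h1 h2 ((crossAt_tgt hQ (by omega) (by omega)).2
      ⟨⟨p, F.row _ h1.le h2.le⟩, q, h⟩)

variable (N) in
/-- `C'` is obtained from the crossing points of `N` by moving a point from `(i, c)` to
`(i + 1, c')` in the block matrix of `α`. -/
def Moved (α : T) (i c c' : ℤ) (N' : Q.Net) : Prop :=
  ∀ k x y, N'.Cross k x y ↔
    (N.Cross k x y ∧ ¬ (Q.tgt k = α ∧ x = i ∧ y + Q.colOff k = c)) ∨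
      (Q.tgt k = α ∧ x = i + 1 ∧ y + Q.colOff k = c' ∧ 1 ≤ y ∧ y ≤ Q.mS (Q.src k))

/-- If the vertical path at the corner comes from the north, only the horizontal path has to be
changed. -/
theorem exists_moved_of_north (hQ : Q.Regular) {k : Fin Q.r} {j q : ℤ}
    (F : N.FreeCorner (Q.tgt k) p i (j + Q.colOff k) c') (hq : N.vp k q i j)
    (hqs : N.vp k q (i + 1) j) (hne : ¬ N.vp k q i (j + 1)) :
    ∃ N', Moved N (Q.tgt k) i (j + Q.colOff k) c' N' := by
  have hs := h_bounds F.south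
  have hi := h_bounds F.corner
  have hbq := vp_bounds hq
  have hu := hQ.uS_le (Q.src k)
  -- The vertical path through (i, c') comes from the south. Had it come from the west, its
  -- horizontal edge would be shared and (i, c' - 1) would be a crossing point: either in the gap,
  -- or equal to the corner, where q does not turn east.
  have end_mem : ∀ k' y, Q.tgt k' = Q.tgt k → 1 ≤ y → y ≤ Q.mS (Q.src k') →
      y + Q.colOff k' = c' → ∃ q', N.vp k' q' (i + 1) y := by
    intro k' y ht h1 h2 e
    have hl := F.last
    rw [← e, ← ht] at hl
    obtain ⟨⟨p', hp'⟩, q', hq'⟩ := (crossAt_tgt hQ h1 h2).1 hl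
    have hi' : i + 1 ≤ Q.mT (Q.tgt k') := by rw [ht]; omega
    have hw := row_bounds_of_page hQ (k := k') (i := i + 1) (by omega) hi'
    refine ⟨q', ?_⟩
    rcases (path_of_vp hq').prev hq' with h | h | h
    · omega
    · exfalso
      obtain ⟨p'', hp''⟩ := exists_hp_of_horizontal_edge hQ (k := k') (q := q') (i := i)
        (j := y) (by omega) (by omega) hq' h
      have hb' := vp_bounds h
      have hu' := hQ.uS_le (Q.src k')
      have hlt := F.lt
      by_cases hjy : y - 1 + Q.colOff k' = j + Q.colOff k
      · obtain ⟨rfl, rfl⟩ := hQ.page_unique ht (by omega) (by omega) (by omega) (by omega) hjy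
        obtain rfl := N.v_inj h hq
        exact hne (by rwa [sub_add_cancel])
      · refine F.gap (y - 1 + Q.colOff k') (by omega) (by omega) ?_
        rw [← ht]
        exact (crossAt_tgt hQ (by omega) (by omega)).2 ⟨⟨p'', hp''.2⟩, q', h⟩
    · exact h
  refine ⟨⟨replaceIn N.h (Q.tgt k) p i (j + Q.colOff k) c', N.v, F.path, N.v_path, F.index,
    N.v_index, F.inj, N.v_inj, ?_, ?_⟩, ?_⟩
  · intro k' p' x y hy hy' H H1 H2
    rcases F.corner_cases hQ hy hy' H H1 H2 with h | ⟨ht, rfl, rfl, e⟩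
    · exact h
    · exact end_mem k' y ht hy hy' e
  · intro k' q' x y hx hx' H H1 H2
    obtain ⟨p', hp'⟩ := N.v_corner hx hx' H H1 H2
    -- No removed point is a corner of a vertical path: at (i, c) the path q has no horizontal edge,
    -- and the other removed points lie in the gap and are not crossing points.
    refine ⟨p', .inl ⟨hp', ?_⟩⟩
    rintro ⟨ht, rfl, rfl, h1, h2⟩
    have hb := vp_bounds H
    have hu' := hQ.uS_le (Q.src k')
    rcases h1.eq_or_lt with h1 | h1
    · obtain ⟨rfl, rfl⟩ := hQ.page_unique ht (by omega) (by omega) (by omega) (by omega) h1.symm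
      obtain rfl := N.v_inj H hq
      rcases H2 with h | h
      · exact hne h
      · have := (path_of_vp hq).diag hqs h (by omega)
        omega
    · refine F.gap _ h1 h2 ?_
      rw [← ht]
      exact (crossAt_tgt hQ (by omega) (by omega)).2 ⟨⟨p', hp'⟩, q', H⟩
  · intro k' x y
    constructor
    · rintro ⟨⟨p', H | ⟨ht, rfl, rfl, h1, h2⟩⟩, q', hq'⟩
      · refine .inl ⟨⟨⟨p', H.1⟩, q', hq'⟩, ?_⟩
        rintro ⟨ht, rfl, e⟩
        have h3 := H.1
        rw [ht, e] at h3
        exact H.2 ⟨ht, N.h_inj h3 F.corner, rfl, e.ge, e ▸ F.lt⟩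
      · have hb := vp_bounds hq'
        have hu' := hQ.uS_le (Q.src k')
        rcases h2.eq_or_lt with h2 | h2
        · exact .inr ⟨ht, rfl, h2, by omega, by omega⟩
        · exact absurd hq' (not_vp_south (N := N) hQ (ht ▸ F) h1 h2)
    · rintro (⟨⟨⟨p', hp'⟩, q', hq'⟩, hn⟩ | ⟨ht, rfl, e, h1, h2⟩)
      · refine ⟨⟨p', .inl ⟨hp', ?_⟩⟩, q', hq'⟩
        rintro ⟨ht, rfl, rfl, h1, h2⟩
        rcases h1.eq_or_lt with h1 | h1
        · exact hn ⟨ht, rfl, h1.symm⟩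
        · have hb := vp_bounds hq'
          have hu' := hQ.uS_le (Q.src k')
          refine F.gap _ h1 h2 ?_
          rw [← ht]
          exact (crossAt_tgt hQ (by omega) (by omega)).2 ⟨⟨p', hp'⟩, q', hq'⟩
      · exact ⟨⟨p, .inr ⟨ht, rfl, rfl, e ▸ F.lt, e.le⟩⟩, end_mem k' y ht h1 h2 e⟩

/-- The hypotheses are symmetric under transposition, so this one statement supplies both
straightness conditions of the new net. -/
theorem corner_of_both (hQ : Q.Regular) {k : Fin Q.r} {j q : ℤ}
    (F : N.FreeCorner (Q.tgt k) p i (j + Q.colOff k) (j + Q.colOff k + 1))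
    (G : N.transpose.FreeCorner (Q.src k) q j (i + Q.rowOff k) (i + Q.rowOff k + 1))
    {k' : Fin Q.r} {p' x y : ℤ} (hy : 1 ≤ y) (hy' : y ≤ Q.mS (Q.src k'))
    (H : replaceIn N.h (Q.tgt k) p i (j + Q.colOff k) (j + Q.colOff k + 1) (Q.tgt k') p' x
      (y + Q.colOff k'))
    (H1 : replaceIn N.h (Q.tgt k) p i (j + Q.colOff k) (j + Q.colOff k + 1) (Q.tgt k') p' x
        (y + 1 + Q.colOff k') ∨
      replaceIn N.h (Q.tgt k) p i (j + Q.colOff k) (j + Q.colOff k + 1) (Q.tgt k') p' x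
        (y - 1 + Q.colOff k'))
    (H2 : replaceIn N.h (Q.tgt k) p i (j + Q.colOff k) (j + Q.colOff k + 1) (Q.tgt k') p' (x + 1)
        (y + Q.colOff k') ∨
      replaceIn N.h (Q.tgt k) p i (j + Q.colOff k) (j + Q.colOff k + 1) (Q.tgt k') p' (x - 1)
        (y + Q.colOff k')) :
    ∃ q', replaceIn N.transpose.h (Q.src k) q j (i + Q.rowOff k) (i + Q.rowOff k + 1) (Q.src k') q'
      y (x + Q.rowOff k') := by
  have hG := vp_bounds (N := N) (k := k) (q := q) (i := i) (j := j + 1) G.south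
  have hq := vp_bounds (N := N) (k := k) (q := q) (i := i) (j := j) G.corner
  have hu := hQ.uS_le (Q.src k)
  have hi := h_bounds F.corner
  rcases F.corner_cases hQ hy hy' H H1 H2 with ⟨q', hq'⟩ | ⟨ht, rfl, rfl, e⟩
  · refine ⟨q', .inl ⟨hq', ?_⟩⟩
    rintro ⟨hs, rfl, rfl, h1, h2⟩
    have hx := F.index H
    have hxb : 1 ≤ x ∧ x ≤ Q.mT (Q.tgt k') := by
      have h3 := (F.path _ _ hx.1 hx.2).bounds H
      have := hQ.uT_le (Q.tgt k')
      omega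
    obtain ⟨rfl, rfl⟩ := hQ.page_unique_row (i := i) hs.symm (by omega) (by omega) hxb.1 hxb.2
      (by omega)
    exact F.not_replaceIn_corner H
  · obtain ⟨rfl, rfl⟩ := hQ.page_unique (j' := j + 1) ht hy hy' (by omega) (by omega) (by omega)
    exact ⟨q, .inr ⟨rfl, rfl, rfl, by omega, by omega⟩⟩

/-- If the vertical path at the corner comes from the east, both paths have to be changed. -/
theorem exists_moved_of_east (hQ : Q.Regular) {k : Fin Q.r} {j q : ℤ}
    (F : N.FreeCorner (Q.tgt k) p i (j + Q.colOff k) (j + Q.colOff k + 1))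
    (G : N.transpose.FreeCorner (Q.src k) q j (i + Q.rowOff k) (i + Q.rowOff k + 1)) :
    ∃ N', Moved N (Q.tgt k) i (j + Q.colOff k) (j + Q.colOff k + 1) N' := by
  have hG := vp_bounds (N := N) (k := k) (q := q) (i := i) (j := j + 1) G.south
  have hq := vp_bounds (N := N) (k := k) (q := q) (i := i) (j := j) G.corner
  have hu := hQ.uS_le (Q.src k)
  have hi := h_bounds F.corner
  have hi' := h_bounds F.south
  refine ⟨⟨replaceIn N.h (Q.tgt k) p i (j + Q.colOff k) (j + Q.colOff k + 1),
    fun β q' x y => replaceIn N.transpose.h (Q.src k) q j (i + Q.rowOff k) (i + Q.rowOff k + 1)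
      β q' y x, F.path, fun β q' h1 h2 => (G.path β q' h1 h2).transpose, F.index, G.index, F.inj,
    G.inj, F.corner_of_both hQ G, ?_⟩, ?_⟩
  · intro k' q' x y hx hx' H H1 H2
    exact G.corner_of_both (N := N.transpose) hQ.transpose (k := k) (k' := k') F hx hx' H H1 H2
  · intro k' x y
    constructor
    · rintro ⟨⟨p', H | ⟨ht, rfl, rfl, h1, h2⟩⟩, q', H' | ⟨hs, rfl, rfl, h3, h4⟩⟩
      · refine .inl ⟨⟨⟨p', H.1⟩, q', H'.1⟩, ?_⟩
        rintro ⟨ht, rfl, e⟩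
        have h3 := H.1
        rw [ht, e] at h3
        exact H.2 ⟨ht, N.h_inj h3 F.corner, rfl, e.ge, by omega⟩
      · have hb := hp_bounds H.1
        obtain ⟨rfl, rfl⟩ := hQ.page_unique_row (i := i + 1) hs.symm (by omega) (by omega)
          (i' := x) (by omega) (by omega) (by omega)
        exact .inr ⟨rfl, rfl, by omega, by omega, by omega⟩
      · have hb := vp_bounds (N := N) (k := k') H'.1
        have := hQ.uS_le (Q.src k')
        exact .inr ⟨ht, rfl, by omega, by omega, by omega⟩
      · exact .inr ⟨ht, rfl, by omega, by omega, by rw [hs]; omega⟩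
    · rintro (⟨⟨⟨p', hp'⟩, q', hq'⟩, hn⟩ | ⟨ht, rfl, e, h1, h2⟩)
      · refine ⟨⟨p', .inl ⟨hp', ?_⟩⟩, q', .inl ⟨hq', ?_⟩⟩
        · rintro ⟨ht, rfl, rfl, h1, h2⟩
          exact hn ⟨ht, rfl, by omega⟩
        · rintro ⟨hs, rfl, rfl, h1, h2⟩
          have hb := hp_bounds hp'
          have := hQ.uT_le (Q.tgt k')
          obtain ⟨rfl, rfl⟩ := hQ.page_unique_row (i := i) (i' := x) hs.symm (by omega) (by omega) (by omega)
            (by omega) (by omega)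
          exact hn ⟨rfl, rfl, rfl⟩
      · obtain ⟨rfl, rfl⟩ := hQ.page_unique (j' := j + 1) ht h1 h2 (by omega) (by omega) (by omega)
        exact ⟨⟨p, .inr ⟨rfl, rfl, rfl, by omega, by omega⟩⟩, q,
          .inr ⟨rfl, rfl, rfl, by omega, by omega⟩⟩

/-- Moving a free corner of a horizontal path. -/
theorem exists_moved (hQ : Q.Regular) (F : N.FreeCorner α p i c c') :
    ∃ N', Moved N α i c c' N' := by
  obtain ⟨k, q, j, rfl, rfl, h1, h2, hqs, hq⟩ := exists_vertical_edge_page hQ F.south F.corner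
  -- The vertical path q shares the edge below the corner. It remains to see whether it turns at the
  -- corner as well.
  by_cases hne : N.vp k q i (j + 1)
  swap
  · exact F.exists_moved_of_north hQ hq hqs hne
  have hi := h_bounds F.corner
  have hi' := h_bounds F.south
  have hb := vp_bounds hne
  have hu := hQ.uS_le (Q.src k)
  obtain ⟨p', hp', hp''⟩ := exists_hp_of_horizontal_edge hQ (k := k) (q := q) (i := i)
    (j := j + 1) (by omega) (by omega) hne (by rwa [add_sub_cancel_right])
  have hC : N.CrossAt (Q.tgt k) i (j + 1 + Q.colOff k) :=
    (crossAt_tgt hQ (by omega) (by omega)).2 ⟨⟨p', hp'⟩, q, hne⟩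
  -- The east edge of q is shared with a horizontal path, so the next crossing point is adjacent to
  -- the corner.
  obtain rfl : c' = j + Q.colOff k + 1 := by
    by_contra h
    have := F.lt
    exact F.gap _ (by omega) (by omega) hC
  -- The block is a 2 × 2 square, and the same square is a free corner of the vertical path. A
  -- vertical path through its SE point would lead east to a horizontal path excluded by `free`, or
  -- north onto q, which already meets that diagonal.
  refine F.exists_moved_of_east hQ (q := q) ⟨by omega, hne, ?_, ?_, by omega, ?_⟩
  · intro y hy hy'
    rcases hy.eq_or_lt with rfl | hy
    · exact hq
    · obtain rfl : y = i + 1 + Q.rowOff k := by omega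
      exact hqs
  · have : N.Cross k (i + 1) j := ⟨⟨p, F.south⟩, q, hqs⟩
    exact ⟨k, i + 1, rfl, by change _ = i + 1 + Q.rowOff k; omega, cross_transpose.2 this⟩
  · intro q' y hy hy' H
    obtain rfl : y = i + 1 + Q.rowOff k := by omega
    have H : N.vp k q' (i + 1) (j + 1) := H
    have hbH := vp_bounds H
    rcases (path_of_vp H).next H with h | h | h
    · have := row_bounds_of_page hQ (k := k) (i := i) (by omega) (by omega)
      omega
    · obtain ⟨p₁, -, hp₁⟩ := exists_hp_of_horizontal_edge hQ (k := k) (q := q') (i := i + 1)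
        (j := j + 1 + 1) (by omega) (by omega) h (by rwa [add_sub_cancel_right])
      rw [add_sub_cancel_right] at hp₁
      exact F.free p₁ (j + 1 + Q.colOff k) (by omega) (by omega) hp₁
    · rw [add_sub_cancel_right] at h
      obtain rfl := N.v_inj h hne
      have := (path_of_vp hq).diag hq H (by omega)
      omega

end FreeCorner

end Net
end PageShape

/-! ### Nets without free corners -/

namespace PageShape

variable {S T : Type*} [DecidableEq S] [DecidableEq T] {Q : PageShape S T}

/-- Among the vertical paths through the block matrix of a target, the path `q'` on page `k'` comes
after the path `q` on page `k`. -/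
def Later (k : Fin Q.r) (q : ℤ) (k' : Fin Q.r) (q' : ℤ) : Prop :=
  k < k' ∨ (k = k' ∧ q < q')

theorem Later.number_lt (hQ : Q.Regular) {k k' : Fin Q.r} {q q' : ℤ} (ht : Q.tgt k = Q.tgt k')
    (hq : q ≤ Q.uS (Q.src k)) (hq' : 1 ≤ q') (h : Later k q k' q') :
    Q.tail k' + Q.uS (Q.src k') - q' < Q.tail k + Q.uS (Q.src k) - q := by
  rcases h with h | ⟨rfl, h⟩
  · have := hQ.tail_add_le_tail h ht
    omega
  · omega

theorem later_of_number_lt (hQ : Q.Regular) {k k' : Fin Q.r} {q q' : ℤ} (ht : Q.tgt k = Q.tgt k')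
    (hq : 1 ≤ q) (hq' : q' ≤ Q.uS (Q.src k'))
    (h : Q.tail k' + Q.uS (Q.src k') - q' < Q.tail k + Q.uS (Q.src k) - q) :
    Later k q k' q' := by
  by_contra hn
  rcases lt_trichotomy k k' with hk | rfl | hk
  · exact hn (.inl hk)
  · exact hn (.inr ⟨rfl, by omega⟩)
  · have := Later.number_lt hQ ht.symm hq' hq (.inl hk)
    omega

/-- The path that goes east in row `a` up to column `c`, north up to row `p`, and east up to
column `w`. -/
def Hook (a p c w x y : ℤ) : Prop :=
  (x = a ∧ 1 ≤ y ∧ y ≤ c) ∨ (y = c ∧ p ≤ x ∧ x ≤ a) ∨ (x = p ∧ c ≤ y ∧ y ≤ w)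

namespace Net

variable {N : Q.Net}

/-- No horizontal path has a free corner. -/
def Reduced (N : Q.Net) : Prop := ∀ α p i c c', ¬ N.FreeCorner α p i c c'

theorem CrossAt.le_width (hQ : Q.Regular) {α : T} {i y : ℤ} (H : N.CrossAt α i y) :
    y ≤ Q.width α := by
  obtain ⟨k, j, rfl, rfl, h⟩ := H
  have := h.bounds
  have := hQ.colOff_add_le_width k
  omega

/-- As the corner is not free, some horizontal path meets row i + 1 before or at the next crossing
column. The first column where this happens belongs to path p + 1 by adjacency, and that path must
enter it from the south by minimality. -/
theorem Reduced.next_corner (hQ : Q.Regular) (hN : N.Reduced) {α : T} {p i c x : ℤ}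
    (H : N.h α p (i + 1) c) (H0 : N.h α p i c) (H1 : N.h α p i (c + 1)) (hx : c < x)
    (hC : N.CrossAt α i x) : ∃ c' y, c < y ∧ y ≤ c' ∧ c' ≤ x ∧
      (∀ z, c < z → z < c' → ¬ N.CrossAt α i z) ∧ N.h α p i y ∧
      N.h α (p + 1) (i + 1) y ∧ N.h α (p + 1) (i + 2) y := by
  obtain ⟨c', ⟨h1, h2⟩, h3⟩ := Int.exists_least_of_bdd (P := fun z => c < z ∧ N.CrossAt α i z)
    ⟨c, fun z hz => hz.1.le⟩ ⟨x, hx, hC⟩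
  have gap : ∀ z, c < z → z < c' → ¬ N.CrossAt α i z := fun z hz hz' h =>
    absurd (h3 z ⟨hz, h⟩) (by omega)
  have row := h_row hQ H0 H1 (h2.le_width hQ) gap
  have hex : ∃ y, c < y ∧ y ≤ c' ∧ ∃ p', N.h α p' (i + 1) y := by
    by_contra hne
    exact hN α p i c c' ⟨h1, H, row, h2, gap, fun p' y h h' h'' => hne ⟨y, h, h', p', h''⟩⟩
  obtain ⟨y, ⟨hy, hy', p', hp'⟩, hmin⟩ := Int.exists_least_of_bdd
    (P := fun y => c < y ∧ y ≤ c' ∧ ∃ p', N.h α p' (i + 1) y) ⟨c, fun z hz => hz.1.le⟩ hex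
  have hne : p ≠ p' := by
    rintro rfl
    exact (path_of_h H).not_lt_lt H0 hp' (by omega) hy
  obtain rfl := h_adjacent hQ (row y hy.le hy') hp' hne
  refine ⟨c', y, hy, hy', h3 x ⟨hx, hC⟩, gap, row y hy.le hy', hp', ?_⟩
  have hb := h_bounds H
  rcases (path_of_h hp').prev hp' with h | h | h
  · omega
  · exfalso
    by_cases hyc : y - 1 = c
    · rw [hyc] at h
      exact hne (N.h_inj H h)
    · have := hmin (y - 1) ⟨by omega, by omega, _, h⟩
      omega
  · rwa [add_assoc] at h

/-- In a reduced net, the north-west corners of the path `p` lie in row `p`. -/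
theorem Reduced.corner_row (hQ : Q.Regular) (hN : N.Reduced) (n : ℕ) :
    ∀ {α : T} {p i c : ℤ}, Q.uT α - p < n → N.h α p (i + 1) c → N.h α p i c →
      N.h α p i (c + 1) → i = p := by
  induction n with
  | zero =>
    intro α p i c hn H
    have := h_bounds H
    push_cast at hn
    omega
  | succ n ih =>
    intro α p i c hn H H0 H1
    push_cast at hn
    have hb := h_bounds H0
    have hb1 := h_bounds H1
    by_cases hex : ∃ x, c < x ∧ N.CrossAt α i x
    · obtain ⟨x, hx, hC⟩ := hex
      obtain ⟨c', y, h1, h2, h3, h4, h5, h6, h7⟩ := hN.next_corner hQ H H0 H1 hx hC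
      -- The point north of (i + 1, y) belongs to path p, so path p + 1 ends here or has a
      -- north-west corner here; both give i + 1 = p + 1.
      rcases (path_of_h h6).next h6 with h | h | h
      · omega
      · have := ih (p := p + 1) (by omega) (by rwa [add_assoc]) h6 h
        omega
      · rw [add_sub_cancel_right] at h
        have := N.h_inj h h5
        omega
    -- With no crossing point further east, the path can neither turn nor climb; it stays in row i
    -- up to its endpoint, whose row is p.
    · push Not at hex
      have Hw := h_row hQ H0 H1 le_rfl (fun y h _ => hex y h) _ hb.2.2.2.2.2 le_rfl
      rcases (path_of_h Hw).next Hw with h | h | h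
      · exact h.1
      · have := h_bounds h
        omega
      · have := (crossAt_of_vertical_edge hQ (i := i - 1) (by rwa [sub_add_cancel]) h).1
        rw [sub_add_cancel] at this
        exact absurd this (hex _ (by omega))

/-- In a reduced net, the horizontal paths are hooks. -/
theorem Reduced.exists_hook (hQ : Q.Regular) (hN : N.Reduced) {α : T} (hα : Q.uT α < Q.mT α)
    {p : ℤ} (hp : 1 ≤ p) (hp' : p ≤ Q.uT α) : ∃ c, ∀ x y, N.h α p x y ↔
      Hook (Q.mT α - Q.uT α + p) p c (Q.width α) x y := by
  have P := N.h_path α p hp hp'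
  obtain ⟨c, h1, h0⟩ := P.exists_vertical_edge (i := p) le_rfl (by omega)
  have hb := h_bounds h0
  have col : ∀ x, p ≤ x → x < Q.mT α - Q.uT α + p → N.h α p x c ∧ N.h α p (x + 1) c := by
    intro x hx
    induction x, hx using Int.leInduction with
    | base => exact fun _ => ⟨h0, h1⟩
    | succ x hx ih =>
      intro hxa
      obtain ⟨i1, i2⟩ := ih (by omega)
      obtain ⟨c', e1, e2⟩ := P.exists_vertical_edge (i := x + 1) (by omega) hxa
      -- Turning east here would be a north-west corner outside row p. So the path goes on to the
      -- north, and two columns for the same vertical step would give a strictly south-east pair on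
      -- it.
      obtain rfl : c = c' := by
        rcases P.next e2 with h | h | h
        · omega
        · have := hN.corner_row hQ (Q.uT α - p + 1).toNat (by omega) e1 e2 h
          omega
        · rw [add_sub_cancel_right] at h
          rcases lt_trichotomy c c' with hc | hc | hc
          · exact (P.not_lt_lt i1 e2 (by omega) hc).elim
          · exact hc
          · exact (P.not_lt_lt h i2 (by omega) hc).elim
      exact ⟨e2, e1⟩
  have west : ∀ x y, N.h α p x y → y < c → x = Q.mT α - Q.uT α + p := by
    intro x y H hy
    have hb' := h_bounds H
    by_contra hx
    exact P.not_lt_lt H (col x (by omega) (by omega)).2 (by omega) hy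
  have east : ∀ x y, N.h α p x y → c < y → x = p := by
    intro x y H hy
    have hb' := h_bounds H
    by_contra hx
    exact P.not_lt_lt (col (x - 1) (by omega) (by omega)).1 H (by omega) hy
  have mid : ∀ x, p ≤ x → x ≤ Q.mT α - Q.uT α + p → N.h α p x c := by
    intro x hx hx'
    rcases hx'.eq_or_lt with rfl | hx'
    · have := (col (Q.mT α - Q.uT α + p - 1) (by omega) (by omega)).2
      rwa [sub_add_cancel] at this
    · exact (col x hx hx').1
  refine ⟨c, fun x y => ⟨fun H => ?_, ?_⟩⟩
  · have hb' := h_bounds H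
    unfold Hook
    rcases lt_trichotomy y c with hy | hy | hy
    · have := west x y H hy
      omega
    · omega
    · have := east x y H hy
      omega
  · rintro (⟨rfl, h2, h3⟩ | ⟨rfl, h2, h3⟩ | ⟨rfl, h2, h3⟩)
    · rcases h3.eq_or_lt with rfl | h3
      · exact mid _ (by omega) le_rfl
      · obtain ⟨x, hx⟩ := P.exists_on_col h2 (by omega)
        exact west x y hx h3 ▸ hx
    · exact mid x h2 h3
    · rcases h2.eq_or_lt with rfl | h2
      · exact mid _ le_rfl (by omega)
      · obtain ⟨z, hz⟩ := P.exists_on_col (j := y) (by omega) h3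
        exact east z y hz h2 ▸ hz

/-- The horizontal path `p` of the target of `k` is a hook whose vertical part lies in column `j` of
page `k`, on the vertical path `q`. -/
structure Attached (N : Q.Net) (k : Fin Q.r) (p q j : ℤ) : Prop where
  one_le : 1 ≤ p
  le_uT : p ≤ Q.uT (Q.tgt k)
  one_le_col : 1 ≤ j
  col_le : j ≤ Q.mS (Q.src k)
  hook : ∀ x y, N.h (Q.tgt k) p x y ↔ Hook (Q.mT (Q.tgt k) - Q.uT (Q.tgt k) + p) p
    (j + Q.colOff k) (Q.width (Q.tgt k)) x y
  vertical : ∀ x, p ≤ x → x ≤ Q.mT (Q.tgt k) - Q.uT (Q.tgt k) + p → N.vp k q x j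

theorem Reduced.exists_attached (hQ : Q.Regular) (hN : N.Reduced) {α : T}
    (hα : Q.uT α < Q.mT α) {p : ℤ} (hp : 1 ≤ p) (hp' : p ≤ Q.uT α) :
    ∃ k q j, Q.tgt k = α ∧ N.Attached k p q j := by
  obtain ⟨c, hc⟩ := hN.exists_hook hQ hα hp hp'
  have mem : ∀ x, p ≤ x → x ≤ Q.mT α - Q.uT α + p → N.h α p x c := fun x h h' =>
    (hc x c).2 (.inr (.inl ⟨rfl, h, h'⟩))
  obtain ⟨k, q, j, rfl, rfl, h1, h2, h3, h4⟩ := exists_vertical_edge_page hQ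
    (mem (p + 1) (by omega) (by omega)) (mem p le_rfl (by omega))
  refine ⟨k, q, j, rfl, ⟨hp, hp', h1, h2, hc, ?_⟩⟩
  intro x hx
  induction x, hx using Int.leInduction with
  | base => exact fun _ => h4
  | succ x hx ih =>
    intro hx'
    obtain ⟨k', q', j', ht, e, h1', h2', h3', h4'⟩ := exists_vertical_edge_page hQ
      (mem (x + 1) (by omega) (by omega)) (mem x hx (by omega))
    obtain ⟨rfl, rfl⟩ := hQ.page_unique ht.symm h1 h2 h1' h2' e
    obtain rfl := N.v_inj (ih (by omega)) h4'
    exact h3'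

theorem v_order (hQ : Q.Regular) {k : Fin Q.r} {q q' i j i' j' : ℤ} (H : N.vp k q i j)
    (H' : N.vp k q' i' j') (hq : q < q') (hi : i' ≤ i) (hj : j' ≤ j) : False :=
  h_order (N := N.transpose) hQ.transpose H H' hq hj (by omega)

/-! ### Which vertical path carries a hook, and in which column -/

namespace Attached

variable {k k' : Fin Q.r} {p q j p' q' j' : ℤ}

theorem mem_col (A : N.Attached k p q j) {x : ℤ} (h : p ≤ x)
    (h' : x ≤ Q.mT (Q.tgt k) - Q.uT (Q.tgt k) + p) : N.hp k p x j :=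
  (A.hook _ _).2 (.inr (.inl ⟨rfl, h, h'⟩))

/-- A later vertical path meets the hook in its final row. -/
theorem exists_meet_of_later (hQ : Q.Regular) (A : N.Attached k p q j)
    (ht : Q.tgt k = Q.tgt k') (hq : 1 ≤ q') (hq' : q' ≤ Q.uS (Q.src k'))
    (hl : Later k q k' q') : ∃ y, N.hp k' p p y ∧ N.vp k' q' p y ∧
      j + Q.colOff k < y + Q.colOff k' := by
  obtain ⟨x, y, hx, hy⟩ := exists_meet (N := N) hQ k' A.one_le (ht ▸ A.le_uT) hq hq'
  have hx' := hx
  unfold hp at hx'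
  rw [← ht, A.hook] at hx'
  have hb := vp_bounds hy
  have hm := hQ.uT_le (Q.tgt k)
  have hlt : j + Q.colOff k < y + Q.colOff k' := by
    rcases hl with hl | ⟨rfl, hl⟩
    · have := hQ.colOff_add_le_colOff hl ht
      have := A.col_le
      omega
    · by_contra hlt
      refine v_order hQ (A.vertical _ (by omega) le_rfl) hy hl ?_ (by omega)
      unfold Hook at hx'
      omega
  obtain rfl : x = p := by
    unfold Hook at hx'
    omega
  exact ⟨y, hx, hy, hlt⟩

/-- Both hooks have a point of their vertical part in row p + 1, because u_α < m_α. The order of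
horizontal paths gives the order of the columns, and then that of the vertical paths. -/
theorem later_succ (hQ : Q.Regular) (hm : Q.uT (Q.tgt k) < Q.mT (Q.tgt k))
    (A : N.Attached k p q j) (A' : N.Attached k' (p + 1) q' j') (ht : Q.tgt k = Q.tgt k') :
    Later k q k' q' := by
  have h1 := A.mem_col (x := p + 1) (by omega) (by omega)
  have h2 := A'.mem_col (x := p + 1) (by omega) (by rw [← ht]; omega)
  have hlt : j + Q.colOff k < j' + Q.colOff k' := by
    by_contra hn
    unfold hp at h2
    rw [← ht] at h2
    exact h_order hQ h1 h2 (by omega) le_rfl (by omega)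
  rcases (hQ.page_le_of_col_le ht A'.col_le A.one_le_col hlt.le).lt_or_eq with hk | rfl
  · exact .inl hk
  refine .inr ⟨rfl, ?_⟩
  have v1 := A.vertical (p + 1) (by omega) (by omega)
  have v2 := A'.vertical (p + 1) (by omega) (by omega)
  rcases lt_trichotomy q q' with hq | rfl | hq
  · exact hq
  · exact ((path_of_vp v1).not_lt_lt (A.vertical p le_rfl (by omega)) v2 (by omega)
      (by omega)).elim
  · exact (v_order hQ v2 v1 hq le_rfl (by omega)).elim

theorem east_mem (A : N.Attached k p q j) {y : ℤ} (h : j + Q.colOff k ≤ y)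
    (h' : y ≤ Q.width (Q.tgt k)) : N.h (Q.tgt k) p p y :=
  (A.hook _ _).2 (.inr (.inr ⟨rfl, h, h'⟩))

theorem next_corner (hQ : Q.Regular) (hN : N.Reduced) (hm : Q.uT (Q.tgt k) < Q.mT (Q.tgt k))
    (A : N.Attached k p q j) {x : ℤ} (hx : j + Q.colOff k < x) (hC : N.CrossAt (Q.tgt k) p x) :
    ∃ c' y, j + Q.colOff k < y ∧ y ≤ c' ∧ c' ≤ x ∧
      (∀ z, j + Q.colOff k < z → z < c' → ¬ N.CrossAt (Q.tgt k) p z) ∧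
      N.h (Q.tgt k) (p + 1) (p + 1) y ∧ N.h (Q.tgt k) (p + 1) (p + 2) y := by
  have hw := hC.le_width hQ
  obtain ⟨c', y, h1, h2, h3, h4, -, h5⟩ := hN.next_corner hQ
    (A.mem_col (x := p + 1) (by omega) (by omega)) (A.mem_col le_rfl (by omega))
    (A.east_mem (by omega) (by omega)) hx hC
  exact ⟨c', y, h1, h2, h3, h4, h5⟩

theorem col_eq (A : N.Attached k p q j) {y : ℤ}
    (H1 : N.h (Q.tgt k) p p y) (H2 : N.h (Q.tgt k) p (p + 1) y) : y = j + Q.colOff k := by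
  rw [A.hook] at H1 H2
  unfold Hook at H1 H2
  omega

/-- The intermediate vertical path crosses the final row of hook p, and the first crossing there
lies at or beyond the column of hook p + 1. As the path precedes q', it must run west along row p
past that column, which produces a crossing point before the first one. -/
theorem not_between (hQ : Q.Regular) (hN : N.Reduced) (hm : Q.uT (Q.tgt k) < Q.mT (Q.tgt k))
    (A : N.Attached k p q j) (A' : N.Attached k' (p + 1) q' j') (ht : Q.tgt k = Q.tgt k')
    {k₁ : Fin Q.r} {q₁ : ℤ} (ht₁ : Q.tgt k = Q.tgt k₁) (hq : 1 ≤ q₁)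
    (hq' : q₁ ≤ Q.uS (Q.src k₁)) (hl : Later k q k₁ q₁) (hl' : Later k₁ q₁ k' q') : False := by
  obtain ⟨y, hy, hv, hlt⟩ := A.exists_meet_of_later hQ ht₁ hq hq' hl
  have hb := hp_bounds hy
  obtain ⟨c', y₀, h1, h2, h3, gap, h4, h5⟩ := A.next_corner hQ hN hm hlt
    ⟨k₁, y, ht₁.symm, rfl, ⟨p, hy⟩, q₁, hv⟩
  have hy₀ : y₀ = j' + Q.colOff k' :=
    A'.col_eq (by rwa [← ht]) (by rw [← ht]; rwa [add_assoc])
  have hvb := vp_bounds hv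
  have hk : k' ≤ k₁ := hQ.page_le_of_col_le (ht.symm.trans ht₁) (j := j') (j' := y) (by omega)
    A'.one_le_col (by omega)
  have hk' : k₁ = k' ∧ q₁ < q' := by
    rcases hl' with h | h
    · exact absurd hk (not_le.2 h)
    · exact h
  obtain ⟨rfl, hqq⟩ := hk'
  have hrow := row_bounds_of_page hQ (k := k₁) (i := p + 1) (by have := A.one_le; omega)
    (by rw [← ht₁]; have := A.le_uT; omega)
  have v' := A'.vertical (p + 1) le_rfl (by have := hQ.uT_le (Q.tgt k₁); omega)
  -- A step to the south would put q₁ weakly to the south-east of the point (p + 1, j') of q',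
  -- contrary to the order of vertical paths. So the path is traced back west through column j'.
  have west : ∀ n : ℕ, ∀ y, j' ≤ y → y - j' ≤ n → N.vp k₁ q₁ p y →
      N.vp k₁ q₁ p j' ∧ N.vp k₁ q₁ p (j' - 1) := by
    intro n
    induction n with
    | zero =>
      intro y hy hn hv
      obtain rfl : y = j' := by push_cast at hn; omega
      rcases (path_of_vp hv).prev hv with h | h | h
      · omega
      · exact ⟨hv, h⟩
      · exact (v_order hQ h v' hqq le_rfl le_rfl).elim
    | succ n ih =>
      intro y hy hn hv
      push_cast at hn
      rcases (path_of_vp hv).prev hv with h | h | h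
      · omega
      · rcases hy.eq_or_lt with rfl | hy
        · exact ⟨hv, h⟩
        · exact ih (y - 1) (by omega) (by omega) h
      · exact (v_order hQ h v' hqq le_rfl hy).elim
  obtain ⟨hw0, hw1⟩ := west (y - j').toNat y (by omega) (by omega) hv
  have hb1 := vp_bounds hw1
  have hlo := A.one_le
  obtain ⟨p₁, -, hp₁⟩ := exists_hp_of_horizontal_edge hQ (k := k₁) (q := q₁) (i := p) (j := j')
    hlo (by have := hQ.uT_le (Q.tgt k₁); omega) hw0 hw1
  have hC : N.CrossAt (Q.tgt k) p (j' - 1 + Q.colOff k₁) :=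
    ⟨k₁, j' - 1, ht₁.symm, rfl, ⟨p₁, hp₁⟩, q₁, hw1⟩
  -- The crossing point found could be the corner of hook p itself; then q₁ = q, which is not later
  -- than q.
  by_cases hj : j + Q.colOff k = j' - 1 + Q.colOff k₁
  · obtain ⟨rfl, rfl⟩ := hQ.page_unique ht A.one_le_col A.col_le (by omega) (by omega) hj
    have := N.v_inj (A.vertical p le_rfl (by omega)) hw1
    rcases hl with h | h
    · exact lt_irrefl _ h
    · omega
  · refine gap _ ?_ (by omega) hC
    omega

theorem number_nonneg (hQ : Q.Regular) (A : N.Attached k p q j) :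
    1 ≤ q ∧ q ≤ Q.uS (Q.src k) ∧ q ≤ j ∧ j ≤ Q.mS (Q.src k) - Q.uS (Q.src k) + q := by
  have hm := hQ.uT_le (Q.tgt k)
  exact vp_bounds (A.vertical p le_rfl (by omega))

/-- The left side counts the vertical paths after q, the right side the horizontal paths after p.
Induction starts from the last horizontal path; consecutive hooks use consecutive vertical paths by
`later_succ` and `not_between`. -/
theorem number_eq (hQ : Q.Regular) (hN : N.Reduced) (n : ℕ) :
    ∀ {k : Fin Q.r} {p q j : ℤ}, Q.uT (Q.tgt k) < Q.mT (Q.tgt k) → N.Attached k p q j →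
      Q.uT (Q.tgt k) - p = n → Q.tail k + Q.uS (Q.src k) - q = n := by
  induction n with
  | zero =>
    intro k p q j hm A hn
    push_cast at hn ⊢
    have hb := A.number_nonneg hQ
    have ht := hQ.tail_nonneg k
    by_contra hne
    have hf := hQ.uT_le_flow (Q.tgt k)
    have hu := hQ.uT_pos (Q.tgt k)
    -- Number 0 is the last vertical path. If it came after q, it would force a horizontal path with
    -- index larger than u_α.
    obtain ⟨k', q', htk, h1, h2, h3⟩ := exists_thread (Q := Q) (α := Q.tgt k) le_rfl (by omega)
    obtain ⟨y, hy, hv, hlt⟩ := A.exists_meet_of_later hQ htk.symm h1 h2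
      (later_of_number_lt hQ htk.symm hb.1 h2 (by omega))
    obtain ⟨c', y₀, -, -, -, -, h4, -⟩ := A.next_corner hQ hN hm hlt
      ⟨k', y, htk, rfl, ⟨p, hy⟩, q', hv⟩
    have := N.h_index h4
    omega
  | succ n ih =>
    intro k p q j hm A hn
    push_cast at hn ⊢
    have hb := A.number_nonneg hQ
    have hlo := A.one_le
    have hf := hQ.uT_le_flow (Q.tgt k)
    obtain ⟨k', q', j', htk, A'⟩ := hN.exists_attached hQ hm (p := p + 1) (by omega) (by omega)
    have hb' := A'.number_nonneg hQ
    have e := ih (by rwa [htk]) A' (by rw [htk]; omega)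
    have hl := (A.later_succ hQ hm A' htk.symm).number_lt hQ htk.symm hb.2.1 hb'.1
    by_contra hne
    obtain ⟨k₁, q₁, ht₁, h1, h2, h3⟩ := exists_thread (Q := Q) (α := Q.tgt k) (n := n + 1) (by omega)
      (by omega)
    exact A.not_between hQ hN hm A' htk.symm ht₁.symm h1 h2
      (later_of_number_lt hQ ht₁.symm hb.1 h2 (by omega))
      (later_of_number_lt hQ (ht₁.trans htk.symm) h1 hb'.2.1 (by omega))

theorem number_eq' (hQ : Q.Regular) (hN : N.Reduced) (hm : Q.uT (Q.tgt k) < Q.mT (Q.tgt k))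
    (A : N.Attached k p q j) : Q.tail k + Q.uS (Q.src k) - q = Q.uT (Q.tgt k) - p := by
  have := A.le_uT
  have := number_eq hQ hN (Q.uT (Q.tgt k) - p).toNat hm A (by omega)
  omega

/-- If the next crossing point is adjacent to the corner of the hook, then the next hook has its
corner diagonally adjacent to the corner of the hook. -/
theorem succ_of_cross (hQ : Q.Regular) (hN : N.Reduced) (hm : Q.uT (Q.tgt k) < Q.mT (Q.tgt k))
    (A : N.Attached k p q j) (hC : N.Cross k p (j + 1)) : p < Q.uT (Q.tgt k) ∧
      ∃ q', N.Attached k (p + 1) q' (j + 1) := by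
  have hC' : N.CrossAt (Q.tgt k) p (j + 1 + Q.colOff k) := ⟨k, j + 1, rfl, rfl, hC⟩
  obtain ⟨c', y, h1, h2, h3, -, h4, h5⟩ := A.next_corner hQ hN hm (by omega) hC'
  have hi := N.h_index h4
  obtain ⟨k', q', j', htk, A'⟩ := hN.exists_attached hQ hm hi.1 hi.2
  have hy : y = j' + Q.colOff k' :=
    A'.col_eq (by rwa [htk]) (by rw [htk]; rwa [add_assoc])
  have hb := hC.bounds
  obtain ⟨rfl, rfl⟩ := hQ.page_unique htk A'.one_le_col A'.col_le (j' := j + 1) (by omega)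
    (by omega) (by omega)
  exact ⟨by omega, q', A'⟩

/-- The vertical part of one hook makes (p + 1, q) a crossing point, and the horizontal part of the
other does so for (p, q + 1). By `succ_of_cross` and its transpose the same configuration recurs at
(p + 1, q + 1), which cannot go on beyond u_α. -/
theorem not_both (hQ : Q.Regular) (hN : N.Reduced) (hN' : N.transpose.Reduced)
    (hm : Q.uT (Q.tgt k) < Q.mT (Q.tgt k)) (hm' : Q.uS (Q.src k) < Q.mS (Q.src k)) (n : ℕ) :
    ∀ {p q p' q' : ℤ}, Q.uT (Q.tgt k) - p < n → N.Attached k p q' q →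
      N.transpose.Attached k q p' p → False := by
  induction n with
  | zero =>
    intro p q p' q' hn A
    have := A.le_uT
    push_cast at hn
    omega
  | succ n ih =>
    intro p q p' q' hn A B
    push_cast at hn
    have a1 := A.one_le
    have a2 := A.le_uT
    have b1 := B.one_le
    have b2 : q ≤ Q.uS (Q.src k) := B.le_uT
    have c1 : N.Cross k p (q + 1) := by
      refine ⟨⟨p', B.vertical (q + 1) (by omega) ?_⟩, q, B.mem_col (x := q + 1) (by omega) ?_⟩ <;>
      · change q + 1 ≤ Q.mS (Q.src k) - Q.uS (Q.src k) + q
        omega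
    have c2 : N.transpose.Cross k q (p + 1) :=
      ⟨⟨q', A.vertical (p + 1) (by omega) (by omega)⟩, p,
        A.mem_col (x := p + 1) (by omega) (by omega)⟩
    obtain ⟨-, q₂, A₂⟩ := A.succ_of_cross hQ hN hm c1
    obtain ⟨-, p₂, B₂⟩ := B.succ_of_cross hQ.transpose hN' hm' c2
    exact ih (by omega) A₂ B₂

/-- In a net without free corners, the vertical parts of the hooks lie in the first columns of the
vertical paths. -/
theorem col_eq_of_reduced (hQ : Q.Regular) (hN : N.Reduced) (hN' : N.transpose.Reduced)
    (hm : Q.uT (Q.tgt k) < Q.mT (Q.tgt k)) (A : N.Attached k p q j) :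
    j = Q.mS (Q.src k) - Q.uS (Q.src k) + q := by
  have hb := A.number_nonneg hQ
  by_contra hne
  have hm' : Q.uS (Q.src k) < Q.mS (Q.src k) := by omega
  obtain ⟨k', s, i, hs, B⟩ := Reduced.exists_attached (N := N.transpose) hQ.transpose hN' hm'
    hb.1 hb.2.1
  have v1 := A.vertical p le_rfl (by omega)
  have v2 := A.vertical (p + 1) (by omega) (by omega)
  have e1 := (B.hook j (p + Q.rowOff k)).1 (by rw [hs]; exact v1)
  have e2 := (B.hook j (p + 1 + Q.rowOff k)).1 (by rw [hs]; exact v2)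
  have hs' : Q.src k' = Q.src k := hs
  -- The transposed hook contains two consecutive rows of a column only in its first column, which
  -- is excluded here, or in its last column q, where it has already turned.
  have hjq : j = q ∧ i + Q.rowOff k' ≤ p + Q.rowOff k := by
    unfold Hook at e1 e2
    simp only [hs'] at e1 e2
    have e0 : Q.transpose.colOff k' = Q.rowOff k' := rfl
    omega
  obtain ⟨rfl, hr⟩ := hjq
  have nA := A.number_eq' hQ hN hm
  have nB := B.number_eq' hQ.transpose hN' (by simp only [hs']; exact hm')
  simp only [hs'] at nB
  have hk : k' ≤ k := hQ.transpose.page_le_of_col_le hs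
    (show p ≤ Q.mT (Q.tgt k) by have := A.le_uT; omega) B.one_le_col hr
  have hB := B.number_nonneg hQ.transpose
  have tA := hQ.tail_nonneg k
  have tB := hQ.transpose.tail_nonneg k
  have hlo := A.one_le
  -- Turning on an earlier page would leave at least u_α horizontal paths after the turning one,
  -- more than the count uS - q ≤ uT - p permits. On the same page the two counts force i = p, the
  -- situation of `not_both`.
  rcases hk.lt_or_eq with hk | rfl
  · have := hQ.transpose.tail_add_le_tail hk hs
    simp only at this hB
    omega
  · simp only at hB
    obtain rfl : i = p := by omega
    exact not_both hQ hN hN' hm hm' (Q.uT (Q.tgt k') - i + 1).toNat (by omega) A B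

end Attached
end Net
end PageShape

/-! ### The extremal net -/

namespace PageShape

variable {S T : Type*} [DecidableEq S] [DecidableEq T] {Q : PageShape S T}

theorem latticePath_hook {a p c w : ℤ} (hp : p ≤ a) (h1 : 1 ≤ c) (hw : c ≤ w) :
    LatticePath (Hook a p c w) a 1 p w := by
  constructor <;> unfold Hook <;> intros <;> omega

variable (Q) in
/-- The vertical path `q` on page `k` is the one to which the horizontal path `p` of `α` is attached
in the extremal net. -/
structure IsThread (α : T) (p : ℤ) (k : Fin Q.r) (q : ℤ) : Prop where
  tgt_eq : Q.tgt k = α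
  one_le : 1 ≤ q
  le_uS : q ≤ Q.uS (Q.src k)
  number : Q.tail k + Q.uS (Q.src k) - q = Q.uT α - p

variable (Q) in
/-- The column of the vertical part of the horizontal path `p` of `α` in the extremal net. -/
def IsHookCol (α : T) (p c : ℤ) : Prop :=
  ∃ k q, Q.IsThread α p k q ∧ c = Q.mS (Q.src k) - Q.uS (Q.src k) + q + Q.colOff k

variable (Q) in
/-- The horizontal path `p` of `α` in the extremal net. -/
def hookPath (α : T) (p x y : ℤ) : Prop :=
  1 ≤ p ∧ p ≤ Q.uT α ∧
    ∃ c, Q.IsHookCol α p c ∧ Hook (Q.mT α - Q.uT α + p) p c (Q.width α) x y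

/-- Here u_α ≤ v_α enters: there are enough vertical paths to carry all hooks. -/
theorem exists_isHookCol (hQ : Q.Regular) {α : T} {p : ℤ} (hp : 1 ≤ p) (hp' : p ≤ Q.uT α) :
    ∃ c, Q.IsHookCol α p c := by
  have := hQ.uT_le_flow α
  obtain ⟨k, q, h1, h2, h3, h4⟩ := exists_thread (Q := Q) (α := α) (n := Q.uT α - p) (by omega)
    (by omega)
  exact ⟨_, k, q, ⟨h1, h2, h3, h4.symm⟩, rfl⟩

theorem Later.col_lt (hQ : Q.Regular) {k k' : Fin Q.r} {q q' : ℤ} (ht : Q.tgt k = Q.tgt k')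
    (hq : q ≤ Q.uS (Q.src k)) (hq' : 1 ≤ q') (h : Later k q k' q') :
    Q.mS (Q.src k) - Q.uS (Q.src k) + q + Q.colOff k <
      Q.mS (Q.src k') - Q.uS (Q.src k') + q' + Q.colOff k' := by
  rcases h with h | ⟨rfl, h⟩
  · have := hQ.colOff_add_le_colOff h ht
    have := hQ.uS_le (Q.src k')
    omega
  · omega

theorem IsHookCol.lt (hQ : Q.Regular) {α : T} {p p' c c' : ℤ} (h : Q.IsHookCol α p c)
    (h' : Q.IsHookCol α p' c') (hp : p < p') : c < c' := by
  obtain ⟨k, q, K, rfl⟩ := h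
  obtain ⟨k', q', K', rfl⟩ := h'
  have ht := K.tgt_eq.trans K'.tgt_eq.symm
  have := K.number
  have := K'.number
  exact (later_of_number_lt hQ ht K.one_le K'.le_uS (by omega)).col_lt hQ ht K.le_uS K'.one_le

theorem IsHookCol.unique (hQ : Q.Regular) {α : T} {p c c' : ℤ} (h : Q.IsHookCol α p c)
    (h' : Q.IsHookCol α p c') : c = c' := by
  obtain ⟨k, q, K, rfl⟩ := h
  obtain ⟨k', q', K', rfl⟩ := h'
  have ht := K.tgt_eq.trans K'.tgt_eq.symm
  have e := K.number
  have e' := K'.number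
  rcases lt_trichotomy k k' with hk | rfl | hk
  · have := Later.number_lt hQ ht K.le_uS K'.one_le (.inl hk)
    omega
  · omega
  · have := Later.number_lt hQ ht.symm K'.le_uS K.one_le (.inl hk)
    omega

theorem IsHookCol.bounds (hQ : Q.Regular) {α : T} {p c : ℤ} (h : Q.IsHookCol α p c) :
    1 ≤ c ∧ c ≤ Q.width α := by
  obtain ⟨k, q, K, rfl⟩ := h
  have := hQ.colOff_nonneg k
  have := hQ.colOff_add_le_width k
  rw [K.tgt_eq] at this
  have := hQ.uS_le (Q.src k)
  have := K.one_le
  have := K.le_uS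
  omega

theorem hookPath_iff (hQ : Q.Regular) {α : T} {p c x y : ℤ} (hp : 1 ≤ p) (hp' : p ≤ Q.uT α)
    (hc : Q.IsHookCol α p c) : Q.hookPath α p x y ↔
      Hook (Q.mT α - Q.uT α + p) p c (Q.width α) x y := by
  constructor
  · rintro ⟨-, -, c', h, H⟩
    rwa [hc.unique hQ h]
  · exact fun H => ⟨hp, hp', c, hc, H⟩

theorem latticePath_hookPath (hQ : Q.Regular) {α : T} {p : ℤ} (hp : 1 ≤ p) (hp' : p ≤ Q.uT α) :
    LatticePath (Q.hookPath α p) (Q.mT α - Q.uT α + p) 1 p (Q.width α) := by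
  obtain ⟨c, hc⟩ := exists_isHookCol hQ hp hp'
  have hb := hc.bounds hQ
  have := hQ.uT_le α
  exact (latticePath_hook (by omega) hb.1 hb.2).congr fun x y => (hookPath_iff hQ hp hp' hc).symm

theorem hookPath_inj (hQ : Q.Regular) {α : T} {p p' x y : ℤ} (H : Q.hookPath α p x y)
    (H' : Q.hookPath α p' x y) : p = p' := by
  have key : ∀ {p p' : ℤ}, p < p' → Q.hookPath α p x y → Q.hookPath α p' x y → False := by
    rintro p p' hp ⟨h1, h2, c, hc, H⟩ ⟨h1', h2', c', hc', H'⟩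
    have := hc.lt hQ hc' hp
    have := hQ.uT_le α
    unfold Hook at H H'
    omega
  rcases lt_trichotomy p p' with h | h | h
  exacts [(key h H H').elim, h, (key h H' H).elim]

/-- The vertical path to which a hook is attached does not turn before it has passed the hook. -/
theorem IsThread.row_le (hQ : Q.Regular) {k : Fin Q.r} {p q r : ℤ} (hp : 1 ≤ p)
    (K : Q.IsThread (Q.tgt k) p k q) (hr : Q.transpose.IsHookCol (Q.src k) q r) :
    Q.mT (Q.tgt k) - Q.uT (Q.tgt k) + p + Q.rowOff k ≤ r := by
  obtain ⟨k', s, K', rfl⟩ := hr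
  have hs : Q.src k' = Q.src k := K'.tgt_eq
  have e := K.number
  have e' := K'.number
  have l := K.le_uS
  have l1 := K'.one_le
  have l' := K'.le_uS
  have t := hQ.tail_nonneg k
  have t' := hQ.transpose.tail_nonneg k'
  have t'' := hQ.transpose.tail_nonneg k
  simp only at e' l' t' ⊢
  -- If the vertical path turns on a later page, it does so below page k. On the same page the two
  -- numbers compare the rows. An earlier page contradicts the numbers, since uS - q ≤ uT - p < uT.
  rcases lt_trichotomy k k' with h | rfl | h
  · have h1 := hQ.transpose.colOff_add_le_colOff h hs.symm
    simp only at h1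
    have h2 := hQ.uT_le (Q.tgt k')
    have e0 : Q.transpose.colOff k = Q.rowOff k := rfl
    omega
  · have e0 : Q.transpose.colOff k = Q.rowOff k := rfl
    omega
  · have h1 := hQ.transpose.tail_add_le_tail h hs
    simp only at h1
    omega

theorem IsThread.hookPath_transpose (hQ : Q.Regular) {k : Fin Q.r} {p q x : ℤ} (hp : 1 ≤ p)
    (K : Q.IsThread (Q.tgt k) p k q) (hx : p ≤ x)
    (hx' : x ≤ Q.mT (Q.tgt k) - Q.uT (Q.tgt k) + p) :
    Q.transpose.hookPath (Q.src k) q (Q.mS (Q.src k) - Q.uS (Q.src k) + q) (x + Q.rowOff k) := by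
  obtain ⟨r, hr⟩ := exists_isHookCol hQ.transpose (α := Q.src k) K.one_le K.le_uS
  have h1 := K.row_le hQ hp hr
  have h2 : 0 ≤ Q.rowOff k := hQ.transpose.colOff_nonneg k
  exact ⟨K.one_le, K.le_uS, r, hr, .inl ⟨rfl, by omega, by omega⟩⟩

theorem hookPath_corner (hQ : Q.Regular) {k : Fin Q.r} {p i j : ℤ} (h1 : 1 ≤ j)
    (h2 : j ≤ Q.mS (Q.src k)) (H : Q.hookPath (Q.tgt k) p i (j + Q.colOff k))
    (H1 : Q.hookPath (Q.tgt k) p i (j + 1 + Q.colOff k) ∨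
      Q.hookPath (Q.tgt k) p i (j - 1 + Q.colOff k))
    (H2 : Q.hookPath (Q.tgt k) p (i + 1) (j + Q.colOff k) ∨
      Q.hookPath (Q.tgt k) p (i - 1) (j + Q.colOff k)) :
    ∃ q, Q.transpose.hookPath (Q.src k) q j (i + Q.rowOff k) := by
  obtain ⟨hp, hp', c, hc, -⟩ := id H
  rw [hookPath_iff hQ hp hp' hc] at H
  rw [hookPath_iff hQ hp hp' hc, hookPath_iff hQ hp hp' hc] at H1 H2
  have hm := hQ.uT_le (Q.tgt k)
  have key : j + Q.colOff k = c ∧ p ≤ i ∧ i ≤ Q.mT (Q.tgt k) - Q.uT (Q.tgt k) + p := by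
    unfold Hook at H H1 H2
    omega
  obtain ⟨k', q, K, rfl⟩ := hc
  have l1 := K.one_le
  have l2 := K.le_uS
  have l3 := hQ.uS_le (Q.src k')
  obtain ⟨rfl, rfl⟩ := hQ.page_unique K.tgt_eq.symm h1 h2 (by omega) (by omega) key.1
  exact ⟨q, K.hookPath_transpose hQ hp key.2.1 key.2.2⟩

/-- The net that will turn out to be the only one without free corners. -/
def extremalNet (hQ : Q.Regular) : Q.Net where
  h := Q.hookPath
  v β q i j := Q.transpose.hookPath β q j i
  h_path _ _ h1 h2 := latticePath_hookPath hQ h1 h2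
  v_path _ _ h1 h2 := (latticePath_hookPath hQ.transpose h1 h2).transpose
  h_index H := ⟨H.1, H.2.1⟩
  v_index H := ⟨H.1, H.2.1⟩
  h_inj := hookPath_inj hQ
  v_inj := hookPath_inj hQ.transpose
  h_corner := hookPath_corner hQ
  v_corner {k} := hookPath_corner hQ.transpose (k := k)

/-- This is the uniqueness of the net without free corners: number and column of each hook are
determined. -/
theorem Net.h_iff_hookPath (hQ : Q.Regular) {N : Q.Net} (hN : N.Reduced)
    (hN' : N.transpose.Reduced) {α : T} {p x y : ℤ} : N.h α p x y ↔ Q.hookPath α p x y := by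
  by_cases hp : 1 ≤ p ∧ p ≤ Q.uT α
  swap
  · exact ⟨fun H => absurd (N.h_index H) hp, fun H => absurd ⟨H.1, H.2.1⟩ hp⟩
  rcases (hQ.uT_le α).lt_or_eq with hm | hm
  · obtain ⟨k, q, j, rfl, A⟩ := hN.exists_attached hQ hm hp.1 hp.2
    have hj := A.col_eq_of_reduced hQ hN hN' hm
    have hb := A.number_nonneg hQ
    rw [A.hook, hookPath_iff hQ hp.1 hp.2
      ⟨k, q, ⟨rfl, hb.1, hb.2.1, A.number_eq' hQ hN hm⟩, rfl⟩, hj]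
  -- If u_α = m_α, path p is confined to row p, and the hook degenerates to that row whatever its
  -- column c.
  · obtain ⟨c, hc⟩ := exists_isHookCol hQ hp.1 hp.2
    have hb := hc.bounds hQ
    rw [hookPath_iff hQ hp.1 hp.2 hc]
    constructor
    · intro H
      have := h_bounds H
      unfold Hook
      omega
    · intro H
      have : x = p ∧ 1 ≤ y ∧ y ≤ Q.width α := by
        unfold Hook at H
        omega
      obtain ⟨z, hz⟩ := (N.h_path α p hp.1 hp.2).exists_on_col this.2.1 this.2.2
      have hzb := h_bounds hz
      obtain rfl : z = x := by omega
      exact hz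

theorem Net.cross_iff_of_reduced (hQ : Q.Regular) {N : Q.Net} (hN : N.Reduced)
    (hN' : N.transpose.Reduced) {k : Fin Q.r} {i j : ℤ} :
    N.Cross k i j ↔ (extremalNet hQ).Cross k i j := by
  have h1 : ∀ p, N.hp k p i j ↔ (extremalNet hQ).hp k p i j := fun p =>
    Net.h_iff_hookPath hQ hN hN'
  have h2 : ∀ q, N.vp k q i j ↔ (extremalNet hQ).vp k q i j := fun q =>
    Net.h_iff_hookPath (N := N.transpose) hQ.transpose hN' hN
  unfold Net.Cross
  simp only [h1, h2]

/-! ### The explicit region and the crossing points of the extremal net -/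

variable (Q) in
/-- The condition of the initial region that comes from the target of a page. -/
def RegionT (k : Fin Q.r) (i j : ℤ) : Prop :=
  Q.mT (Q.tgt k) - Q.uT (Q.tgt k) < i ∨
    Q.mS (Q.src k) - max (Q.uT (Q.tgt k) - Q.tail k) 0 < j

/-- The whole column of a hook is covered: above row p by final rows of hooks with smaller index,
whose columns are further west, and below its lower end by initial rows of hooks with larger index.
-/
theorem hookPath_of_isHookCol (hQ : Q.Regular) {α : T} {p c x : ℤ} (hp : 1 ≤ p)
    (hp' : p ≤ Q.uT α) (hc : Q.IsHookCol α p c) (hx : 1 ≤ x) (hx' : x ≤ Q.mT α) :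
    ∃ p', Q.hookPath α p' x c := by
  have hb := hc.bounds hQ
  have hm := hQ.uT_le α
  by_cases h1 : x < p
  · obtain ⟨c', hc'⟩ := exists_isHookCol hQ hx (by omega : x ≤ Q.uT α)
    have := hc'.lt hQ hc h1
    exact ⟨x, hx, by omega, c', hc', .inr (.inr ⟨rfl, by omega, by omega⟩)⟩
  by_cases h2 : x ≤ Q.mT α - Q.uT α + p
  · exact ⟨p, hp, hp', c, hc, .inr (.inl ⟨rfl, by omega, h2⟩)⟩
  · obtain ⟨c', hc'⟩ := exists_isHookCol hQ (by omega : 1 ≤ x - (Q.mT α - Q.uT α))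
      (by omega : x - (Q.mT α - Q.uT α) ≤ Q.uT α)
    have := hc.lt hQ hc' (by omega)
    exact ⟨_, by omega, by omega, c', hc', .inl ⟨by omega, by omega, by omega⟩⟩

/-- If a hook stands in column j, that column is covered. In all other cases the two region
conditions put i among the bottom u_α rows, and the hook starting in row i turns north no earlier
than column j. -/
theorem exists_hookPath_of_region (hQ : Q.Regular) {k : Fin Q.r} {i j : ℤ} (hi : 1 ≤ i)
    (hi' : i ≤ Q.mT (Q.tgt k)) (hj : 1 ≤ j) (hj' : j ≤ Q.mS (Q.src k)) (h : Q.RegionT k i j)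
    (h' : Q.transpose.RegionT k j i) : ∃ p, Q.hookPath (Q.tgt k) p i (j + Q.colOff k) := by
  unfold RegionT at h h'
  simp only at h'
  have hu := hQ.uS_le (Q.src k)
  have ho := hQ.colOff_nonneg k
  have t := hQ.tail_nonneg k
  have t' := hQ.transpose.tail_nonneg k
  have row : ∀ p c, 1 ≤ p → p ≤ Q.uT (Q.tgt k) → Q.IsHookCol (Q.tgt k) p c →
      i = Q.mT (Q.tgt k) - Q.uT (Q.tgt k) + p → j + Q.colOff k ≤ c →
      ∃ p, Q.hookPath (Q.tgt k) p i (j + Q.colOff k) := fun p c h1 h2 hc e hjc =>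
    ⟨p, h1, h2, c, hc, .inl ⟨e, by omega, hjc⟩⟩
  by_cases hjs : Q.mS (Q.src k) - Q.uS (Q.src k) < j
  · by_cases hn : Q.tail k + Q.mS (Q.src k) - j < Q.uT (Q.tgt k)
    -- Column j is the first column of the vertical path q = j - (mS - uS), and tail + mS - j is the
    -- number of vertical paths after it.
    · refine hookPath_of_isHookCol hQ (p := Q.uT (Q.tgt k) - (Q.tail k + Q.mS (Q.src k) - j))
        (by omega) (by omega) ⟨k, j - (Q.mS (Q.src k) - Q.uS (Q.src k)), ⟨rfl, ?_, ?_, ?_⟩, ?_⟩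
        hi hi' <;> omega
    · have hi2 : Q.mT (Q.tgt k) - Q.uT (Q.tgt k) < i := by omega
      obtain ⟨c, hc⟩ := exists_isHookCol hQ (by omega : 1 ≤ i - (Q.mT (Q.tgt k) - Q.uT (Q.tgt k)))
        (by omega : i - (Q.mT (Q.tgt k) - Q.uT (Q.tgt k)) ≤ Q.uT (Q.tgt k))
      refine row _ c (by omega) (by omega) hc (by omega) ?_
      obtain ⟨k', q', K, rfl⟩ := hc
      have e := K.number
      have hl := later_of_number_lt hQ (q := j - (Q.mS (Q.src k) - Q.uS (Q.src k)))
        K.tgt_eq.symm (by omega) K.le_uS (by omega)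
      have := hl.col_lt hQ K.tgt_eq.symm (by omega) K.one_le
      omega
  · have hi2 : Q.mT (Q.tgt k) - Q.uT (Q.tgt k) < i := by omega
    obtain ⟨c, hc⟩ := exists_isHookCol hQ (by omega : 1 ≤ i - (Q.mT (Q.tgt k) - Q.uT (Q.tgt k)))
      (by omega : i - (Q.mT (Q.tgt k) - Q.uT (Q.tgt k)) ≤ Q.uT (Q.tgt k))
    refine row _ c (by omega) (by omega) hc (by omega) ?_
    obtain ⟨k', q', K, rfl⟩ := hc
    have e := K.number
    have l1 := K.one_le
    have l2 := K.le_uS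
    rcases lt_trichotomy k k' with h | rfl | h
    · have := hQ.colOff_add_le_colOff h K.tgt_eq.symm
      have := hQ.uS_le (Q.src k')
      omega
    · omega
    · have := hQ.tail_add_le_tail h K.tgt_eq
      omega

theorem extremalNet_cross_of_region (hQ : Q.Regular) {k : Fin Q.r} {i j : ℤ} (hi : 1 ≤ i)
    (hi' : i ≤ Q.mT (Q.tgt k)) (hj : 1 ≤ j) (hj' : j ≤ Q.mS (Q.src k)) (h : Q.RegionT k i j)
    (h' : Q.transpose.RegionT k j i) : (extremalNet hQ).Cross k i j :=
  ⟨exists_hookPath_of_region hQ hi hi' hj hj' h h',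
    exists_hookPath_of_region hQ.transpose (k := k) hj hj' hi hi' h' h⟩

/-- The hypothesis on `uS` says that the first hook is not on a page before k. On page k itself its
column is the first of the rightmost uT - tail columns. -/
theorem lt_isHookCol_one (hQ : Q.Regular) {k : Fin Q.r} {i j c : ℤ} (hj : j ≤ Q.mS (Q.src k))
    (h : ¬ Q.RegionT k i j) (hu : Q.uT (Q.tgt k) - Q.tail k ≤ Q.uS (Q.src k))
    (hc : Q.IsHookCol (Q.tgt k) 1 c) : j + Q.colOff k < c := by
  unfold RegionT at h
  obtain ⟨k', q', K, rfl⟩ := hc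
  have e := K.number
  have l1 := K.one_le
  have l2 := K.le_uS
  rcases lt_trichotomy k k' with h | rfl | h
  · have := hQ.colOff_add_le_colOff h K.tgt_eq.symm
    have := hQ.uS_le (Q.src k')
    omega
  · omega
  · have := hQ.tail_add_le_tail h K.tgt_eq
    omega

variable (Q) in
/-- The points `(m_α - u_α + p, c_p)` lie strictly to the south-east of the point `(i, j)` of
page `k`. -/
def ChainSE (k : Fin Q.r) (i j : ℤ) : Prop :=
  i ≤ Q.mT (Q.tgt k) - Q.uT (Q.tgt k) ∧ ∀ c, Q.IsHookCol (Q.tgt k) 1 c → j + Q.colOff k < c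

/-- If the target condition fails but uT - tail > uS, then j is left of the rightmost uS columns and
i is above the bottom uT rows. As uS < uT, the source condition fails too, and there the analogous
inequality holds. -/
theorem chainSE_of_not_region (hQ : Q.Regular) {k : Fin Q.r} {i j : ℤ}
    (hi' : i ≤ Q.mT (Q.tgt k)) (hj' : j ≤ Q.mS (Q.src k))
    (h : ¬ (Q.RegionT k i j ∧ Q.transpose.RegionT k j i)) :
    Q.ChainSE k i j ∨ Q.transpose.ChainSE k j i := by
  have t := hQ.tail_nonneg k
  have t' := hQ.transpose.tail_nonneg k
  by_cases h1 : ¬ Q.RegionT k i j ∧ Q.uT (Q.tgt k) - Q.tail k ≤ Q.uS (Q.src k)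
  · left
    refine ⟨?_, fun c => lt_isHookCol_one hQ hj' h1.1 h1.2⟩
    have := h1.1
    unfold RegionT at this
    omega
  by_cases h2 : ¬ Q.transpose.RegionT k j i ∧
      Q.uS (Q.src k) - Q.transpose.tail k ≤ Q.uT (Q.tgt k)
  · right
    refine ⟨?_, fun c => lt_isHookCol_one hQ.transpose hi' h2.1 h2.2⟩
    have := h2.1
    unfold RegionT at this
    simp only at this ⊢
    omega
  · exfalso
    unfold RegionT at h h1 h2
    simp only at h h1 h2
    omega

/-- The lower ends of the hooks: u_α crossing points forming the diagonal chain that blocks the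
greedy algorithm. -/
theorem cross_of_isThread (hQ : Q.Regular) {k : Fin Q.r} {p q : ℤ} (hp : 1 ≤ p)
    (hp' : p ≤ Q.uT (Q.tgt k)) (K : Q.IsThread (Q.tgt k) p k q) :
    (extremalNet hQ).Cross k (Q.mT (Q.tgt k) - Q.uT (Q.tgt k) + p)
      (Q.mS (Q.src k) - Q.uS (Q.src k) + q) := by
  have hm := hQ.uT_le (Q.tgt k)
  exact ⟨⟨p, hp, hp', _, ⟨k, q, K, rfl⟩, .inr (.inl ⟨rfl, by omega, le_rfl⟩)⟩, q,
    K.hookPath_transpose hQ hp (by omega) le_rfl⟩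

end PageShape

/-! ### Lists of vertices and lattice paths -/

namespace LatticePath

variable {M : ℤ → ℤ → Prop} {i₀ j₀ i₁ j₁ : ℤ}

theorem single (i j : ℤ) : LatticePath (fun x y => x = i ∧ y = j) i j i j := by
  constructor <;> intros <;> omega

theorem cons (h : LatticePath M i₀ j₀ i₁ j₁) {i j : ℤ}
    (hs : (i₀ = i ∧ j₀ = j + 1) ∨ (i₀ = i - 1 ∧ j₀ = j)) :
    LatticePath (fun x y => (x = i ∧ y = j) ∨ M x y) i j i₁ j₁ where
  start := .inl ⟨rfl, rfl⟩
  fin := .inr h.fin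
  next := by
    rintro x y (⟨rfl, rfl⟩ | H)
    · have := h.start
      rcases hs with ⟨rfl, rfl⟩ | ⟨rfl, rfl⟩ <;> tauto
    · have := h.next H
      tauto
  prev := by
    rintro x y (H | H)
    · exact .inl H
    · rcases h.prev H with ⟨rfl, rfl⟩ | H' | H'
      · right
        rcases hs with ⟨e, e'⟩ | ⟨e, e'⟩
        · exact .inl (.inl (by omega))
        · exact .inr (.inl (by omega))
      · tauto
      · tauto
  diag := by
    rintro x y x' y' (H | H) (H' | H') e
    · omega
    · have := h.lower H'
      omega
    · have := h.lower H
      omega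
    · exact h.diag H H' e
  lower := by
    rintro x y (H | H)
    · omega
    · have := h.lower H
      omega
  upper := by
    rintro x y (H | H)
    · have := h.upper h.start
      omega
    · exact h.upper H

/-- Remove the first vertex of a path. -/
theorem tail (h : LatticePath M i₀ j₀ i₁ j₁) {i j : ℤ} (H : M i j)
    (hs : j - i = j₀ - i₀ + 1) :
    LatticePath (fun x y => M x y ∧ j₀ - i₀ < y - x) i j i₁ j₁ where
  start := ⟨H, by omega⟩
  fin := ⟨h.fin, by have := h.upper H; omega⟩
  next := by
    rintro x y ⟨H, e⟩
    rcases h.next H with H' | H' | H'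
    · exact .inl H'
    · exact .inr (.inl ⟨H', by omega⟩)
    · exact .inr (.inr ⟨H', by omega⟩)
  prev := by
    rintro x y ⟨H', e⟩
    by_cases hxy : y - x = j - i
    · have := h.diag H' H hxy
      exact .inl (by omega)
    · rcases h.prev H' with H' | H' | H'
      · omega
      · exact .inr (.inl ⟨H', by omega⟩)
      · exact .inr (.inr ⟨H', by omega⟩)
  diag H H' e := h.diag H.1 H'.1 e
  lower H := by have := H.2; omega
  upper H := h.upper H.1

end LatticePath

theorem IsSWNEPath.latticePath {l : List (ℤ × ℤ)} {P Q : ℤ × ℤ} (h : IsSWNEPath l P Q) :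
    LatticePath (fun i j => (i, j) ∈ l) P.1 P.2 Q.1 Q.2 := by
  induction l generalizing P with
  | nil => exact absurd h.1 (by simp)
  | cons X l ih =>
    obtain ⟨h1, h2, h3⟩ := h
    obtain rfl : X = P := by simpa using h1
    cases l with
    | nil =>
      obtain rfl : X = Q := by simpa using h2
      refine (LatticePath.single X.1 X.2).congr fun x y => ?_
      simp [Prod.ext_iff]
    | cons Y l =>
      rw [List.isChain_cons_cons] at h3
      have := ih (P := Y) ⟨rfl, by simpa using h2, h3.2⟩
      refine (this.cons (i := X.1) (j := X.2) ?_).congr fun x y => ?_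
      · rcases h3.1 with rfl | rfl
        · exact .inl ⟨by simp, by simp⟩
        · exact .inr ⟨by simp [sub_eq_add_neg], by simp⟩
      · rw [List.mem_cons (a := (x, y)) (b := X), Prod.ext_iff]

theorem LatticePath.exists_list {M : ℤ → ℤ → Prop} {i₀ j₀ i₁ j₁ : ℤ}
    (h : LatticePath M i₀ j₀ i₁ j₁) :
    ∃ l, IsSWNEPath l (i₀, j₀) (i₁, j₁) ∧ ∀ i j, (i, j) ∈ l ↔ M i j := by
  have key : ∀ (n : ℕ) (M : ℤ → ℤ → Prop) (i₀ j₀ : ℤ), LatticePath M i₀ j₀ i₁ j₁ →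
      j₁ - i₁ - (j₀ - i₀) = n →
      ∃ l, IsSWNEPath l (i₀, j₀) (i₁, j₁) ∧ ∀ i j, (i, j) ∈ l ↔ M i j := by
    intro n
    induction n with
    | zero =>
      intro M i₀ j₀ h hn
      push_cast at hn
      have := h.diag h.start h.fin (by omega)
      obtain rfl : i₀ = i₁ := this
      obtain rfl : j₀ = j₁ := by omega
      refine ⟨[(i₀, j₀)], ⟨rfl, rfl, List.isChain_singleton _⟩, fun i j => ?_⟩
      simp only [List.mem_singleton, Prod.mk.injEq]
      constructor
      · rintro ⟨rfl, rfl⟩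
        exact h.start
      · intro H
        have := h.lower H
        have := h.upper H
        have := h.diag H h.start (by omega)
        omega
    | succ n ih =>
      intro M i₀ j₀ h hn
      push_cast at hn
      obtain ⟨i, j, H, hs⟩ : ∃ i j, M i j ∧ ((i = i₀ ∧ j = j₀ + 1) ∨ (i = i₀ - 1 ∧ j = j₀)) := by
        rcases h.next h.start with H | H | H
        · omega
        · exact ⟨_, _, H, .inl ⟨rfl, rfl⟩⟩
        · exact ⟨_, _, H, .inr ⟨rfl, rfl⟩⟩
      obtain ⟨l, hl, hm⟩ := ih _ i j (h.tail H (by omega)) (by omega)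
      refine ⟨(i₀, j₀) :: l, ⟨rfl, ?_, ?_⟩, fun x y => ?_⟩
      · have := hl.2.1
        cases l with
        | nil => simp at this
        | cons Y l => simpa using this
      · have h0 := hl.1
        have := hl.2.2
        cases l with
        | nil => exact List.isChain_singleton _
        | cons Y l =>
          obtain rfl : Y = (i, j) := by simpa using h0
          rw [List.isChain_cons_cons]
          refine ⟨?_, this⟩
          simp only [Prod.mk_add_mk, Prod.mk.injEq]
          omega
      · rw [List.mem_cons, hm, Prod.mk.injEq]
        constructor
        · rintro (⟨rfl, rfl⟩ | H)
          exacts [h.start, H.1]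
        · intro H'
          by_cases e : j₀ - i₀ < y - x
          · exact .inr ⟨H', e⟩
          · have := h.lower H'
            have := h.diag H' h.start (by omega)
            exact .inl (by omega)
  exact key (j₁ - i₁ - (j₀ - i₀)).toNat M i₀ j₀ h (by have := h.upper h.start; omega)

/-! ### Concurrent vertex maps and nets -/

namespace BipartiteDatum

variable {S T : Type*}

/-- The page shape of a bipartite datum. -/
@[reducible] def shape (D : BipartiteDatum S T) : PageShape S T :=
  ⟨D.r, D.src, D.tgt, fun β => D.m (.inl β), fun α => D.m (.inr α), fun β => D.u (.inl β),
    fun α => D.u (.inr α)⟩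

variable [DecidableEq S] [DecidableEq T] {D : BipartiteDatum S T}

theorem cast_numCols (α : T) : (D.numCols (.inr α) : ℤ) = D.shape.width α :=
  Nat.cast_sum _ _

theorem cast_numRows (β : S) : (D.numRows (.inl β) : ℤ) = D.shape.height β :=
  Nat.cast_sum _ _

theorem Admissible.regular (hD : D.Admissible) : D.shape.Regular where
  uS_pos β := by have := (hD (.inl β)).1; simp only; omega
  uT_pos α := by have := (hD (.inr α)).1; simp only; omega
  uS_le β := by exact Int.ofNat_le.2 ((hD (.inl β)).2.1.trans (min_le_right _ _))
  uT_le α := by exact Int.ofNat_le.2 ((hD (.inr α)).2.1.trans (min_le_left _ _))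
  uS_le_flow β := by
    have h := (hD (.inl β)).2.2
    simp only [v] at h
    simp only [PageShape.flow]
    exact_mod_cast h
  uT_le_flow α := by
    have h := (hD (.inr α)).2.2
    simp only [v] at h
    simp only [PageShape.flow]
    exact_mod_cast h

theorem pos_tgt (P : PagePoint D.r) :
    D.pos (.inr (D.tgt P.page)) P = (P.row, P.col + D.shape.colOff P.page) := rfl

theorem pos_src (P : PagePoint D.r) :
    D.pos (.inl (D.src P.page)) P = (P.row + D.shape.rowOff P.page, P.col) := rfl

/-- `C` is the set of crossing points of the net `N`. -/
def Represents (N : D.shape.Net) (C : Finset (PagePoint D.r)) : Prop :=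
  ∀ P, P ∈ C ↔ N.Cross P.page P.row P.col

theorem isPathCorner_iff {H : List (ℤ × ℤ)} {i j : ℤ} : IsPathCorner H (i, j) ↔
    (i, j) ∈ H ∧ ((i, j + 1) ∈ H ∨ (i, j - 1) ∈ H) ∧ ((i + 1, j) ∈ H ∨ (i - 1, j) ∈ H) := by
  simp [IsPathCorner]

theorem exists_fin_of_le {n : ℕ} {p : ℤ} (h1 : 1 ≤ p) (h2 : p ≤ n) :
    ∃ p' : Fin n, p = (p' : ℕ) + 1 :=
  ⟨⟨(p - 1).toNat, by omega⟩, by simp only; omega⟩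

/-- The net of a straight road map. -/
theorem exists_net (hD : D.Admissible) {R : D.RoadMap} (hR : R.Straight) :
    ∃ N : D.shape.Net, (∀ P, R.OnHorizontal P ↔ ∃ p, N.hp P.page p P.row P.col) ∧
      ∀ P, R.OnVertical P ↔ ∃ q, N.vp P.page q P.row P.col := by
  have hH : ∀ α p, LatticePath (fun i j => (i, j) ∈ R.H α p)
      (D.shape.mT α - D.shape.uT α + ((p : ℕ) + 1)) 1 ((p : ℕ) + 1) (D.shape.width α) := by
    intro α p
    have := (R.H_path α p).latticePath
    rwa [cast_numCols] at this
  have hV : ∀ β q, LatticePath (fun i j => (i, j) ∈ R.V β q)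
      (D.shape.height β) ((q : ℕ) + 1) 1 (D.shape.mS β - D.shape.uS β + ((q : ℕ) + 1)) := by
    intro β q
    have := (R.V_path β q).latticePath
    rw [cast_numRows] at this
    exact this.congr fun i j => List.mem_reverse
  refine ⟨⟨fun α p i j => ∃ p' : Fin (D.u (.inr α)), p = (p' : ℕ) + 1 ∧ (i, j) ∈ R.H α p',
    fun β q i j => ∃ q' : Fin (D.u (.inl β)), q = (q' : ℕ) + 1 ∧ (i, j) ∈ R.V β q',
    ?_, ?_, ?_, ?_, ?_, ?_, ?_, ?_⟩, ?_, ?_⟩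
  · intro α p h1 h2
    obtain ⟨n, rfl⟩ := exists_fin_of_le h1 h2
    refine (hH α n).congr fun i j => ⟨fun H => ⟨_, rfl, H⟩, ?_⟩
    rintro ⟨p', e, H⟩
    obtain rfl : p' = n := Fin.ext (by omega)
    exact H
  · intro β q h1 h2
    obtain ⟨n, rfl⟩ := exists_fin_of_le h1 h2
    refine (hV β n).congr fun i j => ⟨fun H => ⟨_, rfl, H⟩, ?_⟩
    rintro ⟨p', e, H⟩
    obtain rfl : p' = n := Fin.ext (by omega)
    exact H
  · rintro α _ i j ⟨p, rfl, -⟩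
    have := p.2
    simp only
    omega
  · rintro β _ i j ⟨q, rfl, -⟩
    have := q.2
    simp only
    omega
  · rintro α _ _ i j ⟨p, rfl, H⟩ ⟨p', rfl, H'⟩
    by_cases e : p = p'
    · rw [e]
    · exact (R.H_nonintersecting α p p' e H H').elim
  · rintro β _ _ i j ⟨q, rfl, H⟩ ⟨q', rfl, H'⟩
    by_cases e : q = q'
    · rw [e]
    · exact (R.V_nonintersecting β q q' e H H').elim
  · rintro k _ i j h1 h2 ⟨p, rfl, H⟩ H1 H2
    have hm := hD.regular.uT_le (D.tgt k)
    have hb := (hH _ p).bounds H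
    have hp := p.2
    have e : ∀ x y, (∃ p' : Fin (D.u (.inr (D.tgt k))), ((p : ℕ) : ℤ) + 1 = (p' : ℕ) + 1 ∧
        (x, y) ∈ R.H (D.tgt k) p') → (x, y) ∈ R.H (D.tgt k) p := by
      rintro x y ⟨p', e, h⟩
      obtain rfl : p = p' := Fin.ext (by omega)
      exact h
    obtain ⟨q, hq⟩ := hR.1 (D.tgt k) p _ ⟨i, j, k⟩ (isPathCorner_iff.2 ⟨H,
      H1.imp (fun h => by rw [add_right_comm]; exact e _ _ h) (fun h => by
        rw [show j + D.shape.colOff k - 1 = j - 1 + D.shape.colOff k by ring]; exact e _ _ h),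
      H2.imp (e _ _) (e _ _)⟩)
      ⟨(D.mem_points _).2 ⟨by simp only; omega, by simp only at hm hb ⊢; omega, h1, h2⟩,
        .inr rfl, rfl⟩
    exact ⟨_, q, rfl, hq⟩
  · rintro k _ i j h1 h2 ⟨p, rfl, H⟩ H1 H2
    have hm := hD.regular.uS_le (D.src k)
    have hb := (hV _ p).bounds H
    have hp := p.2
    have e : ∀ x y, (∃ p' : Fin (D.u (.inl (D.src k))), ((p : ℕ) : ℤ) + 1 = (p' : ℕ) + 1 ∧
        (x, y) ∈ R.V (D.src k) p') → (x, y) ∈ R.V (D.src k) p := by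
      rintro x y ⟨p', e, h⟩
      obtain rfl : p = p' := Fin.ext (by omega)
      exact h
    obtain ⟨q, hq⟩ := hR.2 (D.src k) p _ ⟨i, j, k⟩ (isPathCorner_iff.2 ⟨H,
      H2.imp (e _ _) (e _ _),
      H1.imp (fun h => by rw [add_right_comm]; exact e _ _ h) (fun h => by
        rw [show i + D.shape.rowOff k - 1 = i - 1 + D.shape.rowOff k by ring]; exact e _ _ h)⟩)
      ⟨(D.mem_points _).2 ⟨h1, h2, by simp only; omega, by simp only at hm hb ⊢; omega⟩,
        .inl rfl, rfl⟩
    exact ⟨_, q, rfl, hq⟩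
  · intro P
    constructor
    · rintro ⟨p, hp⟩
      exact ⟨_, p, rfl, hp⟩
    · rintro ⟨_, p, -, hp⟩
      exact ⟨p, hp⟩
  · intro P
    constructor
    · rintro ⟨p, hp⟩
      exact ⟨_, p, rfl, hp⟩
    · rintro ⟨_, p, -, hp⟩
      exact ⟨p, hp⟩

/-- The road map of a net. -/
theorem exists_roadMap (N : D.shape.Net) :
    ∃ R : D.RoadMap, R.Straight ∧ (∀ P, R.OnHorizontal P ↔ ∃ p, N.hp P.page p P.row P.col) ∧
      ∀ P, R.OnVertical P ↔ ∃ q, N.vp P.page q P.row P.col := by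
  have hH : ∀ α (p : Fin (D.u (.inr α))), ∃ l, IsSWNEPath l
      ((D.numRows (.inr α) : ℤ) - D.u (.inr α) + ((p : ℕ) + 1), 1)
      (((p : ℕ) : ℤ) + 1, D.numCols (.inr α)) ∧ ∀ i j, (i, j) ∈ l ↔ N.h α ((p : ℕ) + 1) i j := by
    intro α p
    rw [cast_numCols]
    exact (N.h_path α ((p : ℕ) + 1) (by omega) (by have := p.2; simp only; omega)).exists_list
  have hV : ∀ β (q : Fin (D.u (.inl β))), ∃ l, IsNESWPath l
      (1, (D.numCols (.inl β) : ℤ) - D.u (.inl β) + ((q : ℕ) + 1))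
      (D.numRows (.inl β), ((q : ℕ) : ℤ) + 1) ∧
      ∀ i j, (i, j) ∈ l ↔ N.v β ((q : ℕ) + 1) i j := by
    intro β q
    rw [cast_numRows]
    obtain ⟨l, h1, h2⟩ :=
      (N.v_path β ((q : ℕ) + 1) (by omega) (by have := q.2; simp only; omega)).exists_list
    refine ⟨l.reverse, ?_, fun i j => by rw [List.mem_reverse, h2]⟩
    unfold IsNESWPath
    rwa [List.reverse_reverse]
  choose H H1 H2 using hH
  choose V V1 V2 using hV
  let R : D.RoadMap := ⟨H, V, H1, V1,
    fun α p p' hne => fun x hx hx' => hne (Fin.ext (by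
      have := N.h_inj ((H2 α p _ _).1 hx) ((H2 α p' _ _).1 hx')
      omega)),
    fun β q q' hne => fun x hx hx' => hne (Fin.ext (by
      have := N.v_inj ((V2 β q _ _).1 hx) ((V2 β q' _ _).1 hx')
      omega))⟩
  have hOnH : ∀ P, R.OnHorizontal P ↔ ∃ p, N.hp P.page p P.row P.col := by
    intro P
    constructor
    · rintro ⟨p, hp⟩
      exact ⟨_, (H2 _ _ _ _).1 hp⟩
    · rintro ⟨p, hp⟩
      have hi := N.h_index hp
      obtain ⟨p', rfl⟩ := exists_fin_of_le hi.1 hi.2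
      exact ⟨p', (H2 _ _ _ _).2 hp⟩
  have hOnV : ∀ P, R.OnVertical P ↔ ∃ p, N.vp P.page p P.row P.col := by
    intro P
    constructor
    · rintro ⟨p, hp⟩
      exact ⟨_, (V2 _ _ _ _).1 hp⟩
    · rintro ⟨p, hp⟩
      have hi := N.v_index hp
      obtain ⟨p', rfl⟩ := exists_fin_of_le hi.1 hi.2
      exact ⟨p', (V2 _ _ _ _).2 hp⟩
  refine ⟨R, ⟨?_, ?_⟩, hOnH, hOnV⟩
  · rintro α p x P hc ⟨hP, hinc | hinc, rfl⟩
    · simp at hinc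
    obtain rfl : α = D.tgt P.page := Sum.inr_injective hinc
    rw [D.mem_points] at hP
    rw [pos_tgt, isPathCorner_iff] at hc
    change (_ ∈ H _ _) ∧ (_ ∈ H _ _ ∨ _ ∈ H _ _) ∧ (_ ∈ H _ _ ∨ _ ∈ H _ _) at hc
    simp only [H2] at hc
    refine (hOnV P).2 (N.h_corner hP.2.2.1 hP.2.2.2 hc.1 ?_ hc.2.2)
    rw [add_right_comm, show P.col - 1 + D.shape.colOff P.page =
      P.col + D.shape.colOff P.page - 1 by ring]
    exact hc.2.1
  · rintro α p x P hc ⟨hP, hinc | hinc, rfl⟩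
    swap
    · simp at hinc
    obtain rfl : α = D.src P.page := Sum.inl_injective hinc
    rw [D.mem_points] at hP
    rw [pos_src, isPathCorner_iff] at hc
    change (_ ∈ V _ _) ∧ (_ ∈ V _ _ ∨ _ ∈ V _ _) ∧ (_ ∈ V _ _ ∨ _ ∈ V _ _) at hc
    simp only [V2] at hc
    refine (hOnH P).2 (N.v_corner hP.1 hP.2.1 hc.1 ?_ hc.2.1)
    rw [add_right_comm, show P.row - 1 + D.shape.rowOff P.page =
      P.row + D.shape.rowOff P.page - 1 by ring]
    exact hc.2.2

theorem cross_mem_points {N : D.shape.Net} {P : PagePoint D.r}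
    (h : N.Cross P.page P.row P.col) : P ∈ D.points := by
  have hb := h.bounds
  exact (D.mem_points P).2 hb

/-- From here on road maps are replaced by nets. Membership in L comes for free, since rows are
bounded by the horizontal path and columns by the vertical one. -/
theorem isConcurrent_iff (hD : D.Admissible) {C : Finset (PagePoint D.r)} :
    D.IsConcurrent C ↔ ∃ N : D.shape.Net, Represents N C := by
  constructor
  · rintro ⟨R, hR, hC⟩
    obtain ⟨N, h1, h2⟩ := exists_net hD hR
    refine ⟨N, fun P => ?_⟩
    rw [hC, h1, h2]
    exact ⟨fun h => h.2, fun h => ⟨cross_mem_points h, h⟩⟩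
  · rintro ⟨N, hN⟩
    obtain ⟨R, hR, h1, h2⟩ := exists_roadMap N
    refine ⟨R, hR, fun P => ?_⟩
    rw [hN, h1, h2]
    exact ⟨fun h => ⟨cross_mem_points h, h⟩, fun h => h.2⟩

end BipartiteDatum

/-! ### Diagonal chains -/

/-- Pigeonhole: of n + 1 points covered by n paths two share a path, and a path contains no strictly
south-east pair. -/
theorem not_hasDiagonalChain {A : Finset (ℤ × ℤ)} {n : ℕ} (M : ℤ → ℤ → ℤ → Prop)
    (hA : ∀ x ∈ A, ∃ p : ℤ, 1 ≤ p ∧ p ≤ n ∧ M p x.1 x.2)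
    (hM : ∀ p i j i' j', M p i j → M p i' j' → i < i' → j < j' → False) :
    ¬ HasDiagonalChain A (n + 1) := by
  rintro ⟨f, h1, h2, h3⟩
  choose g hg using fun t => hA (f t) (h3 t)
  obtain ⟨s, -, t, -, hne, e⟩ := Finset.exists_ne_map_eq_of_card_lt_of_maps_to
    (s := (Finset.univ : Finset (Fin (n + 1)))) (t := Finset.Icc (1 : ℤ) n) (f := g) (by simp)
    (fun t _ => by
      simp only [Finset.coe_Icc, Set.mem_Icc]
      exact ⟨(hg t).1, (hg t).2.1⟩)
  rcases lt_or_gt_of_ne hne with h | h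
  · exact hM (g s) _ _ _ _ (hg s).2.2 (e ▸ (hg t).2.2) (h1 h) (h2 h)
  · exact hM (g s) _ _ _ _ (e ▸ (hg t).2.2) (hg s).2.2 (h1 h) (h2 h)

theorem HasDiagonalChain.mono {A B : Finset (ℤ × ℤ)} {s : ℕ} (h : A ⊆ B)
    (hA : HasDiagonalChain A s) : HasDiagonalChain B s := by
  obtain ⟨f, h1, h2, h3⟩ := hA
  exact ⟨f, h1, h2, fun t => h (h3 t)⟩

theorem hasDiagonalChain_cons {A : Finset (ℤ × ℤ)} {n : ℕ} {x : ℤ × ℤ} (hx : x ∈ A)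
    {g : ℤ → ℤ × ℤ} (hg : ∀ p : ℤ, 1 ≤ p → p ≤ n → g p ∈ A ∧ x.1 < (g p).1 ∧ x.2 < (g p).2)
    (hm : ∀ p p' : ℤ, 1 ≤ p → p < p' → p' ≤ n → (g p).1 < (g p').1 ∧ (g p).2 < (g p').2) :
    HasDiagonalChain A (n + 1) := by
  -- Index 0 is reserved for x, so the index t ≥ 1 corresponds to `g t` without a shift.
  have key : ∀ s t : Fin (n + 1), s < t →
      (if s = 0 then x else g (s : ℕ)).1 < (if t = 0 then x else g (t : ℕ)).1 ∧
      (if s = 0 then x else g (s : ℕ)).2 < (if t = 0 then x else g (t : ℕ)).2 := by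
    intro s t hst
    have hs := s.2
    have ht := t.2
    rw [Fin.lt_def] at hst
    rw [if_neg (show t ≠ 0 by rintro rfl; simp at hst)]
    split_ifs with h0
    · exact (hg (t : ℕ) (by omega) (by omega)).2
    · have : (s : ℕ) ≠ 0 := fun h => h0 (Fin.ext h)
      exact hm _ _ (by omega) (by omega) (by omega)
  refine ⟨fun t => if t = 0 then x else g (t : ℕ), fun s t h => (key s t h).1,
    fun s t h => (key s t h).2, fun t => ?_⟩
  simp only
  split_ifs with h0
  · exact hx
  · have : (t : ℕ) ≠ 0 := fun h => h0 (Fin.ext h)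
    have := t.2
    exact (hg (t : ℕ) (by omega) (by omega)).1

namespace BipartiteDatum

variable {S T : Type*} [DecidableEq S] [DecidableEq T] {D : BipartiteDatum S T}

theorem mem_preim {γ : S ⊕ T} {C : Finset (PagePoint D.r)} {x : ℤ × ℤ} :
    x ∈ D.preim γ C ↔ ∃ P ∈ C, D.Incident γ P.page ∧ D.pos γ P = x := by
  simp [preim, and_assoc]

theorem preim_mono (γ : S ⊕ T) {C C' : Finset (PagePoint D.r)} (h : C ⊆ C') :
    D.preim γ C ⊆ D.preim γ C' := by
  intro x hx
  rw [mem_preim] at hx ⊢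
  obtain ⟨P, hP, h'⟩ := hx
  exact ⟨P, h hP, h'⟩

theorem incident_inr {α : T} {k : Fin D.r} : D.Incident (.inr α) k ↔ D.tgt k = α := by
  simp [Incident, eq_comm]

theorem incident_inl {β : S} {k : Fin D.r} : D.Incident (.inl β) k ↔ D.src k = β := by
  simp [Incident, eq_comm]

theorem mem_preim_inr {N : D.shape.Net} {C : Finset (PagePoint D.r)} (h : Represents N C) {α : T}
    {x y : ℤ} : (x, y) ∈ D.preim (.inr α) C ↔ N.CrossAt α x y := by
  rw [mem_preim]
  constructor
  · rintro ⟨P, hP, hi, e⟩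
    rw [incident_inr] at hi
    subst hi
    rw [pos_tgt, Prod.mk.injEq] at e
    obtain ⟨rfl, rfl⟩ := e
    exact ⟨P.page, P.col, rfl, rfl, (h P).1 hP⟩
  · rintro ⟨k, j, rfl, rfl, hc⟩
    exact ⟨⟨x, j, k⟩, (h ⟨x, j, k⟩).2 hc, incident_inr.2 rfl, rfl⟩

theorem mem_preim_inl {N : D.shape.Net} {C : Finset (PagePoint D.r)} (h : Represents N C) {β : S}
    {x y : ℤ} : (x, y) ∈ D.preim (.inl β) C ↔ N.transpose.CrossAt β y x := by
  rw [mem_preim]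
  constructor
  · rintro ⟨P, hP, hi, e⟩
    rw [incident_inl] at hi
    subst hi
    rw [pos_src, Prod.mk.injEq] at e
    obtain ⟨rfl, rfl⟩ := e
    exact ⟨P.page, P.row, rfl, rfl, PageShape.Net.cross_transpose.2 ((h P).1 hP)⟩
  · rintro ⟨k, i, rfl, rfl, hc⟩
    exact ⟨⟨i, y, k⟩, (h ⟨i, y, k⟩).2 (PageShape.Net.cross_transpose.1 hc), incident_inl.2 rfl,
      rfl⟩

theorem UCompatible.mono {C C' : Finset (PagePoint D.r)} (h : D.UCompatible C') (hC : C ⊆ C') :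
    D.UCompatible C :=
  ⟨hC.trans h.1, fun γ hc => h.2 γ (hc.mono (preim_mono γ hC))⟩

theorem Represents.uCompatible {N : D.shape.Net} {C : Finset (PagePoint D.r)}
    (h : Represents N C) : D.UCompatible C := by
  refine ⟨fun P hP => cross_mem_points ((h P).1 hP), ?_⟩
  rintro (β | α)
  · refine not_hasDiagonalChain (N.v β) ?_ fun q i j i' j' H H' hi hj =>
      (N.v_path β q (N.v_index H).1 (N.v_index H).2).not_lt_lt H H' hi hj
    rintro ⟨x, y⟩ hx
    obtain ⟨k, i, rfl, rfl, ⟨q, hq⟩, -⟩ := (mem_preim_inl h).1 hx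
    exact ⟨q, (N.v_index hq).1, (N.v_index hq).2, hq⟩
  · refine not_hasDiagonalChain (N.h α) ?_ fun q i j i' j' H H' hi hj =>
      (N.h_path α q (N.h_index H).1 (N.h_index H).2).not_lt_lt H H' hi hj
    rintro ⟨x, y⟩ hx
    obtain ⟨k, i, rfl, rfl, ⟨q, hq⟩, -⟩ := (mem_preim_inr h).1 hx
    exact ⟨q, (N.h_index hq).1, (N.h_index hq).2, hq⟩

/-! ### The greedy algorithm -/

/-- A certificate for the outcome of the greedy run: C is compatible, and each point outside C is
already blocked by the points of C that precede it. The invariant is that the current set is C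
restricted to the points tried so far. -/
theorem greedy_eq {l : List (PagePoint D.r)} {r : PagePoint D.r → PagePoint D.r → Prop}
    [DecidableRel r] (hl : l.Pairwise r) (hasymm : ∀ P Q, r P Q → ¬ r Q P)
    (hmem : ∀ P, P ∈ l ↔ P ∈ D.points) {C : Finset (PagePoint D.r)} (hC : D.UCompatible C)
    (hmax : ∀ P ∈ D.points, P ∉ C → ¬ D.UCompatible (insert P {Q ∈ C | r Q P})) :
    D.greedy l ∅ = C := by
  classical
  have key : ∀ l₂ l₁ : List (PagePoint D.r), l = l₁ ++ l₂ →
      D.greedy l₂ {Q ∈ C | Q ∈ l₁} = {Q ∈ C | Q ∈ l} := by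
    intro l₂
    induction l₂ with
    | nil =>
      intro l₁ h
      simp [greedy, h]
    | cons P l₂ ih =>
      intro l₁ h
      have step : D.greedy (P :: l₂) {Q ∈ C | Q ∈ l₁} = D.greedy l₂ {Q ∈ C | Q ∈ l₁ ++ [P]} := by
        unfold greedy
        rw [List.foldl_cons]
        congr 1
        by_cases hP : P ∈ C
        · have e : insert P {Q ∈ C | Q ∈ l₁} = {Q ∈ C | Q ∈ l₁ ++ [P]} := by
            ext Q
            simp only [Finset.mem_insert, Finset.mem_filter, List.mem_append, List.mem_singleton]
            constructor
            · rintro (rfl | h)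
              exacts [⟨hP, .inr rfl⟩, ⟨h.1, .inl h.2⟩]
            · rintro ⟨h, h' | h'⟩
              exacts [.inr ⟨h, h'⟩, .inl h']
          rw [e, if_pos (hC.mono (Finset.filter_subset _ _))]
        · have hPp : P ∈ D.points := (hmem P).1 (by simp [h])
          rw [if_neg]
          · ext Q
            simp only [Finset.mem_filter, List.mem_append, List.mem_singleton]
            constructor
            · exact fun h => ⟨h.1, .inl h.2⟩
            · rintro ⟨hQ, hQ' | hQ'⟩
              · exact ⟨hQ, hQ'⟩
              · exact absurd (hQ' ▸ hQ) hP
          -- By asymmetry of r, the points of C preceding P are among those already tried, and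
          -- compatibility passes to subsets.
          · refine fun hc => hmax P hPp hP (hc.mono (Finset.insert_subset_insert _ ?_))
            intro Q hQ
            rw [Finset.mem_filter] at hQ ⊢
            refine ⟨hQ.1, ?_⟩
            have hQl : Q ∈ l := (hmem Q).2 (hC.1 hQ.1)
            rw [h, List.mem_append, List.mem_cons] at hQl
            rcases hQl with hQl | rfl | hQl
            · exact hQl
            · exact absurd hQ.1 hP
            · rw [h, List.pairwise_append, List.pairwise_cons] at hl
              exact absurd hQ.2 (hasymm _ _ (hl.2.1.1 Q hQl))
      rw [step]
      exact ih (l₁ ++ [P]) (by simp [h])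
  have h0 := key l [] rfl
  simp only [List.not_mem_nil, Finset.filter_false] at h0
  rw [h0]
  ext Q
  rw [Finset.mem_filter, hmem]
  exact ⟨fun h => h.1, fun h => ⟨h, hC.1 h⟩⟩

theorem cMax_eq {C : Finset (PagePoint D.r)} (hC : D.UCompatible C)
    (hmax : ∀ P ∈ D.points, P ∉ C → ¬ D.UCompatible (insert P {Q ∈ C | P < Q})) :
    D.cMax ∅ = C := by
  refine greedy_eq (r := fun P Q => Q < P) ?_ (fun P Q h => lt_asymm h) (by simp) hC hmax
  exact Finset.sortedGT_sort D.points |>.pairwise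

theorem cMin_eq {C : Finset (PagePoint D.r)} (hC : D.UCompatible C)
    (hmax : ∀ P ∈ D.points, P ∉ C → ¬ D.UCompatible (insert P {Q ∈ C | Q < P})) :
    D.cMin ∅ = C := by
  refine greedy_eq (r := fun P Q => P < Q) ?_ (fun P Q h => lt_asymm h) (by simp) hC hmax
  exact Finset.sortedLT_sort D.points |>.pairwise

/-! ### Chute moves -/

theorem isEntry_inr {α : T} {x y : ℤ} {P : PagePoint D.r} : D.IsEntry (.inr α) (x, y) P ↔
    P ∈ D.points ∧ D.tgt P.page = α ∧ P.row = x ∧ P.col + D.shape.colOff P.page = y := by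
  unfold IsEntry
  rw [incident_inr]
  refine and_congr_right fun _ => and_congr_right ?_
  rintro rfl
  rw [pos_tgt, Prod.mk.injEq]

theorem isEntry_inl {β : S} {x y : ℤ} {P : PagePoint D.r} : D.IsEntry (.inl β) (x, y) P ↔
    P ∈ D.points ∧ D.src P.page = β ∧ P.row + D.shape.rowOff P.page = x ∧ P.col = y := by
  unfold IsEntry
  rw [incident_inl]
  refine and_congr_right fun _ => and_congr_right ?_
  rintro rfl
  rw [pos_src, Prod.mk.injEq]

theorem mem_points_shape {P : PagePoint D.r} : P ∈ D.points ↔ 1 ≤ P.row ∧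
    P.row ≤ D.shape.mT (D.tgt P.page) ∧ 1 ≤ P.col ∧ P.col ≤ D.shape.mS (D.src P.page) :=
  D.mem_points P

/-- Further east in A_α, or further south in A_β, means the same page or a later one; on one page
the row decides. So chains to the south-east of a point consist of larger points for either kind of
vertex. -/
theorem IsEntry.lt (hQ : D.shape.Regular) {γ : S ⊕ T} {i j i' j' : ℤ} {P P' : PagePoint D.r}
    (h : D.IsEntry γ (i, j) P) (h' : D.IsEntry γ (i', j') P') (hi : i < i') (hj : j < j') :
    P < P' := by
  rw [PagePoint.lt_iff]
  rcases γ with β | α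
  · rw [isEntry_inl, mem_points_shape] at h h'
    have hk : P.page ≤ P'.page := hQ.transpose.page_le_of_col_le (k := P.page) (k' := P'.page)
      (h.2.1.trans h'.2.1.symm) h'.1.2.1 h.1.1 (by
        have e1 := h.2.2.1
        have e2 := h'.2.2.1
        change P.row + D.shape.rowOff _ ≤ P'.row + D.shape.rowOff _
        omega)
    rcases hk.lt_or_eq with hk | hk
    · exact .inl hk
    · have e1 := h.2.2.1
      have e2 := h'.2.2.1
      rw [hk] at e1
      exact .inr (.inl ⟨hk, by omega⟩)
  · rw [isEntry_inr, mem_points_shape] at h h'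
    have hk : P.page ≤ P'.page := hQ.page_le_of_col_le (k := P.page) (k' := P'.page)
      (h.2.1.trans h'.2.1.symm) h'.1.2.2.2 h.1.2.2.1 (by omega)
    rcases hk.lt_or_eq with hk | hk
    · exact .inl hk
    · exact .inr (.inl ⟨hk, by omega⟩)

theorem IsEntry.unique (hQ : D.shape.Regular) {γ : S ⊕ T} {x : ℤ × ℤ} {P P' : PagePoint D.r}
    (h : D.IsEntry γ x P) (h' : D.IsEntry γ x P') : P = P' := by
  obtain ⟨i, j⟩ := x
  rcases γ with β | α
  · rw [isEntry_inl, mem_points_shape] at h h'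
    obtain ⟨e, e'⟩ := hQ.page_unique_row (k := P.page) (k' := P'.page)
      (h.2.1.trans h'.2.1.symm) h.1.1 h.1.2.1 h'.1.1 h'.1.2.1
      (h.2.2.1.trans h'.2.2.1.symm)
    exact PagePoint.ext e' (h.2.2.2.trans h'.2.2.2.symm) e
  · rw [isEntry_inr, mem_points_shape] at h h'
    obtain ⟨e, e'⟩ := hQ.page_unique (k := P.page) (k' := P'.page)
      (h.2.1.trans h'.2.1.symm) h.1.2.2.1 h.1.2.2.2 h'.1.2.2.1 h'.1.2.2.2
      (h.2.2.2.trans h'.2.2.2.symm)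
    exact PagePoint.ext (h.2.2.1.trans h'.2.2.1.symm) e' e

theorem mem_preim_iff_mem (hQ : D.shape.Regular) {γ : S ⊕ T} {x : ℤ × ℤ} {P : PagePoint D.r}
    {C : Finset (PagePoint D.r)} (hC : C ⊆ D.points) (h : D.IsEntry γ x P) :
    x ∈ D.preim γ C ↔ P ∈ C := by
  rw [mem_preim]
  constructor
  · rintro ⟨P', hP', hi, e⟩
    rwa [h.unique hQ ⟨hC hP', hi, e⟩]
  · exact fun hP => ⟨P, hP, h.2⟩

/-- If `C` meets a block exactly in its NE, SW and NW corners, then moving the point in the NW corner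
to the SE corner is an inverse chute move. -/
theorem chuteIn_of_block (hQ : D.shape.Regular) {γ : S ⊕ T} {i i' j j' : ℤ}
    {C : Finset (PagePoint D.r)} {P P' : PagePoint D.r} (hC : C ⊆ D.points) (h1 : 1 ≤ i)
    (h2 : i < i') (h3 : i' ≤ D.numRows γ) (h4 : 1 ≤ j) (h5 : j < j') (h6 : j' ≤ D.numCols γ)
    (hP : D.IsEntry γ (i, j) P) (hP' : D.IsEntry γ (i', j') P')
    (hb : D.preim γ C ∩ (Finset.Icc i i' ×ˢ Finset.Icc j j') = {(i, j), (i, j'), (i', j)}) :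
    P ∈ C ∧ P' ∉ C ∧ D.ChuteIn γ i i' j j' (insert P' (C.erase P)) C := by
  have hPC : P ∈ C := by
    rw [← mem_preim_iff_mem hQ hC hP]
    have : (i, j) ∈ D.preim γ C ∩ (Finset.Icc i i' ×ˢ Finset.Icc j j') := by rw [hb]; simp
    exact (Finset.mem_inter.1 this).1
  have hPC' : P' ∉ C := by
    rw [← mem_preim_iff_mem hQ hC hP']
    intro h
    have : (i', j') ∈ D.preim γ C ∩ (Finset.Icc i i' ×ˢ Finset.Icc j j') := by
      simp [h, h2.le, h5.le]
    rw [hb] at this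
    simp only [Finset.mem_insert, Prod.mk.injEq, Finset.mem_singleton] at this
    omega
  have hmem : ∀ x, x ∈ D.preim γ (insert P' (C.erase P)) ↔
      x = (i', j') ∨ (x ∈ D.preim γ C ∧ x ≠ (i, j)) := by
    intro x
    simp only [mem_preim, Finset.mem_insert, Finset.mem_erase]
    constructor
    · rintro ⟨R, rfl | ⟨hne, hR⟩, hi, e⟩
      · exact .inl (e.symm.trans hP'.2.2)
      · refine .inr ⟨⟨R, hR, hi, e⟩, ?_⟩
        rintro rfl
        exact hne (IsEntry.unique hQ ⟨hC hR, hi, e⟩ hP)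
    · rintro (rfl | ⟨⟨R, hR, hi, e⟩, hne⟩)
      · exact ⟨P', .inl rfl, hP'.2⟩
      · refine ⟨R, .inr ⟨?_, hR⟩, hi, e⟩
        rintro rfl
        exact hne (e.symm.trans hP.2.2)
  refine ⟨hPC, hPC', h1, h2, h3, h4, h5, h6, ?_, P, P', hP, hP', ?_⟩
  · ext ⟨x, y⟩
    have hxy : (x, y) ∈ D.preim γ C ∩ (Finset.Icc i i' ×ˢ Finset.Icc j j') ↔
        (x, y) ∈ ({(i, j), (i, j'), (i', j)} : Finset (ℤ × ℤ)) := by rw [hb]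
    simp only [Finset.mem_inter, Finset.mem_product, Finset.mem_Icc, hmem, Finset.mem_insert,
      Finset.mem_singleton, Prod.mk.injEq, ne_eq] at hxy ⊢
    by_cases hxb : (i ≤ x ∧ x ≤ i') ∧ j ≤ y ∧ y ≤ j'
    · simp only [hxb, and_true] at hxy ⊢
      rw [hxy]
      omega
    · simp only [hxb, and_false, false_iff] at hxy ⊢
      omega
  · ext R
    simp only [Finset.mem_sdiff, Finset.mem_union, Finset.mem_insert, Finset.mem_erase,
      Finset.mem_singleton]
    by_cases e : R = P
    · subst e
      simp only [hPC, true_iff]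
      exact ⟨.inr trivial, fun h => hPC' (h ▸ hPC)⟩
    · by_cases e' : R = P'
      · subst e'
        simp [hPC']
      · simp [e, e']

end BipartiteDatum

namespace PageShape.Net

variable {S T : Type*} [DecidableEq S] [DecidableEq T] {Q : PageShape S T} {N : Q.Net}

/-- The block spanned by a free corner shows exactly the pattern left behind by a chute move: the SE
corner is missing because no horizontal path passes there. -/
theorem FreeCorner.crossAt_iff (hQ : Q.Regular) {α : T} {p i c c' x y : ℤ}
    (F : N.FreeCorner α p i c c') (hx : i ≤ x) (hx' : x ≤ i + 1) (hy : c ≤ y) (hy' : y ≤ c') :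
    N.CrossAt α x y ↔ (x = i ∧ y = c) ∨ (x = i ∧ y = c') ∨ (x = i + 1 ∧ y = c) := by
  have hE := crossAt_of_vertical_edge hQ F.south F.corner
  constructor
  · intro H
    rcases hx.eq_or_lt with rfl | hx
    · by_contra hne
      exact F.gap y (by omega) (by omega) H
    · obtain rfl : x = i + 1 := by omega
      obtain ⟨k, j, rfl, rfl, ⟨p', hp'⟩, -⟩ := H
      by_contra hne
      exact F.free p' _ (by omega) hy' hp'
  · rintro (⟨rfl, rfl⟩ | ⟨rfl, rfl⟩ | ⟨rfl, rfl⟩)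
    exacts [hE.2, F.last, hE.1]

theorem FreeCorner.exists_pages (hQ : Q.Regular) {α : T} {p i c c' : ℤ}
    (F : N.FreeCorner α p i c c') :
    (∃ k j, Q.tgt k = α ∧ c = j + Q.colOff k ∧ 1 ≤ j ∧ j ≤ Q.mS (Q.src k)) ∧
      (∃ k j, Q.tgt k = α ∧ c' = j + Q.colOff k ∧ 1 ≤ j ∧ j ≤ Q.mS (Q.src k)) ∧
      1 ≤ i ∧ i + 1 ≤ Q.mT α ∧ 1 ≤ c ∧ c' ≤ Q.width α := by
  have h1 := h_bounds F.corner
  have h2 := h_bounds F.south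
  have h3 := F.last.le_width hQ
  have h4 := F.lt
  exact ⟨exists_page h1.2.2.2.2.1 h1.2.2.2.2.2, exists_page (by omega) h3, by omega, by omega,
    by omega, h3⟩

end PageShape.Net

/-! ### Free corners as inverse chute moves, and termination -/

namespace BipartiteDatum

open PageShape

variable {S T : Type*} [DecidableEq S] [DecidableEq T] {D : BipartiteDatum S T}

theorem Represents.of_moved (hQ : D.shape.Regular) {N N' : D.shape.Net}
    {C : Finset (PagePoint D.r)} (hN : Represents N C) {α : T} {i c c' : ℤ}
    (hM : PageShape.Net.FreeCorner.Moved N α i c c' N') {P P' : PagePoint D.r}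
    (hP : D.IsEntry (.inr α) (i, c) P) (hP' : D.IsEntry (.inr α) (i + 1, c') P') :
    Represents N' (insert P' (C.erase P)) := by
  intro R
  have hR : R = P' ↔ D.IsEntry (.inr α) (i + 1, c') R :=
    ⟨fun e => e ▸ hP', fun h => h.unique hQ hP'⟩
  have hR' : R = P ↔ D.IsEntry (.inr α) (i, c) R := ⟨fun e => e ▸ hP, fun h => h.unique hQ hP⟩
  rw [isEntry_inr, mem_points_shape] at hR hR' hP'
  obtain ⟨⟨a1, a2, -⟩, rfl, e', -⟩ := hP'
  rw [hM R.page R.row R.col, Finset.mem_insert, Finset.mem_erase, Ne, hN R, hR, hR']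
  constructor
  · rintro (h | ⟨h, H⟩)
    · exact .inr ⟨h.2.1, h.2.2.1, h.2.2.2, h.1.2.2⟩
    · exact .inl ⟨H, fun h' => h ⟨H.bounds, h'⟩⟩
  · rintro (⟨H, h⟩ | ⟨e, h1, h2, h3⟩)
    · exact .inr ⟨fun h' => h h'.2, H⟩
    · refine .inl ⟨⟨by omega, ?_, h3⟩, e, h1, h2⟩
      rw [h1, ← e']
      exact a2.trans_eq (congrArg D.shape.mT e.symm)

theorem Represents.of_moved_transpose (hQ : D.shape.Regular) {N : D.shape.Net}
    {N' : D.shape.transpose.Net} {C : Finset (PagePoint D.r)} (hN : Represents N C) {β : S}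
    {j c c' : ℤ} (hM : PageShape.Net.FreeCorner.Moved N.transpose β j c c' N')
    {P P' : PagePoint D.r} (hP : D.IsEntry (.inl β) (c, j) P)
    (hP' : D.IsEntry (.inl β) (c', j + 1) P') :
    Represents (D := D) N'.transpose (insert P' (C.erase P)) := by
  intro R
  have hR : R = P' ↔ D.IsEntry (.inl β) (c', j + 1) R :=
    ⟨fun e => e ▸ hP', fun h => h.unique hQ hP'⟩
  have hR' : R = P ↔ D.IsEntry (.inl β) (c, j) R := ⟨fun e => e ▸ hP, fun h => h.unique hQ hP⟩
  rw [isEntry_inl, mem_points_shape] at hR hR' hP'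
  obtain ⟨⟨-, -, a1, a2⟩, rfl, -, e'⟩ := hP'
  have hM' := hM R.page R.col R.row
  rw [PageShape.Net.cross_transpose] at hM'
  rw [PageShape.Net.cross_transpose, hM', Finset.mem_insert, Finset.mem_erase, Ne, hN R, hR, hR']
  constructor
  · rintro (h | ⟨h, H⟩)
    · exact .inr ⟨h.2.1, h.2.2.2, h.2.2.1, h.1.1, h.1.2.1⟩
    · exact .inl ⟨H, fun h' => h ⟨H.bounds, h'.1, h'.2.2, h'.2.1⟩⟩
  · rintro (⟨H, h⟩ | ⟨e, h1, h2, h3⟩)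
    · exact .inr ⟨fun h' => h ⟨h'.2.1, h'.2.2.2, h'.2.2.1⟩, H⟩
    · refine .inl ⟨⟨h3.1, h3.2, ?_, ?_⟩, e, h2, h1⟩
      · omega
      · rw [h1, ← e']
        exact a2.trans_eq (congrArg D.shape.mS e.symm)

theorem exists_horizontal_chute (hQ : D.shape.Regular) {N : D.shape.Net}
    {C : Finset (PagePoint D.r)} (hN : Represents N C) {α : T} {p i c c' : ℤ}
    (F : N.FreeCorner α p i c c') :
    ∃ (N' : D.shape.Net) (P P' : PagePoint D.r), Represents N' (insert P' (C.erase P)) ∧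
      P ∈ C ∧ P' ∉ C ∧ P < P' ∧ D.ChuteMove (insert P' (C.erase P)) C := by
  obtain ⟨⟨k, j, rfl, hc, h1, h2⟩, ⟨k', j', ht', hc', h1', h2'⟩, h3, h4, h5, h6⟩ :=
    F.exists_pages hQ
  have hP : D.IsEntry (.inr (D.tgt k)) (i, c) ⟨i, j, k⟩ :=
    isEntry_inr.2 ⟨mem_points_shape.2 ⟨h3, (by omega : i ≤ i + 1).trans h4, h1, h2⟩, rfl, rfl, hc.symm⟩
  have hP' : D.IsEntry (.inr (D.tgt k)) (i + 1, c') ⟨i + 1, j', k'⟩ :=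
    isEntry_inr.2 ⟨mem_points_shape.2 ⟨(by omega : 1 ≤ i + 1),
      h4.trans_eq (congrArg D.shape.mT ht'.symm), h1', h2'⟩, ht', rfl, hc'.symm⟩
  obtain ⟨N', hM⟩ := F.exists_moved hQ
  have hb : D.preim (.inr (D.tgt k)) C ∩ (Finset.Icc i (i + 1) ×ˢ Finset.Icc c c') =
      {(i, c), (i, c'), (i + 1, c)} := by
    ext ⟨x, y⟩
    simp only [Finset.mem_inter, Finset.mem_product, Finset.mem_Icc, Finset.mem_insert,
      Finset.mem_singleton, Prod.mk.injEq, mem_preim_inr hN]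
    have hlt := F.lt
    constructor
    · rintro ⟨H, ⟨a1, a2⟩, a3, a4⟩
      exact (F.crossAt_iff hQ a1 a2 a3 a4).1 H
    · intro H
      have hbd : (i ≤ x ∧ x ≤ i + 1) ∧ c ≤ y ∧ y ≤ c' := by omega
      exact ⟨(F.crossAt_iff hQ hbd.1.1 hbd.1.2 hbd.2.1 hbd.2.2).2 H, hbd⟩
  obtain ⟨b1, b2, b3⟩ := chuteIn_of_block hQ hN.uCompatible.1 h3 (by omega) h4 h5 F.lt
    (by rw [cast_numCols]; exact h6) hP hP' hb
  exact ⟨N', _, _, hN.of_moved hQ hM hP hP', b1, b2, hP.lt hQ hP' (by omega) F.lt, .inl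
    ⟨D.tgt k, i, c, c', b3⟩⟩

theorem exists_vertical_chute (hQ : D.shape.Regular) {N : D.shape.Net}
    {C : Finset (PagePoint D.r)} (hN : Represents N C) {β : S} {q j c c' : ℤ}
    (F : N.transpose.FreeCorner β q j c c') :
    ∃ (N' : D.shape.Net) (P P' : PagePoint D.r), Represents N' (insert P' (C.erase P)) ∧
      P ∈ C ∧ P' ∉ C ∧ P < P' ∧ D.ChuteMove (insert P' (C.erase P)) C := by
  obtain ⟨⟨k, i, ht, hc, h1, h2⟩, ⟨k', i', ht', hc', h1', h2'⟩, h3, h4, h5, h6⟩ :=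
    F.exists_pages hQ.transpose
  have ht : D.src k = β := ht
  subst ht
  have hP : D.IsEntry (.inl (D.src k)) (c, j) ⟨i, j, k⟩ :=
    isEntry_inl.2 ⟨mem_points_shape.2 ⟨h1, h2, h3, (by omega : j ≤ j + 1).trans h4⟩, rfl, hc.symm, rfl⟩
  have hP' : D.IsEntry (.inl (D.src k)) (c', j + 1) ⟨i', j + 1, k'⟩ :=
    isEntry_inl.2 ⟨mem_points_shape.2 ⟨h1', h2', (by omega : 1 ≤ j + 1),
      h4.trans_eq (congrArg D.shape.mS ht'.symm)⟩, ht', hc'.symm, rfl⟩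
  obtain ⟨N', hM⟩ := F.exists_moved hQ.transpose
  have hb : D.preim (.inl (D.src k)) C ∩ (Finset.Icc c c' ×ˢ Finset.Icc j (j + 1)) =
      {(c, j), (c, j + 1), (c', j)} := by
    ext ⟨x, y⟩
    simp only [Finset.mem_inter, Finset.mem_product, Finset.mem_Icc, Finset.mem_insert,
      Finset.mem_singleton, Prod.mk.injEq, mem_preim_inl hN]
    have hlt := F.lt
    constructor
    · rintro ⟨H, ⟨a1, a2⟩, a3, a4⟩
      have := (F.crossAt_iff hQ.transpose a3 a4 a1 a2).1 H
      omega
    · intro H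
      have hbd : (c ≤ x ∧ x ≤ c') ∧ j ≤ y ∧ y ≤ j + 1 := by omega
      exact ⟨(F.crossAt_iff hQ.transpose hbd.2.1 hbd.2.2 hbd.1.1 hbd.1.2).2 (by omega), hbd⟩
  obtain ⟨b1, b2, b3⟩ := chuteIn_of_block hQ hN.uCompatible.1 h5 F.lt
    (by rw [cast_numRows]; exact h6) h3 (by omega) h4 hP hP' hb
  exact ⟨N'.transpose, _, _, hN.of_moved_transpose hQ hM hP hP', b1, b2,
    hP.lt hQ hP' F.lt (by omega), .inr ⟨D.src k, c, c', j, b3⟩⟩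

/-- The number of pairs of a point of `C` and a smaller point of `L`. -/
noncomputable def weight (C : Finset (PagePoint D.r)) : ℕ := ∑ P ∈ C, (D.points.filter (· < P)).card

/-- The larger point dominates every point below the smaller one and also the smaller point itself.
-/
theorem weight_lt {C : Finset (PagePoint D.r)} {P P' : PagePoint D.r} (hP : P ∈ C) (hP' : P' ∉ C)
    (hPL : P ∈ D.points) (h : P < P') : weight C < weight (insert P' (C.erase P)) := by
  unfold weight
  rw [Finset.sum_insert (by simp [hP']), ← Finset.add_sum_erase _ _ hP]
  refine Nat.add_lt_add_right (Finset.card_lt_card ?_) _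
  refine Finset.ssubset_iff_subset_ne.2 ⟨fun R hR => ?_, ?_⟩
  · rw [Finset.mem_filter] at hR ⊢
    exact ⟨hR.1, hR.2.trans h⟩
  intro e
  have : P ∈ D.points.filter (· < P') := by simp [hPL, h]
  rw [← e] at this
  simp at this

/-- Every concurrent vertex map is obtained by chute moves from the one of a net without free
corners. -/
theorem exists_reduced (hD : D.Admissible) {C : Finset (PagePoint D.r)}
    (hC : D.IsConcurrent C) : ∃ (N : D.shape.Net) (C₀ : Finset (PagePoint D.r)),
      Represents N C₀ ∧ N.Reduced ∧ N.transpose.Reduced ∧ Relation.ReflTransGen D.ChuteMove C₀ C := by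
  have hQ := hD.regular
  -- An element of maximal weight in this finite set has no free corner, for otherwise an inverse
  -- chute move would give a heavier element of the set.
  let A : Set (Finset (PagePoint D.r)) :=
    {C' | (∃ N : D.shape.Net, Represents N C') ∧ Relation.ReflTransGen D.ChuteMove C' C}
  have hA : A.Finite := by
    refine (D.points.powerset.finite_toSet).subset ?_
    rintro C' ⟨⟨N, hN⟩, -⟩
    simpa using hN.uCompatible.1
  obtain ⟨C₀, ⟨⟨N, hN⟩, hR⟩, hmax⟩ := Set.exists_max_image A weight hA
    ⟨C, (isConcurrent_iff hD).1 hC, .refl⟩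
  have key : ∀ (N' : D.shape.Net) (P P' : PagePoint D.r),
      Represents N' (insert P' (C₀.erase P)) → P ∈ C₀ → P' ∉ C₀ → P < P' →
        D.ChuteMove (insert P' (C₀.erase P)) C₀ → False := by
    intro N' P P' hN' hP hP' hlt hch
    have h1 := hmax _ ⟨⟨N', hN'⟩, .head hch hR⟩
    have h2 := weight_lt hP hP' (hN.uCompatible.1 hP) hlt
    omega
  refine ⟨N, C₀, hN, ?_, ?_, hR⟩
  · intro α p i c c' F
    obtain ⟨N', P, P', h⟩ := exists_horizontal_chute hQ hN F
    exact key N' P P' h.1 h.2.1 h.2.2.1 h.2.2.2.1 h.2.2.2.2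
  · intro β q j c c' F
    obtain ⟨N', P, P', h⟩ := exists_vertical_chute hQ hN F
    exact key N' P P' h.1 h.2.1 h.2.2.1 h.2.2.2.1 h.2.2.2.2

end BipartiteDatum

/-! ### The greedy set -/

namespace BipartiteDatum

open PageShape

variable {S T : Type*} [DecidableEq S] [DecidableEq T] {D : BipartiteDatum S T}

theorem exists_represents (N : D.shape.Net) : ∃ C, Represents N C := by
  classical
  refine ⟨D.points.filter fun P => N.Cross P.page P.row P.col, fun P => ?_⟩
  rw [Finset.mem_filter]
  exact ⟨And.right, fun h => ⟨cross_mem_points h, h⟩⟩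

theorem Represents.unique {N N' : D.shape.Net} {C C' : Finset (PagePoint D.r)}
    (h : Represents N C) (h' : Represents N' C')
    (e : ∀ k i j, N.Cross k i j ↔ N'.Cross k i j) : C = C' :=
  Finset.ext fun P => by rw [h, h', e]

/-- The chain consists of P and the lower ends of the u_α hooks, which are crossing points on
possibly different pages and all larger than P. -/
theorem hasDiagonalChain_insert (hQ : D.shape.Regular) {C : Finset (PagePoint D.r)}
    (hC : Represents (extremalNet hQ) C) {P : PagePoint D.r} (hP : P ∈ D.points)
    (h : D.shape.ChainSE P.page P.row P.col) :
    HasDiagonalChain (D.preim (.inr (D.tgt P.page)) (insert P {R ∈ C | P < R}))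
      (D.u (.inr (D.tgt P.page)) + 1) := by
  -- The column is made a total function of p; outside 1 ≤ p ≤ u_α it takes the dummy value 0.
  have hc : ∀ p : ℤ, ∃ c, 1 ≤ p → p ≤ D.shape.uT (D.tgt P.page) →
      D.shape.IsHookCol (D.tgt P.page) p c := by
    intro p
    by_cases hp : 1 ≤ p ∧ p ≤ D.shape.uT (D.tgt P.page)
    · obtain ⟨c, hc⟩ := exists_isHookCol hQ hp.1 hp.2
      exact ⟨c, fun _ _ => hc⟩
    · exact ⟨0, fun h1 h2 => absurd ⟨h1, h2⟩ hp⟩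
  choose c hc using hc
  have hPe : D.IsEntry (.inr (D.tgt P.page)) (P.row, P.col + D.shape.colOff P.page) P :=
    isEntry_inr.2 ⟨hP, rfl, rfl, rfl⟩
  refine hasDiagonalChain_cons (x := (P.row, P.col + D.shape.colOff P.page))
    (g := fun p => (D.shape.mT (D.tgt P.page) - D.shape.uT (D.tgt P.page) + p, c p))
    (mem_preim.2 ⟨P, Finset.mem_insert_self _ _, hPe.2⟩) (fun p h1 h2 => ?_)
    fun p p' h1 h2 h3 => ⟨by simpa using h2,
      (hc p h1 (h2.le.trans h3)).lt hQ (hc p' (h1.trans h2.le) h3) h2⟩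
  have hr : P.row < D.shape.mT (D.tgt P.page) - D.shape.uT (D.tgt P.page) + p := by
    have := h.1
    simp only at this ⊢
    omega
  have hcol : P.col + D.shape.colOff P.page < c p := by
    have h4 := h.2 _ (hc 1 le_rfl (h1.trans h2))
    rcases h1.lt_or_eq with h1 | rfl
    · exact h4.trans ((hc 1 le_rfl (h1.le.trans h2)).lt hQ (hc p h1.le h2) h1)
    · exact h4
  refine ⟨?_, hr, hcol⟩
  obtain ⟨k, q, K, e⟩ := hc p h1 h2
  have ht := K.tgt_eq
  simp only
  rw [e]
  rw [e] at hcol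
  clear e
  -- The target is freed so that it can be rewritten as the target of the page k carrying the hook.
  generalize D.tgt P.page = α at *
  subst ht
  have hX := cross_of_isThread hQ h1 h2 K
  have hR : D.IsEntry (.inr (D.tgt k)) _ ⟨_, _, k⟩ :=
    isEntry_inr.2 ⟨cross_mem_points (P := ⟨_, _, k⟩) hX, rfl, rfl, rfl⟩
  exact mem_preim.2 ⟨_, Finset.mem_insert_of_mem (Finset.mem_filter.2
    ⟨(hC ⟨_, _, k⟩).2 hX, hPe.lt hQ hR hr hcol⟩), hR.2⟩

theorem hasDiagonalChain_insert_transpose (hQ : D.shape.Regular) {C : Finset (PagePoint D.r)}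
    (hC : Represents (extremalNet hQ) C) {P : PagePoint D.r} (hP : P ∈ D.points)
    (h : D.shape.transpose.ChainSE P.page P.col P.row) :
    HasDiagonalChain (D.preim (.inl (D.src P.page)) (insert P {R ∈ C | P < R}))
      (D.u (.inl (D.src P.page)) + 1) := by
  have hc : ∀ p : ℤ, ∃ c, 1 ≤ p → p ≤ D.shape.uS (D.src P.page) →
      D.shape.transpose.IsHookCol (D.src P.page) p c := by
    intro p
    by_cases hp : 1 ≤ p ∧ p ≤ D.shape.uS (D.src P.page)
    · obtain ⟨c, hc⟩ := exists_isHookCol hQ.transpose hp.1 hp.2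
      exact ⟨c, fun _ _ => hc⟩
    · exact ⟨0, fun h1 h2 => absurd ⟨h1, h2⟩ hp⟩
  choose c hc using hc
  have hPe : D.IsEntry (.inl (D.src P.page)) (P.row + D.shape.rowOff P.page, P.col) P :=
    isEntry_inl.2 ⟨hP, rfl, rfl, rfl⟩
  refine hasDiagonalChain_cons (x := (P.row + D.shape.rowOff P.page, P.col))
    (g := fun p => (c p, D.shape.mS (D.src P.page) - D.shape.uS (D.src P.page) + p))
    (mem_preim.2 ⟨P, Finset.mem_insert_self _ _, hPe.2⟩) (fun p h1 h2 => ?_)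
    fun p p' h1 h2 h3 => ⟨(hc p h1 (h2.le.trans h3)).lt hQ.transpose
      (hc p' (h1.trans h2.le) h3) h2, by simpa using h2⟩
  have hr : P.col < D.shape.mS (D.src P.page) - D.shape.uS (D.src P.page) + p := by
    have := h.1
    simp only at this ⊢
    omega
  have hcol : P.row + D.shape.rowOff P.page < c p := by
    have h4 := h.2 _ (hc 1 le_rfl (h1.trans h2))
    rcases h1.lt_or_eq with h1 | rfl
    · exact h4.trans ((hc 1 le_rfl (h1.le.trans h2)).lt hQ.transpose (hc p h1.le h2) h1)
    · exact h4
  refine ⟨?_, hcol, hr⟩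
  obtain ⟨k, q, K, e⟩ := hc p h1 h2
  have ht : D.src k = _ := K.tgt_eq
  simp only
  rw [e]
  rw [e] at hcol
  clear e
  generalize D.src P.page = β at *
  subst ht
  have hX : (extremalNet hQ).Cross k _ _ :=
    Net.cross_transpose.1 (cross_of_isThread hQ.transpose h1 h2 K)
  have hR : D.IsEntry (.inl (D.src k)) _ ⟨_, _, k⟩ :=
    isEntry_inl.2 ⟨cross_mem_points (P := ⟨_, _, k⟩) hX, rfl, rfl, rfl⟩
  exact mem_preim.2 ⟨_, Finset.mem_insert_of_mem (Finset.mem_filter.2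
    ⟨(hC ⟨_, _, k⟩).2 hX, hPe.lt hQ hR hcol hr⟩), hR.2⟩

theorem cast_laterSum_tgt (k : Fin D.r) :
    (D.laterSum (.inr (D.tgt k)) k : ℤ) = D.shape.tail k :=
  Nat.cast_sum _ _

theorem cast_laterSum_src (k : Fin D.r) :
    (D.laterSum (.inl (D.src k)) k : ℤ) = D.shape.transpose.tail k :=
  Nat.cast_sum _ _

theorem mem_initialRegion {P : PagePoint D.r} : P ∈ D.initialRegion ↔ P ∈ D.points ∧
    D.shape.RegionT P.page P.row P.col ∧ D.shape.transpose.RegionT P.page P.col P.row := by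
  unfold initialRegion RegionT
  rw [Finset.mem_filter]
  simp only [cast_laterSum_tgt, cast_laterSum_src]
  refine and_congr_right fun _ => and_congr_right fun _ => or_comm

theorem not_uCompatible_insert (hQ : D.shape.Regular) {C : Finset (PagePoint D.r)}
    (hC : Represents (extremalNet hQ) C) {P : PagePoint D.r} (hP : P ∈ D.points)
    (h : P ∉ D.initialRegion) : ¬ D.UCompatible (insert P {R ∈ C | P < R}) := by
  intro hc
  have hb := mem_points_shape.1 hP
  rcases chainSE_of_not_region hQ hb.2.1 hb.2.2.2
    (fun h' => h (mem_initialRegion.2 ⟨hP, h'⟩)) with h' | h'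
  · exact hc.2 _ (hasDiagonalChain_insert hQ hC hP h')
  · exact hc.2 _ (hasDiagonalChain_insert_transpose hQ hC hP h')

/-- A crossing point outside the region would complete a diagonal chain inside the crossing set,
which is compatible. So the reverse inclusion needs no separate geometric argument. -/
theorem initialRegion_eq (hQ : D.shape.Regular) {C : Finset (PagePoint D.r)}
    (hC : Represents (extremalNet hQ) C) : D.initialRegion = C := by
  ext P
  constructor
  · intro h
    rw [mem_initialRegion, mem_points_shape] at h
    exact (hC P).2 (extremalNet_cross_of_region hQ h.1.1 h.1.2.1 h.1.2.2.1 h.1.2.2.2 h.2.1 h.2.2)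
  · intro h
    by_contra hn
    refine not_uCompatible_insert hQ hC (hC.uCompatible.1 h) hn
      (hC.uCompatible.mono (Finset.insert_subset h (Finset.filter_subset _ _)))

theorem cMax_eq_initialRegion (hQ : D.shape.Regular) : D.cMax ∅ = D.initialRegion := by
  obtain ⟨C, hC⟩ := exists_represents (extremalNet hQ)
  have e := initialRegion_eq hQ hC
  rw [e]
  exact cMax_eq hC.uCompatible fun P hP h => not_uCompatible_insert hQ hC hP (e ▸ h)

theorem represents_cMax (hQ : D.shape.Regular) : Represents (extremalNet hQ) (D.cMax ∅) := by
  obtain ⟨C, hC⟩ := exists_represents (extremalNet hQ)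
  rwa [cMax_eq_initialRegion hQ, initialRegion_eq hQ hC]

theorem reflTransGen_cMax (hD : D.Admissible) {C : Finset (PagePoint D.r)}
    (hC : D.IsConcurrent C) : Relation.ReflTransGen D.ChuteMove (D.cMax ∅) C := by
  obtain ⟨N, C₀, hN, h1, h2, h⟩ := exists_reduced hD hC
  rwa [(represents_cMax hD.regular).unique hN
    fun k i j => (Net.cross_iff_of_reduced hD.regular h1 h2).symm]

end BipartiteDatum

/-! ### Rotation by a half turn -/

theorem LatticePath.rotate {M : ℤ → ℤ → Prop} {i₀ j₀ i₁ j₁ : ℤ} (h : LatticePath M i₀ j₀ i₁ j₁)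
    (a b : ℤ) : LatticePath (fun i j => M (a - i) (b - j)) (a - i₁) (b - j₁) (a - i₀) (b - j₀) where
  start := by simpa using h.fin
  fin := by simpa using h.start
  next {i j} H := by
    rcases h.prev H with h | h | h
    · exact .inl (by omega)
    · exact .inr (.inl (by rwa [show b - (j + 1) = b - j - 1 by ring]))
    · exact .inr (.inr (by rwa [show a - (i - 1) = a - i + 1 by ring]))
  prev {i j} H := by
    rcases h.next H with h | h | h
    · exact .inl (by omega)
    · exact .inr (.inl (by rwa [show b - (j - 1) = b - j + 1 by ring]))
    · exact .inr (.inr (by rwa [show a - (i + 1) = a - i - 1 by ring]))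
  diag H H' e := by have := h.diag H H' (by omega); omega
  lower H := by have := h.upper H; omega
  upper H := by have := h.lower H; omega

namespace PageShape

variable {S T : Type*} [DecidableEq S] [DecidableEq T] {r : ℕ} {src src' : Fin r → S}
  {tgt tgt' : Fin r → T} {mS uS : S → ℤ} {mT uT : T → ℤ}

/-- The reversed arrows are arbitrary functions related pointwise to the given ones. This relation
is symmetric, so rotating back returns literally to the original datum. -/
theorem width_rotate (hs : ∀ k, src' k = src k.rev) (ht : ∀ k, tgt' k = tgt k.rev) (α : T) :
    (PageShape.mk r src' tgt' mS mT uS uT).width α = (PageShape.mk r src tgt mS mT uS uT).width α := by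
  refine Finset.sum_equiv Fin.revPerm (fun k => ?_) fun k _ => ?_ <;> simp [hs, ht]

theorem colOff_rotate (hs : ∀ k, src' k = src k.rev) (ht : ∀ k, tgt' k = tgt k.rev) (k : Fin r) :
    (PageShape.mk r src' tgt' mS mT uS uT).colOff k + (PageShape.mk r src tgt mS mT uS uT).colOff k.rev + mS (src' k) =
      (PageShape.mk r src tgt mS mT uS uT).width (tgt' k) := by
  have h : (PageShape.mk r src' tgt' mS mT uS uT).colOff k =
      ∑ l with k.rev < l ∧ tgt l = tgt k.rev, mS (src l) := by
    refine Finset.sum_equiv Fin.revPerm (fun l => ?_) fun l _ => ?_ <;> simp [hs, ht]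
  rw [h, ht, hs]
  have := sum_below_add_above (fun l => tgt l = tgt k.rev) (fun l => mS (src l)) (k := k.rev) rfl
  simp only [colOff, width]
  linarith

namespace Net

/-- A family of paths, rotated by a half turn. -/
def rotateIn {A : Type*} (F : A → ℤ → ℤ → ℤ → Prop) (u m w : A → ℤ) : A → ℤ → ℤ → ℤ → Prop :=
  fun a p i y => F a (u a + 1 - p) (m a + 1 - i) (w a + 1 - y)

variable (N : (PageShape.mk r src tgt mS mT uS uT).Net)

theorem rotateIn_page (hs : ∀ k, src' k = src k.rev) (ht : ∀ k, tgt' k = tgt k.rev) {k : Fin r}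
    {p i j : ℤ} : rotateIn N.h uT mT (PageShape.mk r src tgt mS mT uS uT).width (tgt' k) p i
        (j + (PageShape.mk r src' tgt' mS mT uS uT).colOff k) ↔
      N.hp k.rev (uT (tgt' k) + 1 - p) (mT (tgt' k) + 1 - i) (mS (src' k) + 1 - j) := by
  unfold rotateIn
  have e : (PageShape.mk r src tgt mS mT uS uT).width (tgt' k) + 1 -
      (j + (PageShape.mk r src' tgt' mS mT uS uT).colOff k) =
      mS (src' k) + 1 - j + (PageShape.mk r src tgt mS mT uS uT).colOff k.rev := by
    have := colOff_rotate (mS := mS) (mT := mT) (uS := uS) (uT := uT) hs ht k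
    linarith
  rw [e, ht]

theorem rotateIn_corner (hs : ∀ k, src' k = src k.rev) (ht : ∀ k, tgt' k = tgt k.rev) {k : Fin r}
    {p i j : ℤ} (h1 : 1 ≤ j) (h2 : j ≤ mS (src' k))
    (H : rotateIn N.h uT mT (PageShape.mk r src tgt mS mT uS uT).width (tgt' k) p i
        (j + (PageShape.mk r src' tgt' mS mT uS uT).colOff k))
    (H1 : rotateIn N.h uT mT (PageShape.mk r src tgt mS mT uS uT).width (tgt' k) p i
        (j + 1 + (PageShape.mk r src' tgt' mS mT uS uT).colOff k) ∨
      rotateIn N.h uT mT (PageShape.mk r src tgt mS mT uS uT).width (tgt' k) p i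
        (j - 1 + (PageShape.mk r src' tgt' mS mT uS uT).colOff k))
    (H2 : rotateIn N.h uT mT (PageShape.mk r src tgt mS mT uS uT).width (tgt' k) p (i + 1)
        (j + (PageShape.mk r src' tgt' mS mT uS uT).colOff k) ∨
      rotateIn N.h uT mT (PageShape.mk r src tgt mS mT uS uT).width (tgt' k) p (i - 1)
        (j + (PageShape.mk r src' tgt' mS mT uS uT).colOff k)) :
    ∃ q, rotateIn N.transpose.h uS mS (PageShape.mk r src tgt mS mT uS uT).height (src' k) q j
        (i + (PageShape.mk r src' tgt' mS mT uS uT).rowOff k) := by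
  rw [rotateIn_page N hs ht] at H
  rw [rotateIn_page N hs ht, rotateIn_page N hs ht] at H1 H2
  obtain ⟨q, hq⟩ := N.h_corner (k := k.rev) (by omega) (by simp only [← hs]; omega) H
    (H1.symm.imp (by intro h; convert h using 2; ring) (by intro h; convert h using 2; ring))
    (H2.symm.imp (by intro h; convert h using 1; ring) (by intro h; convert h using 1; ring))
  refine ⟨uS (src' k) + 1 - q, ?_⟩
  rw [rotateIn_page N.transpose ht hs]
  convert hq using 1
  · rw [sub_sub_cancel]

theorem exists_rotate (hs : ∀ k, src' k = src k.rev) (ht : ∀ k, tgt' k = tgt k.rev) :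
    ∃ N' : (PageShape.mk r src' tgt' mS mT uS uT).Net, ∀ k i j,
      N'.Cross k i j ↔ N.Cross k.rev (mT (tgt' k) + 1 - i) (mS (src' k) + 1 - j) := by
  refine ⟨{ h := rotateIn N.h uT mT (PageShape.mk r src tgt mS mT uS uT).width
            v := fun β q x j =>
              rotateIn N.transpose.h uS mS (PageShape.mk r src tgt mS mT uS uT).height β q j x
            h_path := ?_
            v_path := ?_
            h_index := ?_
            v_index := ?_
            h_inj := ?_
            v_inj := ?_
            h_corner := rotateIn_corner N hs ht
            v_corner := rotateIn_corner N.transpose ht hs }, ?_⟩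
  · intro α p h1 h2
    have := (N.h_path α (uT α + 1 - p) (by simp only at h2; omega) (by simp only; omega)).rotate (mT α + 1)
      ((PageShape.mk r src tgt mS mT uS uT).width α + 1)
    rw [width_rotate hs ht]
    convert this using 1 <;> first | rfl | ring1
  · intro β q h1 h2
    have := ((N.v_path β (uS β + 1 - q) (by simp only at h2; omega) (by simp only; omega)).rotate
      ((PageShape.mk r src tgt mS mT uS uT).height β + 1) (mS β + 1))
    rw [height, width_rotate ht hs]
    convert this using 1 <;> first | rfl | ring1
  · intro α p i j h
    have := N.h_index h
    simp only at this ⊢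
    omega
  · intro α p i j h
    have := N.v_index h
    simp only at this ⊢
    omega
  · intro α p p' i j h h'
    have := N.h_inj h h'
    omega
  · intro α p p' i j h h'
    have := N.v_inj h h'
    omega
  · intro k i j
    unfold Cross
    refine and_congr ?_ ?_
    · change (∃ p, rotateIn N.h uT mT _ (tgt' k) p i _) ↔ _
      simp only [rotateIn_page N hs ht]
      -- The half turn reverses the order of the paths: p becomes u + 1 - p.
      exact (Equiv.subLeft (uT (tgt' k) + 1)).exists_congr_left.trans (by simp)
    · change (∃ q, rotateIn N.transpose.h uS mS _ (src' k) q j _) ↔ _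
      simp only [rotateIn_page N.transpose ht hs]
      exact (Equiv.subLeft (uS (src' k) + 1)).exists_congr_left.trans (by simp)

end Net
end PageShape

theorem HasDiagonalChain.rotate {A B : Finset (ℤ × ℤ)} {s : ℕ} (a b : ℤ)
    (h : ∀ x y, (x, y) ∈ A → (a - x, b - y) ∈ B) (hA : HasDiagonalChain A s) :
    HasDiagonalChain B s := by
  obtain ⟨f, h1, h2, h3⟩ := hA
  refine ⟨fun t => (a - (f t.rev).1, b - (f t.rev).2), fun t t' htt => ?_, fun t t' htt => ?_,
    fun t => h _ _ (h3 t.rev)⟩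
  · have := h1 (Fin.rev_lt_rev.2 htt)
    simp only at this ⊢
    omega
  · have := h2 (Fin.rev_lt_rev.2 htt)
    simp only at this ⊢
    omega

namespace BipartiteDatum

variable {S T : Type*} [DecidableEq S] [DecidableEq T] {D : BipartiteDatum S T}
  {src' : Fin D.r → S} {tgt' : Fin D.r → T}

variable (D) in
/-- Rotate every page by a half turn and reverse the order of the pages. -/
def rotatePoint (P : PagePoint D.r) : PagePoint D.r :=
  ⟨D.m (.inr (D.tgt P.page)) + 1 - P.row, D.m (.inl (D.src P.page)) + 1 - P.col, P.page.rev⟩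

theorem rotatePoint_lt {P P' : PagePoint D.r} (h : P < P') : D.rotatePoint P' < D.rotatePoint P := by
  rw [PagePoint.lt_iff] at h ⊢
  simp only [rotatePoint, Fin.rev_lt_rev, Fin.rev_inj]
  rcases h with h | ⟨e, h⟩ | ⟨e, e', h⟩
  · exact .inl h
  · exact .inr (.inl ⟨e.symm, by rw [e]; omega⟩)
  · exact .inr (.inr ⟨e.symm, by rw [e, e'], by rw [e]; omega⟩)

theorem rotatePoint_rotatePoint (hs : ∀ k, src' k = D.src k.rev) (ht : ∀ k, tgt' k = D.tgt k.rev)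
    (P : PagePoint D.r) :
    (mk D.r src' tgt' D.m D.u).rotatePoint (D.rotatePoint P) = P := by
  ext <;> simp [rotatePoint, hs, ht]

theorem rotatePoint_rotatePoint' (hs : ∀ k, src' k = D.src k.rev)
    (ht : ∀ k, tgt' k = D.tgt k.rev) (P : PagePoint D.r) :
    D.rotatePoint ((mk D.r src' tgt' D.m D.u).rotatePoint P) = P :=
  rotatePoint_rotatePoint (D := mk D.r src' tgt' D.m D.u) (src' := D.src) (tgt' := D.tgt)
    (fun k => by simp [hs]) (fun k => by simp [ht]) P

theorem mem_image_rotatePoint (hs : ∀ k, src' k = D.src k.rev) (ht : ∀ k, tgt' k = D.tgt k.rev)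
    {C : Finset (PagePoint D.r)} {P : PagePoint D.r} :
    P ∈ C.image D.rotatePoint ↔ (mk D.r src' tgt' D.m D.u).rotatePoint P ∈ C := by
  rw [Finset.mem_image]
  constructor
  · rintro ⟨R, hR, rfl⟩
    rwa [rotatePoint_rotatePoint hs ht]
  · exact fun h => ⟨_, h, rotatePoint_rotatePoint' hs ht P⟩

theorem image_rotatePoint_image (hs : ∀ k, src' k = D.src k.rev)
    (ht : ∀ k, tgt' k = D.tgt k.rev) (C : Finset (PagePoint D.r)) :
    (C.image D.rotatePoint).image (mk D.r src' tgt' D.m D.u).rotatePoint = C := by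
  ext R
  constructor
  · intro h
    obtain ⟨P, hP, rfl⟩ := Finset.mem_image.1 h
    obtain ⟨R, hR, rfl⟩ := Finset.mem_image.1 hP
    rwa [rotatePoint_rotatePoint hs ht]
  · intro h
    exact Finset.mem_image.2
      ⟨_, Finset.mem_image_of_mem _ h, rotatePoint_rotatePoint hs ht R⟩

theorem numRows_rotate (hs : ∀ k, src' k = D.src k.rev) (ht : ∀ k, tgt' k = D.tgt k.rev)
    (γ : S ⊕ T) : (mk D.r src' tgt' D.m D.u).numRows γ = D.numRows γ := by
  rcases γ with β | α
  · refine Finset.sum_equiv Fin.revPerm (fun k => ?_) fun k _ => ?_ <;> simp [hs, ht]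
  · rfl

theorem numCols_rotate (hs : ∀ k, src' k = D.src k.rev) (ht : ∀ k, tgt' k = D.tgt k.rev)
    (γ : S ⊕ T) : (mk D.r src' tgt' D.m D.u).numCols γ = D.numCols γ := by
  rcases γ with β | α
  · rfl
  · refine Finset.sum_equiv Fin.revPerm (fun k => ?_) fun k _ => ?_ <;> simp [hs, ht]

theorem v_rotate (hs : ∀ k, src' k = D.src k.rev) (ht : ∀ k, tgt' k = D.tgt k.rev)
    (γ : S ⊕ T) : (mk D.r src' tgt' D.m D.u).v γ = D.v γ := by
  rcases γ with β | α <;>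
  refine Finset.sum_equiv Fin.revPerm (fun k => ?_) fun k _ => ?_ <;> simp [hs, ht]

theorem Admissible.rotate (hD : D.Admissible) (hs : ∀ k, src' k = D.src k.rev)
    (ht : ∀ k, tgt' k = D.tgt k.rev) : (mk D.r src' tgt' D.m D.u).Admissible := by
  intro γ
  rw [numRows_rotate hs ht, numCols_rotate hs ht, v_rotate hs ht]
  exact hD γ

theorem rotatePoint_mem (hs : ∀ k, src' k = D.src k.rev) (ht : ∀ k, tgt' k = D.tgt k.rev)
    {P : PagePoint D.r} (h : P ∈ D.points) :
    D.rotatePoint P ∈ (mk D.r src' tgt' D.m D.u).points := by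
  rw [mem_points] at h ⊢
  simp only [rotatePoint, hs, ht, Fin.rev_rev]
  omega

theorem IsEntry.rotate (hs : ∀ k, src' k = D.src k.rev) (ht : ∀ k, tgt' k = D.tgt k.rev)
    {γ : S ⊕ T} {x y : ℤ} {P : PagePoint D.r} (h : D.IsEntry γ (x, y) P) :
    (mk D.r src' tgt' D.m D.u).IsEntry γ (D.numRows γ + 1 - x, D.numCols γ + 1 - y)
      (D.rotatePoint P) := by
  rcases γ with β | α
  · rw [isEntry_inl] at h ⊢
    obtain ⟨h, rfl, rfl, rfl⟩ := h
    refine ⟨rotatePoint_mem hs ht h, (hs _).trans (by simp [rotatePoint]), ?_, rfl⟩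
    have e := PageShape.colOff_rotate (mS := D.shape.mT) (mT := D.shape.mS) (uS := D.shape.uT)
      (uT := D.shape.uS) ht hs P.page.rev
    rw [hs, ht, Fin.rev_rev] at e
    rw [cast_numRows]
    change D.shape.mT (D.tgt P.page) + 1 - P.row + _ = _
    change _ + D.shape.rowOff P.page + D.shape.mT (D.tgt P.page) = D.shape.height _ at e
    rw [← e]
    change _ + (PageShape.mk D.r tgt' src' D.shape.mT D.shape.mS D.shape.uT D.shape.uS).colOff
      P.page.rev = _
    ring
  · rw [isEntry_inr] at h ⊢
    obtain ⟨h, rfl, rfl, rfl⟩ := h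
    refine ⟨rotatePoint_mem hs ht h, (ht _).trans (by simp [rotatePoint]), rfl, ?_⟩
    have e := PageShape.colOff_rotate (mS := D.shape.mS) (mT := D.shape.mT) (uS := D.shape.uS)
      (uT := D.shape.uT) hs ht P.page.rev
    rw [hs, ht, Fin.rev_rev] at e
    rw [cast_numCols]
    change D.shape.mS (D.src P.page) + 1 - P.col + _ = _
    change _ + D.shape.colOff P.page + D.shape.mS (D.src P.page) = D.shape.width _ at e
    rw [← e]
    change _ + (PageShape.mk D.r src' tgt' D.shape.mS D.shape.mT D.shape.uS D.shape.uT).colOff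
      P.page.rev = _
    ring

theorem mem_preim_image_of_mem (hs : ∀ k, src' k = D.src k.rev) (ht : ∀ k, tgt' k = D.tgt k.rev)
    {C : Finset (PagePoint D.r)} (hC : C ⊆ D.points) {γ : S ⊕ T} {x y : ℤ}
    (h : (x, y) ∈ D.preim γ C) : (D.numRows γ + 1 - x, D.numCols γ + 1 - y) ∈
      (mk D.r src' tgt' D.m D.u).preim γ (C.image D.rotatePoint) := by
  rw [mem_preim] at h ⊢
  obtain ⟨P, hP, hi, e⟩ := h
  exact ⟨_, Finset.mem_image_of_mem _ hP, (IsEntry.rotate hs ht ⟨hC hP, hi, e⟩).2⟩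

theorem image_subset_points (hs : ∀ k, src' k = D.src k.rev) (ht : ∀ k, tgt' k = D.tgt k.rev)
    {C : Finset (PagePoint D.r)} (hC : C ⊆ D.points) :
    C.image D.rotatePoint ⊆ (mk D.r src' tgt' D.m D.u).points := by
  intro R hR
  obtain ⟨P, hP, rfl⟩ := Finset.mem_image.1 hR
  exact rotatePoint_mem hs ht (hC hP)

theorem rev_symm {A : Type*} {n : ℕ} {f g : Fin n → A} (h : ∀ k, g k = f k.rev) (k : Fin n) :
    f k = g k.rev := by
  rw [h, Fin.rev_rev]

theorem mem_preim_image (hs : ∀ k, src' k = D.src k.rev) (ht : ∀ k, tgt' k = D.tgt k.rev)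
    {C : Finset (PagePoint D.r)} (hC : C ⊆ D.points) {γ : S ⊕ T} {x y : ℤ} :
    (x, y) ∈ (mk D.r src' tgt' D.m D.u).preim γ (C.image D.rotatePoint) ↔
      (D.numRows γ + 1 - x, D.numCols γ + 1 - y) ∈ D.preim γ C := by
  constructor
  · intro h
    have := mem_preim_image_of_mem (D := mk D.r src' tgt' D.m D.u) (rev_symm hs) (rev_symm ht)
      (image_subset_points hs ht hC) h
    rwa [image_rotatePoint_image hs ht, numRows_rotate hs ht, numCols_rotate hs ht] at this
  · intro h
    have := mem_preim_image_of_mem hs ht hC h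
    rwa [sub_sub_cancel, sub_sub_cancel] at this

theorem UCompatible.rotate (hs : ∀ k, src' k = D.src k.rev) (ht : ∀ k, tgt' k = D.tgt k.rev)
    {C : Finset (PagePoint D.r)} (hC : D.UCompatible C) :
    (mk D.r src' tgt' D.m D.u).UCompatible (C.image D.rotatePoint) :=
  ⟨image_subset_points hs ht hC.1, fun γ h =>
    hC.2 γ (h.rotate _ _ fun _ _ => (mem_preim_image hs ht hC.1).1)⟩

theorem IsConcurrent.rotate (hD : D.Admissible) (hs : ∀ k, src' k = D.src k.rev)
    (ht : ∀ k, tgt' k = D.tgt k.rev) {C : Finset (PagePoint D.r)} (hC : D.IsConcurrent C) :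
    (mk D.r src' tgt' D.m D.u).IsConcurrent (C.image D.rotatePoint) := by
  obtain ⟨N, hN⟩ := (isConcurrent_iff hD).1 hC
  obtain ⟨N', hN'⟩ := N.exists_rotate hs ht
  refine (isConcurrent_iff (hD.rotate hs ht)).2 ⟨N', fun P => ?_⟩
  rw [mem_image_rotatePoint hs ht, hN, hN']
  rfl

/-- The pattern NE, SE, SW becomes SW, NW, NE, so `chuteIn_of_block` applies with the roles of the
NW and SE corners exchanged. -/
theorem ChuteIn.rotate (hQ : (mk D.r src' tgt' D.m D.u).shape.Regular)
    (hs : ∀ k, src' k = D.src k.rev) (ht : ∀ k, tgt' k = D.tgt k.rev) {γ : S ⊕ T}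
    {i i' j j' : ℤ} {C C' : Finset (PagePoint D.r)} (hC : C ⊆ D.points)
    (h : D.ChuteIn γ i i' j j' C C') :
    (mk D.r src' tgt' D.m D.u).ChuteIn γ (D.numRows γ + 1 - i') (D.numRows γ + 1 - i)
      (D.numCols γ + 1 - j') (D.numCols γ + 1 - j)
      (C'.image D.rotatePoint) (C.image D.rotatePoint) := by
  obtain ⟨h1, h2, h3, h4, h5, h6, hb, P, R, hP, hR, rfl⟩ := h
  have hne : P ≠ R := by
    rintro rfl
    have := hP.2.2.symm.trans hR.2.2
    rw [Prod.mk.injEq] at this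
    omega
  have key := (chuteIn_of_block hQ (image_subset_points hs ht hC) (by omega)
    (show (D.numRows γ : ℤ) + 1 - i' < D.numRows γ + 1 - i by omega)
    (by rw [numRows_rotate hs ht]; omega) (by omega)
    (show (D.numCols γ : ℤ) + 1 - j' < D.numCols γ + 1 - j by omega)
    (by rw [numCols_rotate hs ht]; omega) (hR.rotate hs ht) (hP.rotate hs ht) (by
      ext ⟨x, y⟩
      have hxy := Finset.ext_iff.1 hb (D.numRows γ + 1 - x, D.numCols γ + 1 - y)
      simp only [Finset.mem_inter, Finset.mem_product, Finset.mem_Icc, Finset.mem_insert,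
        Finset.mem_singleton, Prod.mk.injEq, mem_preim_image hs ht hC] at hxy ⊢
      have e : ((D.numRows γ + 1 - i' ≤ x ∧ x ≤ D.numRows γ + 1 - i) ∧
          D.numCols γ + 1 - j' ≤ y ∧ y ≤ D.numCols γ + 1 - j) ↔
          (i ≤ D.numRows γ + 1 - x ∧ D.numRows γ + 1 - x ≤ i') ∧
          j ≤ D.numCols γ + 1 - y ∧ D.numCols γ + 1 - y ≤ j' := by omega
      rw [e, hxy]
      omega)).2.2
  convert key using 1
  have hinj : Function.Injective D.rotatePoint :=
    Function.LeftInverse.injective (g := (mk D.r src' tgt' D.m D.u).rotatePoint)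
      (rotatePoint_rotatePoint hs ht)
  rw [← Finset.image_erase hinj, ← Finset.image_insert]
  congr 1
  ext X
  simp only [Finset.mem_sdiff, Finset.mem_union, Finset.mem_singleton, Finset.mem_insert,
    Finset.mem_erase]
  constructor
  · rintro ⟨h | h, h'⟩
    exacts [.inr ⟨h', h⟩, .inl h]
  · rintro (rfl | ⟨h', h⟩)
    exacts [⟨.inr rfl, hne⟩, ⟨.inl h, h'⟩]

theorem ChuteMove.rotate (hQ : (mk D.r src' tgt' D.m D.u).shape.Regular)
    (hs : ∀ k, src' k = D.src k.rev) (ht : ∀ k, tgt' k = D.tgt k.rev)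
    {C C' : Finset (PagePoint D.r)} (hC : C ⊆ D.points) (h : D.ChuteMove C C') :
    (mk D.r src' tgt' D.m D.u).ChuteMove (C'.image D.rotatePoint) (C.image D.rotatePoint) := by
  rcases h with ⟨α, i, j, j', h⟩ | ⟨β, i, i', j, h⟩
  · refine .inl ⟨α, D.numRows (.inr α) + 1 - (i + 1), D.numCols (.inr α) + 1 - j',
      D.numCols (.inr α) + 1 - j, ?_⟩
    convert h.rotate hQ hs ht hC using 1
    ring
  · refine .inr ⟨β, D.numRows (.inl β) + 1 - i', D.numRows (.inl β) + 1 - i,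
      D.numCols (.inl β) + 1 - (j + 1), ?_⟩
    convert h.rotate hQ hs ht hC using 1
    ring

theorem ChuteMove.subset_points {C C' : Finset (PagePoint D.r)} (h : D.ChuteMove C C')
    (hC : C ⊆ D.points) : C' ⊆ D.points := by
  have key : ∀ γ i i' j j', D.ChuteIn γ i i' j j' C C' → C' ⊆ D.points := by
    rintro γ i i' j j' ⟨-, -, -, -, -, -, -, P, R, hP, -, rfl⟩
    exact Finset.sdiff_subset.trans (Finset.union_subset hC (by simpa using hP.1))
  rcases h with ⟨α, i, j, j', h⟩ | ⟨β, i, i', j, h⟩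
  exacts [key _ _ _ _ _ h, key _ _ _ _ _ h]

theorem reflTransGen_rotate (hQ : (mk D.r src' tgt' D.m D.u).shape.Regular)
    (hs : ∀ k, src' k = D.src k.rev) (ht : ∀ k, tgt' k = D.tgt k.rev)
    {C C' : Finset (PagePoint D.r)} (hC : C ⊆ D.points)
    (h : Relation.ReflTransGen D.ChuteMove C C') :
    Relation.ReflTransGen (mk D.r src' tgt' D.m D.u).InverseChuteMove (C.image D.rotatePoint)
      (C'.image D.rotatePoint) := by
  suffices C' ⊆ D.points ∧ Relation.ReflTransGen (mk D.r src' tgt' D.m D.u).InverseChuteMove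
      (C.image D.rotatePoint) (C'.image D.rotatePoint) from this.2
  induction h with
  | refl => exact ⟨hC, .refl⟩
  | tail _ h ih => exact ⟨h.subset_points ih.1, ih.2.tail (h.rotate hQ hs ht ih.1)⟩

/-- The half turn preserves compatibility and reverses <_T. A point that is blocked by larger points
in one datum is therefore blocked by smaller points in the other, and this is the certificate that
`cMin_eq` asks for. -/
theorem cMin_eq_image_cMax (hQ : D.shape.Regular)
    (hs : ∀ k, src' k = D.src k.rev) (ht : ∀ k, tgt' k = D.tgt k.rev) :
    (mk D.r src' tgt' D.m D.u).cMin ∅ = (D.cMax ∅).image D.rotatePoint := by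
  have hR := represents_cMax hQ
  refine cMin_eq (hR.uCompatible.rotate hs ht) fun P hP hPC hc => ?_
  rw [mem_image_rotatePoint hs ht] at hPC
  refine not_uCompatible_insert hQ hR (rotatePoint_mem (D := mk D.r src' tgt' D.m D.u)
    (rev_symm hs) (rev_symm ht) hP) (cMax_eq_initialRegion hQ ▸ hPC) ?_
  refine (hc.rotate (rev_symm hs) (rev_symm ht)).mono ?_
  intro R hR
  rw [mem_image_rotatePoint (rev_symm hs) (rev_symm ht), Finset.mem_insert, Finset.mem_filter,
    mem_image_rotatePoint hs ht]
  rw [Finset.mem_insert, Finset.mem_filter] at hR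
  rcases hR with rfl | ⟨h, h'⟩
  · exact .inl (rotatePoint_rotatePoint' hs ht P)
  · refine .inr ⟨?_, ?_⟩
    · rw [rotatePoint_rotatePoint hs ht]
      exact h
    · have := rotatePoint_lt (D := D) h'
      rw [rotatePoint_rotatePoint' hs ht] at this
      exact this

end BipartiteDatum

/-! ### The proposition -/

open BipartiteDatum in
theorem mainTheorem9 {S T : Type*} [Finite S] [Finite T] [DecidableEq S] [DecidableEq T]
    (D : BipartiteDatum S T) (hD : D.Admissible) :
    (D.IsConcurrent (D.cMax ∅) ∧ D.cMax ∅ = D.initialRegion ∧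
      ∀ C, D.IsConcurrent C → Relation.ReflTransGen D.ChuteMove (D.cMax ∅) C) ∧
    (D.IsConcurrent (D.cMin ∅) ∧
      ∀ C, D.IsConcurrent C → Relation.ReflTransGen D.InverseChuteMove (D.cMin ∅) C) := by
  -- The given datum is viewed as the rotation of the reversed one, so C_min here is the rotated
  -- C_max there.
  have hs : ∀ k, D.src k = (fun k => D.src k.rev) k.rev := fun k => by simp
  have ht : ∀ k, D.tgt k = (fun k => D.tgt k.rev) k.rev := fun k => by simp
  have hD' := hD.rotate (src' := fun k => D.src k.rev) (tgt' := fun k => D.tgt k.rev)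
    (fun _ => rfl) fun _ => rfl
  have hmax := (isConcurrent_iff hD').2 ⟨_, represents_cMax hD'.regular⟩
  have e : D.cMin ∅ = _ := cMin_eq_image_cMax
    (D := mk D.r (fun k => D.src k.rev) (fun k => D.tgt k.rev) D.m D.u) hD'.regular hs ht
  refine ⟨⟨(isConcurrent_iff hD).2 ⟨_, represents_cMax hD.regular⟩,
    cMax_eq_initialRegion hD.regular, fun C hC => reflTransGen_cMax hD hC⟩, ?_, fun C hC => ?_⟩
  · rw [e]
    exact hmax.rotate hD' hs ht
  · rw [e]
    have h := reflTransGen_cMax hD' (hC.rotate hD (src' := fun k => D.src k.rev)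
      (tgt' := fun k => D.tgt k.rev) (fun _ => rfl) fun _ => rfl)
    have h' := reflTransGen_rotate
      (D := mk D.r (fun k => D.src k.rev) (fun k => D.tgt k.rev) D.m D.u) hD.regular hs ht
      (represents_cMax hD'.regular).uCompatible.1 h
    have e' : (C.image D.rotatePoint).image _ = C :=
      image_rotatePoint_image (src' := fun k => D.src k.rev) (tgt' := fun k => D.tgt k.rev)
        (fun _ => rfl) (fun _ => rfl) C
    exact e' ▸ h'
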